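/- Let $q$ be a real-valued measurable function on $(0,\infty)$ with $\int_0^\infty (1+x)|q(x)|\,dx<\infty$. For $\operatorname{Im}k\ge 0$ there is exactly one function $f(\cdot,k)$ on $[0,\infty)$ (the Jost solution) that has a locally absolutely continuous derivative $f'=\partial_x f$, satisfies $-f''+q(x)f=k^2f$ for almost every $x>0$, and satisfies $e^{-ikx}f(x,k)\to 1$ as $x\to+\infty$. Put $f(k):=f(0,k)$ (the Jost function) and $I(k):=f'(0,k)/f(k)$. (a) Let $k_j>0$, $1\le j\le J$, be the numbers such that $-k_j^2$ are the negative eigenvalues of $-\frac{d^2}{dx^2}+q$ in $L^2(0,\infty)$ with the boundary condition $u(0)=0$. Then $J<\infty$, the function $I$ is meromorphic in $\mathbb C_+=\{z\in\mathbb C:\operatorname{Im}z>0\}$, and its poles in $\mathbb C_+$ are exactly the points $ik_j$, $1\le j\le J$, all of them simple. (b) One has $s/\operatorname{Im}I(s)>0$ for all real $s\neq 0$. Put $w(z):=\prod_{j=1}^J\frac{z-ik_j}{z+ik_j}$. Then, for all $z$ with $\operatorname{Im}z>0$, $$f(z)=w(z)\,\exp\left(\frac1{2\pi i}\int_{-\infty}^\infty\frac{\ln\frac{s}{\operatorname{Im}I(s)}}{s-z}\,ds\right),$$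 where the integral converges absolutely. (c) If $f(0)=0$, put $w_1(z):=\frac{z}{z+i}\,w(z)$. Then also, for all $z$ with $\operatorname{Im}z>0$, $$f(z)=w_1(z)\,\exp\left(\frac1{2\pi i}\int_{-\infty}^\infty\frac{\ln\frac{s^2+1}{s\operatorname{Im}I(s)}}{s-z}\,ds\right),$$ where the integral converges absolutely. (d) The values $I(k)$, $k>0$, determine $J$, the numbers $k_j$, and $f$ in $\mathbb C_+$: if two potentials of the above class have the same $I(k)$ for all $k>0$, then they have the same $J$, the same $k_j$, and the same $f(z)$ for $\operatorname{Im}z>0$. -/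

import Mathlib

open Set Filter Topology MeasureTheory

namespace Schrodinger

/-- The class `L_{1,1}` of real potentials on the half-line: `∫_0^∞ (1 + x) |q x| dx < ∞`. -/
def InL11 (q : ℝ → ℝ) : Prop :=
  IntegrableOn (fun x : ℝ => (1 + x) * q x) (Ioi 0)

/-- `u` solves `-u'' + q u = E u` on the half-line in the Carathéodory sense, with `u' = v`:
`u` is differentiable on `[0, ∞)` with derivative `v`, and `v` is the primitive of `(q - E) u`
(so that `v` is locally absolutely continuous and `v' = (q - E) u` almost everywhere). -/
structure IsSolution (q : ℝ → ℝ) (E : ℂ) (u v : ℝ → ℂ) : Prop where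
  hasDeriv : ∀ x : ℝ, 0 ≤ x → HasDerivWithinAt u (v x) (Ici 0) x
  deriv_eq : ∀ x : ℝ, 0 ≤ x → v x = v 0 + ∫ t in (0 : ℝ)..x, ((q t : ℂ) - E) * u t

/-- `u` is the Jost solution at `k` (with `v = u'`): it solves `-u'' + q u = k² u` and
`u(x) = e^{ikx} (1 + o(1))` as `x → +∞`. -/
structure IsJostSolution (q : ℝ → ℝ) (k : ℂ) (u v : ℝ → ℂ) : Prop where
  isSolution : IsSolution q (k ^ 2) u v
  asymptotics : Tendsto (fun x : ℝ => Complex.exp (-(Complex.I * k * x)) * u x) atTop (𝓝 1)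

/-- The pair `(f(·, k), f'(·, k))` of the Jost solution and its derivative in `x`; it is used
for `0 ≤ Im k` only, where it exists and is unique on `[0, ∞)`. -/
noncomputable def jostPair (q : ℝ → ℝ) (k : ℂ) : (ℝ → ℂ) × (ℝ → ℂ) :=
  Classical.epsilon fun p => IsJostSolution q k p.1 p.2

/-- The Jost function `f(k) = f(0, k)`. -/
noncomputable def jostFunction (q : ℝ → ℝ) (k : ℂ) : ℂ := (jostPair q k).1 0

/-- The I-function `I(k) = f'(0, k) / f(k)`. -/
noncomputable def iFunction (q : ℝ → ℝ) (k : ℂ) : ℂ := (jostPair q k).2 0 / jostFunction q k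

/-- `E` is an eigenvalue of `-d²/dx² + q` in `L²(0, ∞)` with the condition `u(0) = 0`. -/
def IsDirichletEigenvalue (q : ℝ → ℝ) (E : ℝ) : Prop :=
  ∃ u v : ℝ → ℂ, IsSolution q (E : ℂ) u v ∧ u 0 = 0 ∧
    MemLp u 2 (volume.restrict (Ioi (0 : ℝ))) ∧ ∃ x : ℝ, 0 < x ∧ u x ≠ 0

/-- The numbers `k_j > 0` such that `-k_j²` is a (negative) Dirichlet eigenvalue. -/
def boundStates (q : ℝ → ℝ) : Set ℝ :=
  {κ : ℝ | 0 < κ ∧ IsDirichletEigenvalue q (-κ ^ 2)}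

/-- The open upper half-plane as a set of complex numbers. -/
def upperHalf : Set ℂ := {z : ℂ | 0 < z.im}

/-- The poles of `F` in the open upper half-plane. -/
def upperPoles (F : ℂ → ℂ) : Set ℂ := {p : ℂ | p ∈ upperHalf ∧ meromorphicOrderAt F p < 0}

/-- `w(z) = ∏_p (z - p) / (z + p)`, the product over the poles `p` of `F` in the open upper
half-plane. -/
noncomputable def w (F : ℂ → ℂ) (z : ℂ) : ℂ := ∏ᶠ p ∈ upperPoles F, (z - p) / (z + p)

/-- `w₁(z) = z / (z + i) * w(z)`. -/
noncomputable def w₁ (F : ℂ → ℂ) (z : ℂ) : ℂ := z / (z + Complex.I) * w F z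

/-- `ln (s / Im F(s)) / (s - z)`. -/
noncomputable def integrand (F : ℂ → ℂ) (z : ℂ) (s : ℝ) : ℂ :=
  (Real.log (s / (F s).im) : ℂ) / ((s : ℂ) - z)

/-- `ln ((s² + 1) / (s Im F(s))) / (s - z)`. -/
noncomputable def integrand₁ (F : ℂ → ℂ) (z : ℂ) (s : ℝ) : ℂ :=
  (Real.log ((s ^ 2 + 1) / (s * (F s).im)) : ℂ) / ((s : ℂ) - z)

end Schrodinger

/-! The function m(x, k) = e^{-ikx} f(x, k) solves the Volterra equation m(x) = 1 + ∫_x^∞ ∫_s^∞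
e^{2ik(t-s)} q(t) m(t) dt ds (`jostM_eq`). For Im k ≥ 0 the exponential has modulus at most 1, so
the n-th Neumann term is bounded by τ(x)^n / n! with τ(x) = ∫_x^∞ ∫_s^∞ |q|, finite by the
first-moment condition. The bound does not involve k. Hence f(k) = m(0, k) is holomorphic in the
open half-plane and continuous up to the real line; the differential equation for m adds f(k) = 1 +
O(1/|k|).

The rest of the spectral information comes from Wronskians. The imaginary part of f'(0, k) times the
conjugate of f(k) equals s at a real point k = s, and 2 Re k Im k ∫ |f(x, k)|² dx when Im k > 0. The
first identity gives Im I(s) = s / |f(s)|², so the logarithm in (b) is 2 ln |f(s)|. Together they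
give |f(k)| ≥ c |Re k| on bounded sets (`exists_mul_abs_re_le_norm_jostFunction`). This inequality
puts the zeros in the open half-plane on the imaginary axis, makes them simple, excludes real zeros
other than 0, and controls ln |f| near 0. The zeros are the bound states
(`isDirichletEigenvalue_iff`). Near 0, where analyticity says nothing, they cannot accumulate
because distinct eigenfunctions are orthogonal (`exists_boundStates_separation`).

For (b), g = f / w has no zeros in the half-plane and has a logarithm h = O(1/|z|). Cauchy's theorem
recovers h(z + iε) from 2 Re h = 2 ln |g| on the line Im = ε (`integral_two_re_div_sub`). As ε → 0
the integrals are dominated by a multiple of |s|^{-1/2} / |s - z|, and |w| = 1 on the real line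
(`eq_exp_integral_log_boundary`). For (c), the same representation is applied to (z + i)/z and
multiplied in.

For (d), the difference of the cross products of f and f' for the two potentials vanishes on the
real line and grows at most linearly, so it vanishes in the half-plane by Phragmén–Lindelöf
(`jostDeriv_mul_eq`). Hence the zeros coincide, and (b) then gives f. -/

namespace Schrodinger

/-! ### Calculus for primitives of integrable functions -/

section AbsolutelyContinuous

variable {E : Type*} [NormedAddCommGroup E] [NormedSpace ℝ E]

/-- Primitives of integrable vector-valued functions are absolutely continuous. -/
lemma absolutelyContinuousOnInterval_integral {f : ℝ → E} {a b : ℝ}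
    (hf : IntervalIntegrable f volume a b) :
    AbsolutelyContinuousOnInterval (fun x => ∫ t in a..x, f t) a b := by
  have hn := hf.norm.absolutelyContinuousOnInterval_intervalIntegral (c := a) left_mem_uIcc
  have hsub : ∀ {x y}, x ∈ uIcc a b → y ∈ uIcc a b → IntervalIntegrable f volume x y :=
    fun hx hy => hf.mono_set (uIcc_subset_uIcc hx hy)
  refine (absolutelyContinuousOnInterval_iff _ _ _).2 fun ε hε => ?_
  obtain ⟨δ, hδ, h⟩ := (absolutelyContinuousOnInterval_iff _ _ _).1 hn ε hε
  refine ⟨δ, hδ, fun I hI hlt => lt_of_le_of_lt (Finset.sum_le_sum fun i hi => ?_) (h I hI hlt)⟩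
  have hmem := hI.1 i hi
  have h1 : IntervalIntegrable f volume a (I.2 i).1 := hsub left_mem_uIcc hmem.1
  have h2 : IntervalIntegrable f volume a (I.2 i).2 := hsub left_mem_uIcc hmem.2
  rw [dist_comm, dist_comm (∫ v in a..(I.2 i).1, ‖f v‖), dist_eq_norm, dist_eq_norm,
    intervalIntegral.integral_interval_sub_left h2 h1,
    intervalIntegral.integral_interval_sub_left h2.norm h1.norm, Real.norm_eq_abs]
  exact intervalIntegral.norm_integral_le_abs_integral_norm

end AbsolutelyContinuous

/-- Product rule for primitives of integrable functions. -/
lemma mul_eq_add_integral {A B a b : ℝ → ℂ} {x : ℝ} (hx : 0 ≤ x)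
    (ha : IntervalIntegrable a volume 0 x) (hb : IntervalIntegrable b volume 0 x)
    (hA : ∀ t ∈ Icc 0 x, A t = A 0 + ∫ s in (0 : ℝ)..t, a s)
    (hB : ∀ t ∈ Icc 0 x, B t = B 0 + ∫ s in (0 : ℝ)..t, b s) :
    A x * B x = A 0 * B 0 + ∫ t in (0 : ℝ)..x, (a t * B t + A t * b t) := by
  -- The formulas for `A` and `B` hold only on `[0, x]`; the globally defined primitives can be
  -- differentiated almost everywhere. An absolutely continuous function with a.e. zero derivative
  -- is constant.
  set A' : ℝ → ℂ := fun t => A 0 + ∫ s in (0 : ℝ)..t, a s with hA'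
  set B' : ℝ → ℂ := fun t => B 0 + ∫ s in (0 : ℝ)..t, b s with hB'
  have hconst : ∀ c : ℂ, AbsolutelyContinuousOnInterval (fun _ : ℝ => c) 0 x := fun c =>
    (contDiff_const.contDiffOn).absolutelyContinuousOnInterval
  have acA : AbsolutelyContinuousOnInterval A' 0 x :=
    (hconst _).add (absolutelyContinuousOnInterval_integral ha)
  have acB : AbsolutelyContinuousOnInterval B' 0 x :=
    (hconst _).add (absolutelyContinuousOnInterval_integral hb)
  have hc : IntervalIntegrable (fun t => a t * B' t + A' t * b t) volume 0 x :=
    (ha.mul_continuousOn acB.continuousOn).add (hb.continuousOn_mul acA.continuousOn)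
  have acF := (acA.fun_smul acB).fun_sub (absolutelyContinuousOnInterval_integral hc)
  obtain ⟨C, hC⟩ := acF.const_of_ae_hasDerivAt_zero (by
    filter_upwards [ha.ae_hasDerivAt_integral, hb.ae_hasDerivAt_integral,
      hc.ae_hasDerivAt_integral] with t h1 h2 h3 ht
    have h1 := (h1 ht 0 left_mem_uIcc).const_add (A 0)
    have h2 := (h2 ht 0 left_mem_uIcc).const_add (B 0)
    have h3 := h3 ht 0 left_mem_uIcc
    convert! (h1.mul h2).sub h3 using 1
    simp [hA', hB'])
  have e0 := hC 0 left_mem_uIcc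
  have e1 := hC x right_mem_uIcc
  have hcongr : ∫ t in (0 : ℝ)..x, (a t * B t + A t * b t) =
      ∫ t in (0 : ℝ)..x, (a t * B' t + A' t * b t) := by
    refine intervalIntegral.integral_congr fun t ht => ?_
    rw [uIcc_of_le hx] at ht
    simp only [hA t ht, hB t ht, hA', hB']
  rw [hcongr, hA x (right_mem_Icc.2 hx), hB x (right_mem_Icc.2 hx)]
  simp only [hA', hB', intervalIntegral.integral_same, add_zero, sub_zero, smul_eq_mul] at e0 e1 ⊢
  rw [e0, ← e1]; ring

/-- Powers of the primitive of an integrable real function. -/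
lemma integral_mul_pow_primitive {K : ℝ → ℝ} {x : ℝ} (hx : 0 ≤ x)
    (hK : IntervalIntegrable K volume 0 x) (n : ℕ) :
    ∫ t in (0 : ℝ)..x, K t * (∫ s in (0 : ℝ)..t, K s) ^ n =
      (∫ s in (0 : ℝ)..x, K s) ^ (n + 1) / (n + 1) := by
  -- The induction runs over `ℂ` so that the product rule `mul_eq_add_integral` applies.
  have key : ∀ n : ℕ, ∀ y ∈ Icc 0 x, ((∫ s in (0 : ℝ)..y, K s : ℝ) : ℂ) ^ (n + 1) =
      ∫ t in (0 : ℝ)..y, ((n + 1 : ℂ) * ((K t : ℂ) * ((∫ s in (0 : ℝ)..t, K s : ℝ) : ℂ) ^ n)) := by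
    intro n
    induction n with
    | zero => intro y _; simp [intervalIntegral.integral_ofReal]
    | succ n ih =>
      intro y hy
      have hKy : IntervalIntegrable K volume 0 y :=
        hK.mono_set (by rw [uIcc_of_le hy.1, uIcc_of_le hx]; exact Icc_subset_Icc le_rfl hy.2)
      have hcont : ContinuousOn (fun t => ((∫ s in (0 : ℝ)..t, K s : ℝ) : ℂ)) (uIcc 0 y) :=
        Complex.continuous_ofReal.comp_continuousOn
          (absolutelyContinuousOnInterval_integral hKy).continuousOn
      have hKc : IntervalIntegrable (fun t => (K t : ℂ)) volume 0 y :=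
        ⟨hKy.1.ofReal, hKy.2.ofReal⟩
      have := mul_eq_add_integral (A := fun t => ((∫ s in (0 : ℝ)..t, K s : ℝ) : ℂ) ^ (n + 1))
        (B := fun t => ((∫ s in (0 : ℝ)..t, K s : ℝ) : ℂ)) (b := fun t => (K t : ℂ)) hy.1
        (a := fun t => (n + 1 : ℂ) * ((K t : ℂ) * ((∫ s in (0 : ℝ)..t, K s : ℝ) : ℂ) ^ n))
        ((hKc.mul_continuousOn (hcont.pow n)).const_mul _) hKc
        (fun t ht => by simpa using ih t ⟨ht.1, ht.2.trans hy.2⟩) (fun t _ => by simp [intervalIntegral.integral_ofReal])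
      simp only [intervalIntegral.integral_same, Complex.ofReal_zero, mul_zero, zero_add] at this
      rw [pow_succ, this]
      refine intervalIntegral.integral_congr fun t _ => ?_
      push_cast; ring
  have h := key n x (right_mem_Icc.2 hx)
  rw [intervalIntegral.integral_const_mul] at h
  have h' : ((∫ s in (0 : ℝ)..x, K s) ^ (n + 1) : ℝ) =
      (n + 1) * ∫ t in (0 : ℝ)..x, K t * (∫ s in (0 : ℝ)..t, K s) ^ n := by
    have e : ∫ t in (0 : ℝ)..x, ((K t : ℂ) * ((∫ s in (0 : ℝ)..t, K s : ℝ) : ℂ) ^ n) =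
        ((∫ t in (0 : ℝ)..x, K t * (∫ s in (0 : ℝ)..t, K s) ^ n : ℝ) : ℂ) := by
      rw [← intervalIntegral.integral_ofReal]; push_cast; rfl
    rw [e] at h
    exact_mod_cast h
  rw [h']; field_simp

/-- Integral form of Grönwall's inequality with vanishing initial value. -/
lemma eq_zero_of_le_integral {M K : ℝ → ℝ} {X : ℝ} (hX : 0 ≤ X) (hM : ContinuousOn M (Icc 0 X))
    (hM0 : ∀ x ∈ Icc 0 X, 0 ≤ M x) (hK : IntervalIntegrable K volume 0 X)
    (hK0 : ∀ t, 0 ≤ K t)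
    (hle : ∀ x ∈ Icc 0 X, M x ≤ ∫ t in (0 : ℝ)..x, K t * M t) :
    ∀ x ∈ Icc 0 X, M x = 0 := by
  obtain ⟨B, hB⟩ := isCompact_Icc.exists_bound_of_continuousOn hM
  -- Inserting the inequality into itself `n` times produces the factorial, and the bound tends to
  -- 0.
  have key : ∀ n : ℕ, ∀ x ∈ Icc 0 X, M x ≤ B * ((∫ s in (0 : ℝ)..x, K s) ^ n / n.factorial) := by
    intro n
    induction n with
    | zero => intro x hx; simpa using (le_abs_self _).trans (hB x hx)
    | succ n ih =>
      intro x hx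
      have hsub : uIcc 0 x ⊆ uIcc 0 X := by
        rw [uIcc_of_le hx.1, uIcc_of_le hX]; exact Icc_subset_Icc le_rfl hx.2
      have hKx := hK.mono_set hsub
      have hc := (absolutelyContinuousOnInterval_integral hKx).continuousOn
      have hMx : ContinuousOn M (uIcc 0 x) := hM.mono (by rwa [← uIcc_of_le hX])
      calc M x ≤ ∫ t in (0 : ℝ)..x, K t * M t := hle x hx
        _ ≤ ∫ t in (0 : ℝ)..x,
            (B / n.factorial) * (K t * (∫ s in (0 : ℝ)..t, K s) ^ n) := by
          refine intervalIntegral.integral_mono_on hx.1 (hKx.mul_continuousOn hMx)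
            ((hKx.mul_continuousOn (hc.pow n)).const_mul _) fun t ht => ?_
          have := mul_le_mul_of_nonneg_left (ih t ⟨ht.1, ht.2.trans hx.2⟩) (hK0 t)
          calc K t * M t ≤ _ := this
            _ = _ := by ring
        _ = _ := by
          rw [intervalIntegral.integral_const_mul, integral_mul_pow_primitive hx.1 hKx,
            Nat.factorial_succ]
          push_cast
          field_simp
  intro x hx
  refine le_antisymm ?_ (hM0 x hx)
  have ht := (FloorSemiring.tendsto_pow_div_factorial_atTop (∫ s in (0 : ℝ)..x, K s)).const_mul B
  rw [mul_zero] at ht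
  exact ge_of_tendsto' ht fun n => key n x hx

/-! ### Solutions in the Carathéodory sense, Wronskians, uniqueness for the initial value problem -/

variable {q : ℝ → ℝ}

lemma InL11.integrableOn (hq : InL11 q) : IntegrableOn q (Ioi 0) := by
  have h : IntegrableOn (fun x => (1 + x)⁻¹ * ((1 + x) * q x)) (Ioi 0) := by
    refine Integrable.bdd_mul (c := 1) hq (by fun_prop) ?_
    filter_upwards [ae_restrict_mem measurableSet_Ioi] with x hx
    have hx : (0 : ℝ) < x := hx
    rw [norm_inv, Real.norm_of_nonneg (by linarith)]
    exact inv_le_one_of_one_le₀ (by linarith)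
  refine h.congr_fun (fun x hx => ?_) measurableSet_Ioi
  have hx : (0 : ℝ) < x := hx
  have : 1 + x ≠ 0 := by linarith
  simp only; field_simp

lemma InL11.intervalIntegrable (hq : InL11 q) {x : ℝ} (hx : 0 ≤ x) :
    IntervalIntegrable (fun t => (q t : ℂ)) volume 0 x := by
  rw [intervalIntegrable_iff_integrableOn_Ioc_of_le hx]
  exact (hq.integrableOn.mono_set Ioc_subset_Ioi_self).ofReal

namespace IsSolution

variable {E E₁ E₂ : ℂ} {u v u₁ v₁ u₂ v₂ : ℝ → ℂ}

lemma continuousOn_fst (h : IsSolution q E u v) : ContinuousOn u (Ici 0) :=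
  fun x hx => (h.hasDeriv x hx).continuousWithinAt

lemma intervalIntegrable (h : IsSolution q E u v) (hq : InL11 q) {x : ℝ} (hx : 0 ≤ x) :
    IntervalIntegrable (fun t => ((q t : ℂ) - E) * u t) volume 0 x := by
  refine ((hq.intervalIntegrable hx).sub intervalIntegrable_const).mul_continuousOn
    (h.continuousOn_fst.mono ?_)
  rw [uIcc_of_le hx]; exact Icc_subset_Ici_self

lemma continuousOn_snd (h : IsSolution q E u v) (hq : InL11 q) : ContinuousOn v (Ici 0) := by
  intro x hx
  have hx' : (0 : ℝ) ≤ x + 1 := add_nonneg hx zero_le_one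
  have hc := (absolutelyContinuousOnInterval_integral (h.intervalIntegrable hq hx')).continuousOn
  rw [uIcc_of_le hx'] at hc
  have h1 : ContinuousWithinAt v (Icc 0 (x + 1)) x :=
    ((continuousOn_const (c := v 0)).add hc |>.congr fun t ht => h.deriv_eq t ht.1) x
      ⟨hx, by linarith⟩
  refine h1.mono_of_mem_nhdsWithin ?_
  rw [← Ici_inter_Iic]
  exact inter_mem self_mem_nhdsWithin
    (mem_nhdsWithin_of_mem_nhds (Iic_mem_nhds (by linarith)))

lemma fst_eq (h : IsSolution q E u v) (hq : InL11 q) {x : ℝ} (hx : 0 ≤ x) :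
    u x = u 0 + ∫ t in (0 : ℝ)..x, v t := by
  have hsub : uIcc 0 x ⊆ Ici 0 := by rw [uIcc_of_le hx]; exact Icc_subset_Ici_self
  rw [intervalIntegral.integral_eq_sub_of_hasDeriv_right_of_le hx
    (h.continuousOn_fst.mono Icc_subset_Ici_self) (f' := v) (fun t ht => ?_)
    ((h.continuousOn_snd hq).mono hsub).intervalIntegrable]
  · ring
  · exact (h.hasDeriv t ht.1.le).mono fun s hs => ht.1.le.trans (le_of_lt hs)

lemma intervalIntegrable_snd (h : IsSolution q E u v) (hq : InL11 q) {x : ℝ} (hx : 0 ≤ x) :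
    IntervalIntegrable v volume 0 x :=
  ((h.continuousOn_snd hq).mono (by rw [uIcc_of_le hx]; exact Icc_subset_Ici_self)).intervalIntegrable

lemma conj (h : IsSolution q E u v) :
    IsSolution q (starRingEnd ℂ E) (fun x => starRingEnd ℂ (u x)) (fun x => starRingEnd ℂ (v x)) where
  hasDeriv x hx := (h.hasDeriv x hx).star
  deriv_eq x hx := by
    rw [h.deriv_eq x hx, map_add, intervalIntegral.integral_of_le hx,
      intervalIntegral.integral_of_le hx, ← integral_conj]
    simp

lemma lincomb (h₁ : IsSolution q E u₁ v₁) (h₂ : IsSolution q E u₂ v₂) (hq : InL11 q) (c₁ c₂ : ℂ) :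
    IsSolution q E (fun x => c₁ * u₁ x + c₂ * u₂ x) (fun x => c₁ * v₁ x + c₂ * v₂ x) where
  hasDeriv x hx := ((h₁.hasDeriv x hx).const_mul c₁).add ((h₂.hasDeriv x hx).const_mul c₂)
  deriv_eq x hx := by
    have e : ∫ t in (0 : ℝ)..x, ((q t : ℂ) - E) * (c₁ * u₁ t + c₂ * u₂ t) =
        c₁ * (∫ t in (0 : ℝ)..x, ((q t : ℂ) - E) * u₁ t) +
        c₂ * (∫ t in (0 : ℝ)..x, ((q t : ℂ) - E) * u₂ t) := by
      rw [← intervalIntegral.integral_const_mul, ← intervalIntegral.integral_const_mul,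
        ← intervalIntegral.integral_add ((h₁.intervalIntegrable hq hx).const_mul c₁)
          ((h₂.intervalIntegrable hq hx).const_mul c₂)]
      exact intervalIntegral.integral_congr fun t _ => by ring
    rw [e, h₁.deriv_eq x hx, h₂.deriv_eq x hx]; ring

/-- The Wronskian identity. -/
lemma wronskian (h₁ : IsSolution q E₁ u₁ v₁) (h₂ : IsSolution q E₂ u₂ v₂) (hq : InL11 q)
    {x : ℝ} (hx : 0 ≤ x) :
    v₁ x * u₂ x - u₁ x * v₂ x =
      v₁ 0 * u₂ 0 - u₁ 0 * v₂ 0 + (E₂ - E₁) * ∫ t in (0 : ℝ)..x, u₁ t * u₂ t := by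
  have p1 := mul_eq_add_integral hx (h₁.intervalIntegrable hq hx) (h₂.intervalIntegrable_snd hq hx)
    (fun t ht => h₁.deriv_eq t ht.1) (fun t ht => h₂.fst_eq hq ht.1)
  have p2 := mul_eq_add_integral hx (h₁.intervalIntegrable_snd hq hx) (h₂.intervalIntegrable hq hx)
    (fun t ht => h₁.fst_eq hq ht.1) (fun t ht => h₂.deriv_eq t ht.1)
  have hsub : uIcc 0 x ⊆ Ici 0 := by rw [uIcc_of_le hx]; exact Icc_subset_Ici_self
  have cu₁ := h₁.continuousOn_fst.mono hsub
  have cu₂ := h₂.continuousOn_fst.mono hsub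
  have cv₁ := (h₁.continuousOn_snd hq).mono hsub
  have cv₂ := (h₂.continuousOn_snd hq).mono hsub
  have cvv : ContinuousOn (fun t => v₁ t * v₂ t) (uIcc 0 x) := cv₁.mul cv₂
  rw [p1, p2, add_sub_add_comm, ← intervalIntegral.integral_sub
    (((h₁.intervalIntegrable hq hx).mul_continuousOn cu₂).add cvv.intervalIntegrable)
    (cvv.intervalIntegrable.add ((h₂.intervalIntegrable hq hx).continuousOn_mul cu₁)),
    ← intervalIntegral.integral_const_mul]
  congr 1
  exact intervalIntegral.integral_congr fun t _ => by ring

/-- Uniqueness for the initial value problem. -/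
lemma eq_zero (h : IsSolution q E u v) (hq : InL11 q) (hu : u 0 = 0) (hv : v 0 = 0) {x : ℝ}
    (hx : 0 ≤ x) : u x = 0 ∧ v x = 0 := by
  have hsub : uIcc 0 x ⊆ Ici 0 := by rw [uIcc_of_le hx]; exact Icc_subset_Ici_self
  have hcu := h.continuousOn_fst
  have hcv := h.continuousOn_snd hq
  have hKi : ∀ {y : ℝ}, 0 ≤ y → IntervalIntegrable (fun t => 1 + ‖(q t : ℂ) - E‖) volume 0 y :=
    fun hy => intervalIntegrable_const.add
      ((hq.intervalIntegrable hy).sub intervalIntegrable_const).norm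
  -- Grönwall for the first-order system `u' = v`, `v' = (q - E) u`, whose coefficients are bounded
  -- by `1 + ‖q - E‖`.
  have key := eq_zero_of_le_integral (M := fun t => ‖u t‖ + ‖v t‖)
    (K := fun t => 1 + ‖(q t : ℂ) - E‖) hx
    ((hcu.norm.add hcv.norm).mono Icc_subset_Ici_self) (fun t _ => by positivity) (hKi hx)
    (fun t => by positivity) (fun y hy => ?_) x (right_mem_Icc.2 hx)
  · constructor <;> rw [← norm_eq_zero] <;> linarith [norm_nonneg (u x), norm_nonneg (v x)]
  · have hsuby : uIcc 0 y ⊆ Ici 0 := by rw [uIcc_of_le hy.1]; exact Icc_subset_Ici_self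
    have i1 := (h.intervalIntegrable_snd hq hy.1).norm
    have i2 := (h.intervalIntegrable hq hy.1).norm
    have b1 : ‖u y‖ ≤ ∫ t in (0 : ℝ)..y, ‖v t‖ := by
      rw [h.fst_eq hq hy.1, hu, zero_add]; exact intervalIntegral.norm_integral_le_integral_norm hy.1
    have b2 : ‖v y‖ ≤ ∫ t in (0 : ℝ)..y, ‖((q t : ℂ) - E) * u t‖ := by
      rw [h.deriv_eq y hy.1, hv, zero_add]
      exact intervalIntegral.norm_integral_le_integral_norm hy.1
    calc ‖u y‖ + ‖v y‖ ≤ ∫ t in (0 : ℝ)..y, (‖v t‖ + ‖((q t : ℂ) - E) * u t‖) := by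
          rw [intervalIntegral.integral_add i1 i2]; exact add_le_add b1 b2
      _ ≤ _ := by
          refine intervalIntegral.integral_mono_on hy.1 (i1.add i2)
            ((hKi hy.1).mul_continuousOn ((hcu.norm.add hcv.norm).mono hsuby)) fun t _ => ?_
          rw [norm_mul]
          nlinarith [norm_nonneg (u t), norm_nonneg (v t), norm_nonneg ((q t : ℂ) - E),
            mul_nonneg (norm_nonneg ((q t : ℂ) - E)) (norm_nonneg (v t))]

end IsSolution

end Schrodinger

/-! ### Holomorphic parameter integrals and iterated tails of the potential -/

namespace Schrodinger

section Parametric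

variable {α : Type*} [MeasurableSpace α] {μ : Measure α}

/-- A dominated integral depending holomorphically on a parameter is holomorphic. -/
lemma differentiableOn_integral_of_dominated {F : ℂ → α → ℂ} {U : Set ℂ} (hU : IsOpen U)
    {bound : α → ℝ} (hmeas : ∀ z ∈ U, AEStronglyMeasurable (F z) μ)
    (hbound : ∀ᵐ a ∂μ, ∀ z ∈ U, ‖F z a‖ ≤ bound a) (hInt : Integrable bound μ)
    (hdiff : ∀ᵐ a ∂μ, DifferentiableOn ℂ (fun z => F z a) U) :
    DifferentiableOn ℂ (fun z => ∫ a, F z a ∂μ) U := by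
  intro z₀ hz₀
  obtain ⟨r, hr, hrU⟩ := Metric.isOpen_iff.1 hU z₀ hz₀
  have hsub : ∀ z ∈ Metric.ball z₀ (r / 2), Metric.closedBall z (r / 4) ⊆ U := by
    intro z hz y hy
    refine hrU ?_
    rw [Metric.mem_ball] at hz ⊢
    rw [Metric.mem_closedBall] at hy
    linarith [dist_triangle y z z₀]
  -- Difference quotients along this sequence exhibit the derivative at `z₀` as an a.e. limit, which
  -- gives its measurability in `a`.
  have hU0 : ∀ n : ℕ, z₀ + ((r / 2 / (n + 1) : ℝ) : ℂ) ∈ U := by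
    intro n
    refine hrU ?_
    rw [Metric.mem_ball, dist_eq_norm, add_sub_cancel_left, Complex.norm_real,
      Real.norm_of_nonneg (by positivity)]
    have : r / 2 / (n + 1) ≤ r / 2 := div_le_self (by positivity) (by norm_cast; omega)
    linarith
  have hlim : Tendsto (fun n : ℕ => ((r / 2 / (n + 1) : ℝ) : ℂ)) atTop (𝓝[≠] 0) := by
    refine tendsto_nhdsWithin_iff.2 ⟨?_, Eventually.of_forall fun n => ?_⟩
    · have : Tendsto (fun n : ℕ => (r / 2 / (n + 1) : ℝ)) atTop (𝓝 0) := by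
        simpa [div_eq_mul_inv] using
          (tendsto_one_div_add_atTop_nhds_zero_nat (𝕜 := ℝ)).const_mul (r / 2)
      exact (Complex.continuous_ofReal.tendsto' 0 0 Complex.ofReal_zero).comp this
    · have : (0 : ℝ) < r / 2 / (n + 1) := by positivity
      exact Complex.ofReal_ne_zero.2 this.ne'
  have hderiv : ∀ᵐ a ∂μ, ∀ z ∈ Metric.ball z₀ (r / 2),
      HasDerivAt (fun z => F z a) (deriv (fun z => F z a) z) z := by
    filter_upwards [hdiff] with a ha z hz
    exact (ha.differentiableAt (hU.mem_nhds
      (hsub z hz (Metric.mem_closedBall_self (by positivity))))).hasDerivAt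
  have hmeas' : AEStronglyMeasurable (fun a => deriv (fun z => F z a) z₀) μ := by
    refine aestronglyMeasurable_of_tendsto_ae atTop (f := fun (n : ℕ) a =>
      ((r / 2 / (n + 1) : ℝ) : ℂ)⁻¹ * (F (z₀ + ((r / 2 / (n + 1) : ℝ) : ℂ)) a - F z₀ a))
      (fun n => ((hmeas _ (hU0 n)).sub (hmeas _ hz₀)).const_mul _) ?_
    filter_upwards [hderiv] with a ha
    exact (ha z₀ (Metric.mem_ball_self (by positivity))).tendsto_slope_zero.comp hlim
  refine (hasDerivAt_integral_of_dominated_loc_of_deriv_le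
    (F' := fun z a => deriv (fun z => F z a) z)
    (bound := fun a => bound a / (r / 4)) (Metric.ball_mem_nhds z₀ (half_pos hr))
    ?_ ?_ hmeas' ?_ (hInt.div_const _) hderiv).2.differentiableAt.differentiableWithinAt
  · filter_upwards [hU.mem_nhds hz₀] with z hz using hmeas z hz
  · exact hInt.mono' (hmeas z₀ hz₀) (hbound.mono fun a ha => ha z₀ hz₀)
  -- Cauchy's estimate on a circle of radius `r / 4` dominates the derivative by `bound a / (r /
  -- 4)`.
  · filter_upwards [hdiff, hbound] with a ha hb z hz
    refine Complex.norm_deriv_le_of_forall_mem_sphere_norm_le (by positivity) ?_ fun y hy =>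
      hb y (hsub z hz (Metric.sphere_subset_closedBall hy))
    refine DifferentiableOn.diffContOnCl ?_
    rw [closure_ball z (by positivity)]
    exact ha.mono (hsub z hz)

end Parametric

lemma intervalIntegrable_of_integrableOn_Ioi {E : Type*} [NormedAddCommGroup E] {g : ℝ → E}
    (hg : IntegrableOn g (Ioi 0)) {x : ℝ} (hx : 0 ≤ x) : IntervalIntegrable g volume 0 x := by
  rw [intervalIntegrable_iff_integrableOn_Ioc_of_le hx]
  exact hg.mono_set Ioc_subset_Ioi_self

section Tails

variable {E : Type*} [NormedAddCommGroup E] [NormedSpace ℝ E] {g : ℝ → E}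

lemma integral_Ioi_eq_sub (hg : IntegrableOn g (Ioi 0)) {x : ℝ} (hx : 0 ≤ x) :
    ∫ t in Ioi x, g t = (∫ t in Ioi 0, g t) - ∫ t in (0 : ℝ)..x, g t :=
  eq_sub_of_add_eq' (intervalIntegral.integral_interval_add_Ioi hg
    (hg.mono_set (Ioi_subset_Ioi hx)))

lemma continuousOn_integral_Ioi (hg : IntegrableOn g (Ioi 0)) :
    ContinuousOn (fun x => ∫ t in Ioi x, g t) (Ici 0) := by
  intro x hx
  have hx' : (0 : ℝ) ≤ x + 1 := add_nonneg hx zero_le_one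
  have hc := (absolutelyContinuousOnInterval_integral
    (intervalIntegrable_of_integrableOn_Ioi hg hx')).continuousOn
  rw [uIcc_of_le hx'] at hc
  have h1 : ContinuousWithinAt (fun x => ∫ t in Ioi x, g t) (Icc 0 (x + 1)) x :=
    ((continuousOn_const (c := ∫ t in Ioi 0, g t)).sub hc |>.congr fun t ht =>
      integral_Ioi_eq_sub hg ht.1) x ⟨hx, by linarith⟩
  refine h1.mono_of_mem_nhdsWithin ?_
  rw [← Ici_inter_Iic]
  exact inter_mem self_mem_nhdsWithin
    (mem_nhdsWithin_of_mem_nhds (Iic_mem_nhds (by linarith)))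

lemma tendsto_integral_Ioi_atTop_zero (hg : IntegrableOn g (Ioi 0)) :
    Tendsto (fun x => ∫ t in Ioi x, g t) atTop (𝓝 0) := by
  have h := (intervalIntegral_tendsto_integral_Ioi 0 hg tendsto_id).const_sub (∫ t in Ioi 0, g t)
  rw [sub_self] at h
  refine h.congr' ?_
  filter_upwards [eventually_ge_atTop 0] with x hx using (integral_Ioi_eq_sub hg hx).symm

lemma hasDerivWithinAt_integral_Ioi [CompleteSpace E] (hg : IntegrableOn g (Ioi 0))
    (hc : ContinuousOn g (Ici 0)) {x : ℝ} (hx : 0 ≤ x) :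
    HasDerivWithinAt (fun x => ∫ t in Ioi x, g t) (-g x) (Ici 0) x := by
  have hx' : (0 : ℝ) ≤ x + 1 := by linarith
  have hmem : x ∈ Icc 0 (x + 1) := ⟨hx, by linarith⟩
  have hcI : ContinuousOn g (Icc 0 (x + 1)) := hc.mono Icc_subset_Ici_self
  have : Fact (x ∈ Icc 0 (x + 1)) := ⟨hmem⟩
  have h := intervalIntegral.integral_hasDerivWithinAt_right (s := Icc 0 (x + 1))
    (t := Icc 0 (x + 1)) (intervalIntegrable_of_integrableOn_Ioi hg hx)
    (hcI.stronglyMeasurableAtFilter_nhdsWithin measurableSet_Icc x) (hcI x hmem)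
  have h1 : HasDerivWithinAt (fun x => ∫ t in Ioi x, g t) (-g x) (Icc 0 (x + 1)) x :=
    (h.const_sub (∫ t in Ioi 0, g t)).congr_of_mem
      (fun t ht => integral_Ioi_eq_sub hg ht.1) hmem
  refine h1.mono_of_mem_nhdsWithin ?_
  rw [← Ici_inter_Iic]
  exact inter_mem self_mem_nhdsWithin
    (mem_nhdsWithin_of_mem_nhds (Iic_mem_nhds (by linarith)))

end Tails

/-- `∫_s^∞ |q|`. -/
noncomputable def tail (q : ℝ → ℝ) (s : ℝ) : ℝ := ∫ t in Ioi s, |q t|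

/-- `∫_x^∞ ∫_s^∞ |q|`. -/
noncomputable def tail₂ (q : ℝ → ℝ) (x : ℝ) : ℝ := ∫ s in Ioi x, tail q s

variable {q : ℝ → ℝ}

lemma tail_nonneg (q : ℝ → ℝ) (s : ℝ) : 0 ≤ tail q s := integral_nonneg fun _ => abs_nonneg _

lemma tail₂_nonneg (q : ℝ → ℝ) (s : ℝ) : 0 ≤ tail₂ q s := integral_nonneg fun _ => tail_nonneg _ _

lemma InL11.integrableOn_abs (hq : InL11 q) : IntegrableOn (fun t => |q t|) (Ioi 0) :=
  hq.integrableOn.abs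

lemma continuousOn_tail (hq : InL11 q) : ContinuousOn (tail q) (Ici 0) :=
  continuousOn_integral_Ioi hq.integrableOn_abs

lemma tail_le_zero (hq : InL11 q) {s : ℝ} (hs : 0 ≤ s) : tail q s ≤ tail q 0 :=
  setIntegral_mono_set hq.integrableOn_abs (ae_of_all _ fun _ => abs_nonneg _)
    (Ioi_subset_Ioi hs).eventuallyLE

/-- By Tonelli the integral of the tail is `∫ t |q t|`. This is where the first moment of `q` is
needed. -/
lemma integrableOn_tail (hq : InL11 q) : IntegrableOn (tail q) (Ioi 0) := by
  have hm : AEStronglyMeasurable (fun p : ℝ × ℝ => {p : ℝ × ℝ | p.1 < p.2}.indicator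
      (fun p => |q p.2|) p) ((volume.restrict (Ioi 0)).prod (volume.restrict (Ioi 0))) := by
    refine AEStronglyMeasurable.indicator ?_ (measurableSet_lt measurable_fst measurable_snd)
    exact hq.integrableOn_abs.aestronglyMeasurable.comp_snd
  have hi : Integrable (fun p : ℝ × ℝ => {p : ℝ × ℝ | p.1 < p.2}.indicator
      (fun p => |q p.2|) p) ((volume.restrict (Ioi 0)).prod (volume.restrict (Ioi 0))) := by
    have hfun : ∀ t : ℝ, (fun s : ℝ => {p : ℝ × ℝ | p.1 < p.2}.indicator
        (fun p => |q p.2|) (s, t)) = (Iio t).indicator fun _ => |q t| := by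
      intro t; ext s; simp [indicator, mem_Iio]
    refine (integrable_prod_iff' hm).2 ⟨?_, ?_⟩
    · refine ae_of_all _ fun t => ?_
      rw [hfun t, integrable_indicator_iff measurableSet_Iio, IntegrableOn,
        Measure.restrict_restrict measurableSet_Iio, Iio_inter_Ioi]
      exact integrableOn_const (by simp)
    · have h2 : IntegrableOn (fun t => t * |q t|) (Ioi 0) := by
        refine (hq.abs.sub hq.integrableOn_abs).congr ?_
        filter_upwards [ae_restrict_mem measurableSet_Ioi] with t ht
        have ht : (0 : ℝ) < t := ht
        simp only [Pi.sub_apply, abs_mul, abs_of_pos (by linarith : 0 < 1 + t)]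
        ring
      refine h2.congr ?_
      filter_upwards [ae_restrict_mem measurableSet_Ioi] with t ht
      have ht : (0 : ℝ) < t := ht
      simp_rw [norm_indicator_eq_indicator_norm]
      have : ∀ s : ℝ, {p : ℝ × ℝ | p.1 < p.2}.indicator (fun p => ‖|q p.2|‖) (s, t) =
          (Iio t).indicator (fun _ => |q t|) s := by
        intro s; simp [indicator, mem_Iio]
      simp_rw [this]
      rw [integral_indicator measurableSet_Iio, Measure.restrict_restrict measurableSet_Iio,
        Iio_inter_Ioi, setIntegral_const]
      simp [ht.le]
  refine hi.integral_prod_left.congr ?_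
  filter_upwards [ae_restrict_mem measurableSet_Ioi] with s hs
  have hs : (0 : ℝ) < s := hs
  have : ∀ t : ℝ, {p : ℝ × ℝ | p.1 < p.2}.indicator (fun p => |q p.2|) (s, t) =
      (Ioi s).indicator (fun t => |q t|) t := by
    intro t; simp [indicator, mem_Ioi]
  simp_rw [this]
  rw [integral_indicator measurableSet_Ioi, Measure.restrict_restrict measurableSet_Ioi,
    Ioi_inter_Ioi, sup_of_le_left hs.le, tail]

lemma tail₂_anti (hq : InL11 q) {x y : ℝ} (hx : 0 ≤ x) (hxy : x ≤ y) : tail₂ q y ≤ tail₂ q x :=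
  setIntegral_mono_set ((integrableOn_tail hq).mono_set (Ioi_subset_Ioi hx))
    (ae_of_all _ fun _ => tail_nonneg _ _) (Ioi_subset_Ioi hxy).eventuallyLE

lemma integrableOn_tail_mul_pow (hq : InL11 q) (n : ℕ) :
    IntegrableOn (fun s => tail q s * tail₂ q s ^ n) (Ioi 0) := by
  refine Integrable.mul_bdd (c := tail₂ q 0 ^ n) (integrableOn_tail hq) ?_ ?_
  · exact ((continuousOn_integral_Ioi (integrableOn_tail hq)).pow n
      |>.mono Ioi_subset_Ici_self).aestronglyMeasurable measurableSet_Ioi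
  · filter_upwards [ae_restrict_mem measurableSet_Ioi] with s hs
    rw [norm_pow, Real.norm_of_nonneg (tail₂_nonneg _ _)]
    exact pow_le_pow_left₀ (tail₂_nonneg _ _) (tail₂_anti hq le_rfl (le_of_lt hs)) n

/-- Since `tail₂' = -tail`, the integrand is an exact derivative. This identity produces the
factorials in the Neumann series. -/
lemma integral_tail_mul_pow (hq : InL11 q) (n : ℕ) {x : ℝ} (hx : 0 ≤ x) :
    ∫ s in Ioi x, tail q s * tail₂ q s ^ n = tail₂ q x ^ (n + 1) / (n + 1) := by
  have hd : ∀ s ∈ Ioi x, HasDerivAt (fun s => -(tail₂ q s ^ (n + 1) / (n + 1)))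
      (tail q s * tail₂ q s ^ n) s := by
    intro s hs
    have hs : x < s := hs
    have h := (hasDerivWithinAt_integral_Ioi (integrableOn_tail hq) (continuousOn_tail hq)
      (hx.trans hs.le)).hasDerivAt (Ici_mem_nhds (hx.trans_lt hs))
    have h2 := ((h.pow (n + 1)).div_const ((n : ℝ) + 1)).neg
    refine h2.congr_deriv ?_
    have : (n : ℝ) + 1 ≠ 0 := by positivity
    rw [Nat.add_sub_cancel]
    push_cast
    rw [tail₂]
    field_simp
  have hc : ContinuousWithinAt (fun s => -(tail₂ q s ^ (n + 1) / (n + 1))) (Ici x) x :=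
    (((continuousOn_integral_Ioi (integrableOn_tail hq)).pow (n + 1)).div_const _).neg x hx
      |>.mono (Ici_subset_Ici.2 hx)
  have ht : Tendsto (fun s => -(tail₂ q s ^ (n + 1) / (n + 1))) atTop (𝓝 0) := by
    have h0 : Tendsto (tail₂ q) atTop (𝓝 0) := tendsto_integral_Ioi_atTop_zero (integrableOn_tail hq)
    simpa using ((h0.pow (n + 1)).div_const ((n : ℝ) + 1)).neg
  rw [integral_Ioi_of_hasDerivAt_of_tendsto hc hd
    ((integrableOn_tail_mul_pow hq n).mono_set (Ioi_subset_Ioi hx)) ht]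
  ring

end Schrodinger

/-! ### The Volterra equation and its Neumann series -/

namespace Schrodinger

/-- `∫_s^∞ e^{2ik(t-s)} q(t) m(t) dt`. -/
noncomputable def jostKernel (q : ℝ → ℝ) (k : ℂ) (m : ℝ → ℂ) (s : ℝ) : ℂ :=
  ∫ t in Ioi s, Complex.exp (2 * Complex.I * k * ((t : ℂ) - s)) * ((q t : ℂ) * m t)

variable {q : ℝ → ℝ} {k : ℂ} {m : ℝ → ℂ}

lemma norm_exp_two_I_mul_le_one (hk : 0 ≤ k.im) {s t : ℝ} (hst : s ≤ t) :
    ‖Complex.exp (2 * Complex.I * k * ((t : ℂ) - s))‖ ≤ 1 := by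
  rw [Complex.norm_exp, Real.exp_le_one_iff]
  have : (2 * Complex.I * k * ((t : ℂ) - s)).re = -(2 * (k.im * (t - s))) := by
    simp [Complex.mul_re, Complex.mul_im]; ring
  rw [this, neg_nonpos]
  exact mul_nonneg zero_le_two (mul_nonneg hk (sub_nonneg.2 hst))

lemma norm_jostKernel_integrand_le (hk : 0 ≤ k.im) {B s t : ℝ} (hst : s ≤ t) (hm : ‖m t‖ ≤ B) :
    ‖Complex.exp (2 * Complex.I * k * ((t : ℂ) - s)) * ((q t : ℂ) * m t)‖ ≤ |q t| * B := by
  rw [norm_mul, norm_mul, Complex.norm_real, Real.norm_eq_abs]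
  calc _ ≤ 1 * (|q t| * ‖m t‖) := by gcongr; exact norm_exp_two_I_mul_le_one hk hst
    _ ≤ _ := by rw [one_mul]; gcongr

lemma aestronglyMeasurable_jostKernel_integrand (hq : InL11 q) (hm : ContinuousOn m (Ici 0)) (k : ℂ)
    {s : ℝ} (hs : 0 ≤ s) :
    AEStronglyMeasurable (fun t : ℝ =>
      Complex.exp (2 * Complex.I * k * ((t : ℂ) - s)) * ((q t : ℂ) * m t))
      (volume.restrict (Ioi s)) := by
  refine AEStronglyMeasurable.mul (by fun_prop) (AEStronglyMeasurable.mul ?_ ?_)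
  · exact (hq.integrableOn.mono_set (Ioi_subset_Ioi hs)).ofReal.aestronglyMeasurable
  · exact (hm.mono (Ioi_subset_Ici hs)).aestronglyMeasurable measurableSet_Ioi

lemma integrableOn_jostKernel_integrand (hq : InL11 q) (hk : 0 ≤ k.im)
    (hm : ContinuousOn m (Ici 0)) {C : ℝ} (hC : ∀ t, 0 ≤ t → ‖m t‖ ≤ C) {s : ℝ} (hs : 0 ≤ s) :
    IntegrableOn (fun t : ℝ =>
      Complex.exp (2 * Complex.I * k * ((t : ℂ) - s)) * ((q t : ℂ) * m t)) (Ioi s) := by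
  refine ((hq.integrableOn_abs.mono_set (Ioi_subset_Ioi hs)).mul_const C).mono'
    (aestronglyMeasurable_jostKernel_integrand hq hm k hs) ?_
  filter_upwards [ae_restrict_mem measurableSet_Ioi] with t ht
  exact norm_jostKernel_integrand_le hk (le_of_lt ht) (hC t (hs.trans (le_of_lt ht)))

lemma norm_jostKernel_le (hq : InL11 q) (hk : 0 ≤ k.im) {B s : ℝ} (hs : 0 ≤ s)
    (hB : ∀ t, s ≤ t → ‖m t‖ ≤ B) : ‖jostKernel q k m s‖ ≤ tail q s * B := by
  rw [jostKernel, tail, ← integral_mul_const]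
  refine norm_integral_le_of_norm_le
    ((hq.integrableOn_abs.mono_set (Ioi_subset_Ioi hs)).mul_const B) ?_
  filter_upwards [ae_restrict_mem measurableSet_Ioi] with t ht
  exact norm_jostKernel_integrand_le hk (le_of_lt ht) (hB t (le_of_lt ht))

/-- Factoring the exponential leaves a tail integral of an integrand independent of `s`, to which
the tail lemmas apply. The prefactor may grow, but it is only used for continuity and the product
rule, never for bounds at infinity. -/
lemma jostKernel_eq (q : ℝ → ℝ) (k : ℂ) (m : ℝ → ℂ) (s : ℝ) :
    jostKernel q k m s = Complex.exp (-(2 * Complex.I * k * s)) *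
      ∫ t in Ioi s, Complex.exp (2 * Complex.I * k * ((t : ℂ) - (0 : ℝ))) * ((q t : ℂ) * m t) := by
  rw [jostKernel, ← integral_const_mul]
  congr 1 with t
  conv_rhs => rw [← mul_assoc, ← Complex.exp_add]
  congr 2
  push_cast; ring

lemma continuousOn_jostKernel (hq : InL11 q) (hk : 0 ≤ k.im)
    (hm : ContinuousOn m (Ici 0)) {C : ℝ} (hC : ∀ t, 0 ≤ t → ‖m t‖ ≤ C) :
    ContinuousOn (jostKernel q k m) (Ici 0) := by
  simp_rw [funext (jostKernel_eq q k m)]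
  exact ContinuousOn.mul (by fun_prop)
    (continuousOn_integral_Ioi (integrableOn_jostKernel_integrand hq hk hm hC le_rfl))

lemma integrableOn_jostKernel (hq : InL11 q) (hk : 0 ≤ k.im)
    (hm : ContinuousOn m (Ici 0)) {C : ℝ} (hC : ∀ t, 0 ≤ t → ‖m t‖ ≤ C) :
    IntegrableOn (jostKernel q k m) (Ioi 0) := by
  refine ((integrableOn_tail hq).mul_const C).mono'
    (((continuousOn_jostKernel hq hk hm hC).mono Ioi_subset_Ici_self).aestronglyMeasurable
      measurableSet_Ioi) ?_
  filter_upwards [ae_restrict_mem measurableSet_Ioi] with s hs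
  have hs : (0 : ℝ) < s := hs
  exact norm_jostKernel_le hq hk hs.le fun t ht => hC t (hs.le.trans ht)

/-- The kernel integral solves `p' = -2ik p - q m`. -/
lemma jostKernel_eq_add_integral (hq : InL11 q) (hk : 0 ≤ k.im)
    (hm : ContinuousOn m (Ici 0)) {C : ℝ} (hC : ∀ t, 0 ≤ t → ‖m t‖ ≤ C) {x : ℝ} (hx : 0 ≤ x) :
    jostKernel q k m x = jostKernel q k m 0 +
      ∫ t in (0 : ℝ)..x, (-(2 * Complex.I * k) * jostKernel q k m t - (q t : ℂ) * m t) := by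
  set g : ℝ → ℂ := fun t => Complex.exp (2 * Complex.I * k * ((t : ℂ) - (0 : ℝ))) *
    ((q t : ℂ) * m t) with hg
  have hgi : IntegrableOn g (Ioi 0) := integrableOn_jostKernel_integrand hq hk hm hC le_rfl
  have hexp : ∀ t : ℝ, HasDerivAt (fun t : ℝ => Complex.exp (-(2 * Complex.I * k * t)))
      (-(2 * Complex.I * k) * Complex.exp (-(2 * Complex.I * k * t))) t := by
    intro t
    have h := (((hasDerivAt_id (t : ℂ)).const_mul (2 * Complex.I * k)).neg.cexp).comp_ofReal
    refine h.congr_deriv ?_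
    simp only [id, mul_one, Pi.neg_apply]; ring
  have hcont : Continuous fun t : ℝ =>
      -(2 * Complex.I * k) * Complex.exp (-(2 * Complex.I * k * t)) := by fun_prop
  have h := mul_eq_add_integral (A := fun t : ℝ => Complex.exp (-(2 * Complex.I * k * t)))
    (B := fun t => ∫ s in Ioi t, g s) hx (hcont.intervalIntegrable 0 x)
    (intervalIntegrable_of_integrableOn_Ioi hgi.neg hx)
    (fun t _ => by
      rw [intervalIntegral.integral_eq_sub_of_hasDerivAt (fun s _ => hexp s)
        (hcont.intervalIntegrable 0 t)]; ring)
    (fun t ht => by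
      simp only [Pi.neg_apply, intervalIntegral.integral_neg]
      rw [integral_Ioi_eq_sub hgi ht.1]; ring)
  rw [jostKernel_eq q k m x, jostKernel_eq q k m 0, h]
  congr 1
  refine intervalIntegral.integral_congr fun t _ => ?_
  simp only [Pi.neg_apply, hg, jostKernel_eq q k m t]
  rw [mul_neg, ← mul_assoc (Complex.exp (-(2 * Complex.I * k * t))), ← Complex.exp_add]
  have : -(2 * Complex.I * k * t) + 2 * Complex.I * k * ((t : ℂ) - (0 : ℝ)) = 0 := by
    push_cast; ring
  rw [this, Complex.exp_zero]; ring

/-- A uniformly bounded family of continuous functions on `[0, ∞)` that depends continuously on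
`k` in the closed upper half-plane and holomorphically in the open one. -/
structure IsAdmissible (m : ℂ → ℝ → ℂ) (C : ℝ) : Prop where
  continuousOn_pos : ∀ k : ℂ, 0 ≤ k.im → ContinuousOn (m k) (Ici 0)
  norm_le : ∀ k : ℂ, 0 ≤ k.im → ∀ t, 0 ≤ t → ‖m k t‖ ≤ C
  continuousOn_param : ∀ t, 0 ≤ t → ContinuousOn (fun k => m k t) {k : ℂ | 0 ≤ k.im}
  differentiableOn_param : ∀ t, 0 ≤ t → DifferentiableOn ℂ (fun k => m k t) {k : ℂ | 0 < k.im}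

lemma isOpen_upper : IsOpen {k : ℂ | 0 < k.im} := isOpen_lt continuous_const Complex.continuous_im

namespace IsAdmissible

variable {m : ℂ → ℝ → ℂ} {C : ℝ}

lemma continuousOn_jostKernel_param (h : IsAdmissible m C) (hq : InL11 q) {s : ℝ} (hs : 0 ≤ s) :
    ContinuousOn (fun k => jostKernel q k (m k) s) {k : ℂ | 0 ≤ k.im} := by
  refine continuousOn_of_dominated (bound := fun t => |q t| * C)
    (fun k hk => aestronglyMeasurable_jostKernel_integrand hq (h.continuousOn_pos k hk) k hs)
    (fun k hk => ?_) ((hq.integrableOn_abs.mono_set (Ioi_subset_Ioi hs)).mul_const C) ?_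
  · filter_upwards [ae_restrict_mem measurableSet_Ioi] with t ht
    exact norm_jostKernel_integrand_le hk (le_of_lt ht) (h.norm_le k hk t (hs.trans (le_of_lt ht)))
  · filter_upwards [ae_restrict_mem measurableSet_Ioi] with t ht
    exact ContinuousOn.mul (by fun_prop)
      (continuousOn_const.mul (h.continuousOn_param t (hs.trans (le_of_lt ht))))

lemma differentiableOn_jostKernel_param (h : IsAdmissible m C) (hq : InL11 q) {s : ℝ}
    (hs : 0 ≤ s) :
    DifferentiableOn ℂ (fun k => jostKernel q k (m k) s) {k : ℂ | 0 < k.im} := by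
  refine differentiableOn_integral_of_dominated isOpen_upper (bound := fun t => |q t| * C)
    (fun k hk => aestronglyMeasurable_jostKernel_integrand hq
      (h.continuousOn_pos k (le_of_lt hk)) k hs)
    ?_ ((hq.integrableOn_abs.mono_set (Ioi_subset_Ioi hs)).mul_const C) ?_
  · filter_upwards [ae_restrict_mem measurableSet_Ioi] with t ht k hk
    have hk : 0 < k.im := hk
    exact norm_jostKernel_integrand_le hk.le (le_of_lt ht)
      (h.norm_le k hk.le t (hs.trans (le_of_lt ht)))
  · filter_upwards [ae_restrict_mem measurableSet_Ioi] with t ht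
    exact DifferentiableOn.mul (by fun_prop)
      ((differentiableOn_const _).mul (h.differentiableOn_param t (hs.trans (le_of_lt ht))))

/-- One Volterra step preserves admissibility. The bound `C'` is an input, because the constant
obtained from `C` alone would lose the factorial gain. -/
lemma integral_jostKernel (h : IsAdmissible m C) (hq : InL11 q) {C' : ℝ}
    (hC' : ∀ k : ℂ, 0 ≤ k.im → ∀ t, 0 ≤ t → ‖∫ s in Ioi t, jostKernel q k (m k) s‖ ≤ C') :
    IsAdmissible (fun k x => ∫ s in Ioi x, jostKernel q k (m k) s) C' := by
  have hmeas : ∀ (k : ℂ) (x : ℝ), 0 ≤ k.im → 0 ≤ x →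
      AEStronglyMeasurable (jostKernel q k (m k)) (volume.restrict (Ioi x)) := fun k x hk hx =>
    ((integrableOn_jostKernel hq hk (h.continuousOn_pos k hk) (h.norm_le k hk)).mono_set
      (Ioi_subset_Ioi hx)).aestronglyMeasurable
  have hbd : ∀ (k : ℂ) (x s : ℝ), 0 ≤ k.im → 0 ≤ x → s ∈ Ioi x →
      ‖jostKernel q k (m k) s‖ ≤ tail q s * C := fun k x s hk hx hs =>
    norm_jostKernel_le hq hk (hx.trans (le_of_lt hs)) fun t ht =>
      h.norm_le k hk t ((hx.trans (le_of_lt hs)).trans ht)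
  refine ⟨fun k hk => ?_, hC', fun t ht => ?_, fun t ht => ?_⟩
  · exact continuousOn_integral_Ioi
      (integrableOn_jostKernel hq hk (h.continuousOn_pos k hk) (h.norm_le k hk))
  · refine continuousOn_of_dominated (bound := fun s => tail q s * C)
      (fun k hk => hmeas k t hk ht) (fun k hk => ?_)
      (((integrableOn_tail hq).mono_set (Ioi_subset_Ioi ht)).mul_const C) ?_
    · filter_upwards [ae_restrict_mem measurableSet_Ioi] with s hs using hbd k t s hk ht hs
    · filter_upwards [ae_restrict_mem measurableSet_Ioi] with s hs
      exact h.continuousOn_jostKernel_param hq (ht.trans (le_of_lt hs))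
  · refine differentiableOn_integral_of_dominated isOpen_upper (bound := fun s => tail q s * C)
      (fun k hk => hmeas k t (le_of_lt hk) ht) ?_
      (((integrableOn_tail hq).mono_set (Ioi_subset_Ioi ht)).mul_const C) ?_
    · filter_upwards [ae_restrict_mem measurableSet_Ioi] with s hs k hk
      exact hbd k t s (le_of_lt hk) ht hs
    · filter_upwards [ae_restrict_mem measurableSet_Ioi] with s hs
      exact h.differentiableOn_jostKernel_param hq (ht.trans (le_of_lt hs))

end IsAdmissible

/-- The terms of the Neumann series for `e^{-ikx} f(x, k)`. -/
noncomputable def jostIter (q : ℝ → ℝ) : ℕ → ℂ → ℝ → ℂ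
  | 0 => fun _ _ => 1
  | n + 1 => fun k x => ∫ s in Ioi x, jostKernel q k (jostIter q n k) s

/-- The modified Jost solution `e^{-ikx} f(x, k)`. -/
noncomputable def jostM (q : ℝ → ℝ) (k : ℂ) (x : ℝ) : ℂ := ∑' n, jostIter q n k x

/-- The inner kernel costs a factor `tail q s`, and the outer integration raises the power of
`tail₂` and divides by `n + 1`. The estimate must be local in `x` for this induction; admissibility
then keeps only its value at 0. -/
lemma norm_jostIter_le_and_isAdmissible (hq : InL11 q) (n : ℕ) :
    (∀ k : ℂ, 0 ≤ k.im → ∀ x, 0 ≤ x → ‖jostIter q n k x‖ ≤ tail₂ q x ^ n / n.factorial) ∧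
      IsAdmissible (jostIter q n) (tail₂ q 0 ^ n / n.factorial) := by
  induction n with
  | zero =>
    refine ⟨fun k _ x _ => by simp [jostIter], fun k _ => continuousOn_const, fun k _ t _ => ?_,
      fun t _ => continuousOn_const, fun t _ => differentiableOn_const _⟩
    simp [jostIter]
  | succ n ih =>
    have hb : ∀ k : ℂ, 0 ≤ k.im → ∀ x, 0 ≤ x →
        ‖jostIter q (n + 1) k x‖ ≤ tail₂ q x ^ (n + 1) / (n + 1).factorial := by
      intro k hk x hx
      have e : ∫ s in Ioi x, tail q s * tail₂ q s ^ n / n.factorial =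
          tail₂ q x ^ (n + 1) / (n + 1).factorial := by
        rw [integral_div, integral_tail_mul_pow hq n hx, Nat.factorial_succ]
        push_cast; field_simp
      rw [← e, jostIter]
      refine norm_integral_le_of_norm_le
        (((integrableOn_tail_mul_pow hq n).mono_set (Ioi_subset_Ioi hx)).div_const _) ?_
      filter_upwards [ae_restrict_mem measurableSet_Ioi] with s hs
      have hs0 : 0 ≤ s := hx.trans (le_of_lt hs)
      rw [mul_div_assoc]
      -- The kernel only sees `t ≥ s`, where `tail₂ q t ≤ tail₂ q s`.
      refine norm_jostKernel_le hq hk hs0 fun t ht => (ih.1 k hk t (hs0.trans ht)).trans ?_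
      gcongr
      · exact tail₂_nonneg _ _
      · exact tail₂_anti hq hs0 ht
    refine ⟨hb, ih.2.integral_jostKernel hq fun k hk t ht => (hb k hk t ht).trans ?_⟩
    gcongr
    · exact tail₂_nonneg _ _
    · exact tail₂_anti hq le_rfl ht

lemma norm_jostIter_le (hq : InL11 q) (n : ℕ) (hk : 0 ≤ k.im) {x : ℝ} (hx : 0 ≤ x) :
    ‖jostIter q n k x‖ ≤ tail₂ q x ^ n / n.factorial :=
  (norm_jostIter_le_and_isAdmissible hq n).1 k hk x hx

lemma isAdmissible_jostIter (hq : InL11 q) (n : ℕ) :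
    IsAdmissible (jostIter q n) (tail₂ q 0 ^ n / n.factorial) :=
  (norm_jostIter_le_and_isAdmissible hq n).2

lemma hasSum_jostIter (hq : InL11 q) (hk : 0 ≤ k.im) {x : ℝ} (hx : 0 ≤ x) :
    HasSum (fun n => jostIter q n k x) (jostM q k x) :=
  (Summable.of_norm_bounded (Real.summable_pow_div_factorial (tail₂ q x))
    fun n => norm_jostIter_le hq n hk hx).hasSum

lemma isAdmissible_jostM (hq : InL11 q) : IsAdmissible (jostM q) (Real.exp (tail₂ q 0)) := by
  have hs := Real.summable_pow_div_factorial (tail₂ q 0)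
  have hb : ∀ n, ∀ k : ℂ, 0 ≤ k.im → ∀ t, 0 ≤ t →
      ‖jostIter q n k t‖ ≤ tail₂ q 0 ^ n / n.factorial := fun n => (isAdmissible_jostIter hq n).norm_le
  refine ⟨fun k hk => ?_, fun k hk t ht => ?_, fun t ht => ?_, fun t ht => ?_⟩
  · exact continuousOn_tsum (fun n => (isAdmissible_jostIter hq n).continuousOn_pos k hk) hs
      fun n t ht => hb n k hk t ht
  · rw [Real.exp_eq_exp_ℝ, NormedSpace.exp_eq_tsum_div]
    exact tsum_of_norm_bounded hs.hasSum fun n => hb n k hk t ht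
  · exact continuousOn_tsum (fun n => (isAdmissible_jostIter hq n).continuousOn_param t ht) hs
      fun n k hk => hb n k hk t ht
  · exact Complex.differentiableOn_tsum_of_summable_norm hs
      (fun n => (isAdmissible_jostIter hq n).differentiableOn_param t ht) isOpen_upper
      fun n k hk => hb n k (le_of_lt hk) t ht

lemma hasSum_jostKernel_jostIter (hq : InL11 q) (hk : 0 ≤ k.im) {s : ℝ} (hs : 0 ≤ s) :
    HasSum (fun n => jostKernel q k (jostIter q n k) s) (jostKernel q k (jostM q k) s) := by
  refine hasSum_integral_of_dominated_convergence
    (fun n t => |q t| * (tail₂ q 0 ^ n / n.factorial))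
    (fun n => aestronglyMeasurable_jostKernel_integrand hq
      ((isAdmissible_jostIter hq n).continuousOn_pos k hk) k hs) (fun n => ?_)
    (ae_of_all _ fun t => (Real.summable_pow_div_factorial _).mul_left _) ?_ ?_
  · filter_upwards [ae_restrict_mem measurableSet_Ioi] with t ht
    exact norm_jostKernel_integrand_le hk (le_of_lt ht)
      ((isAdmissible_jostIter hq n).norm_le k hk t (hs.trans (le_of_lt ht)))
  · simp_rw [tsum_mul_left]
    exact (hq.integrableOn_abs.mono_set (Ioi_subset_Ioi hs)).mul_const _
  · filter_upwards [ae_restrict_mem measurableSet_Ioi] with t ht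
    exact ((hasSum_jostIter hq hk (hs.trans (le_of_lt ht))).mul_left _).mul_left _

/-- The Volterra equation for the modified Jost solution. -/
lemma jostM_eq (hq : InL11 q) (hk : 0 ≤ k.im) {x : ℝ} (hx : 0 ≤ x) :
    jostM q k x = 1 + ∫ s in Ioi x, jostKernel q k (jostM q k) s := by
  have h : HasSum (fun n => jostIter q (n + 1) k x)
      (∫ s in Ioi x, jostKernel q k (jostM q k) s) := by
    refine hasSum_integral_of_dominated_convergence
      (fun n s => tail q s * (tail₂ q 0 ^ n / n.factorial))
      (fun n => ((integrableOn_jostKernel hq hk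
        ((isAdmissible_jostIter hq n).continuousOn_pos k hk)
        ((isAdmissible_jostIter hq n).norm_le k hk)).mono_set
          (Ioi_subset_Ioi hx)).aestronglyMeasurable) (fun n => ?_)
      (ae_of_all _ fun t => (Real.summable_pow_div_factorial _).mul_left _) ?_ ?_
    · filter_upwards [ae_restrict_mem measurableSet_Ioi] with s hs
      have hs0 : 0 ≤ s := hx.trans (le_of_lt hs)
      exact norm_jostKernel_le hq hk hs0 fun t ht =>
        (isAdmissible_jostIter hq n).norm_le k hk t (hs0.trans ht)
    · simp_rw [tsum_mul_left]
      exact ((integrableOn_tail hq).mono_set (Ioi_subset_Ioi hx)).mul_const _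
    · filter_upwards [ae_restrict_mem measurableSet_Ioi] with s hs
      exact hasSum_jostKernel_jostIter hq hk (hx.trans (le_of_lt hs))
  have h2 := (hasSum_jostIter hq hk hx).summable.sum_add_tsum_nat_add 1
  rw [h.tsum_eq] at h2
  simpa [jostIter, jostM] using h2.symm

end Schrodinger

/-! ### The Jost solution: existence, uniqueness, behaviour for large `k` -/

namespace Schrodinger

variable {q : ℝ → ℝ} {k : ℂ}

/-- `-∂ₓ (e^{-ikx} f(x, k))`. -/
noncomputable def jostP (q : ℝ → ℝ) (k : ℂ) (x : ℝ) : ℂ := jostKernel q k (jostM q k) x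

/-- The Jost solution `f(x, k)`. -/
noncomputable def jostSol (q : ℝ → ℝ) (k : ℂ) (x : ℝ) : ℂ :=
  Complex.exp (Complex.I * k * x) * jostM q k x

/-- The derivative `∂ₓ f(x, k)` of the Jost solution. -/
noncomputable def jostSol' (q : ℝ → ℝ) (k : ℂ) (x : ℝ) : ℂ :=
  Complex.exp (Complex.I * k * x) * (Complex.I * k * jostM q k x - jostP q k x)

/-- A uniform bound for the modified Jost solutions. -/
noncomputable def jostBound (q : ℝ → ℝ) : ℝ := Real.exp (tail₂ q 0)

lemma jostBound_pos (q : ℝ → ℝ) : 0 < jostBound q := Real.exp_pos _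

lemma norm_jostM_le (hq : InL11 q) (hk : 0 ≤ k.im) {x : ℝ} (hx : 0 ≤ x) :
    ‖jostM q k x‖ ≤ jostBound q := (isAdmissible_jostM hq).norm_le k hk x hx

lemma norm_jostP_le (hq : InL11 q) (hk : 0 ≤ k.im) {x : ℝ} (hx : 0 ≤ x) :
    ‖jostP q k x‖ ≤ tail q x * jostBound q :=
  norm_jostKernel_le hq hk hx fun _ ht => norm_jostM_le hq hk (hx.trans ht)

lemma continuousOn_jostM (hq : InL11 q) (hk : 0 ≤ k.im) : ContinuousOn (jostM q k) (Ici 0) :=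
  (isAdmissible_jostM hq).continuousOn_pos k hk

lemma continuousOn_jostP (hq : InL11 q) (hk : 0 ≤ k.im) : ContinuousOn (jostP q k) (Ici 0) :=
  continuousOn_jostKernel hq hk (continuousOn_jostM hq hk) fun _ ht => norm_jostM_le hq hk ht

lemma integrableOn_jostP (hq : InL11 q) (hk : 0 ≤ k.im) : IntegrableOn (jostP q k) (Ioi 0) :=
  integrableOn_jostKernel hq hk (continuousOn_jostM hq hk) fun _ ht => norm_jostM_le hq hk ht

lemma norm_jostM_sub_one_le (hq : InL11 q) (hk : 0 ≤ k.im) {x : ℝ} (hx : 0 ≤ x) :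
    ‖jostM q k x - 1‖ ≤ tail₂ q x * jostBound q := by
  rw [jostM_eq hq hk hx, add_sub_cancel_left, tail₂, ← integral_mul_const]
  refine norm_integral_le_of_norm_le
    (((integrableOn_tail hq).mono_set (Ioi_subset_Ioi hx)).mul_const _) ?_
  filter_upwards [ae_restrict_mem measurableSet_Ioi] with s hs
  exact norm_jostP_le hq hk (hx.trans (le_of_lt hs))

lemma tendsto_tail₂ (hq : InL11 q) : Tendsto (tail₂ q) atTop (𝓝 0) :=
  tendsto_integral_Ioi_atTop_zero (integrableOn_tail hq)

lemma tendsto_tail (hq : InL11 q) : Tendsto (tail q) atTop (𝓝 0) :=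
  tendsto_integral_Ioi_atTop_zero hq.integrableOn_abs

lemma tendsto_jostM (hq : InL11 q) (hk : 0 ≤ k.im) : Tendsto (jostM q k) atTop (𝓝 1) := by
  rw [tendsto_iff_norm_sub_tendsto_zero]
  refine squeeze_zero' (Eventually.of_forall fun _ => norm_nonneg _) ?_
    (by simpa using (tendsto_tail₂ hq).mul_const (jostBound q))
  filter_upwards [eventually_ge_atTop 0] with x hx using norm_jostM_sub_one_le hq hk hx

lemma tendsto_jostP (hq : InL11 q) (hk : 0 ≤ k.im) : Tendsto (jostP q k) atTop (𝓝 0) := by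
  rw [tendsto_zero_iff_norm_tendsto_zero]
  refine squeeze_zero' (Eventually.of_forall fun _ => norm_nonneg _) ?_
    (by simpa using (tendsto_tail hq).mul_const (jostBound q))
  filter_upwards [eventually_ge_atTop 0] with x hx using norm_jostP_le hq hk hx

lemma hasDerivWithinAt_jostM (hq : InL11 q) (hk : 0 ≤ k.im) {x : ℝ} (hx : 0 ≤ x) :
    HasDerivWithinAt (jostM q k) (-jostP q k x) (Ici 0) x :=
  ((hasDerivWithinAt_integral_Ioi (integrableOn_jostP hq hk) (continuousOn_jostP hq hk)
    hx).const_add 1).congr_of_mem (fun _ ht => jostM_eq hq hk ht) hx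

lemma jostM_eq_sub (hq : InL11 q) (hk : 0 ≤ k.im) {x : ℝ} (hx : 0 ≤ x) :
    jostM q k x = jostM q k 0 + ∫ t in (0 : ℝ)..x, -jostP q k t := by
  rw [jostM_eq hq hk hx, jostM_eq hq hk le_rfl, intervalIntegral.integral_neg]
  have := integral_Ioi_eq_sub (integrableOn_jostP hq hk) hx
  simp only [jostP] at this ⊢
  rw [this]; ring

lemma jostP_eq (hq : InL11 q) (hk : 0 ≤ k.im) {x : ℝ} (hx : 0 ≤ x) :
    jostP q k x = jostP q k 0 +
      ∫ t in (0 : ℝ)..x, (-(2 * Complex.I * k) * jostP q k t - (q t : ℂ) * jostM q k t) :=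
  jostKernel_eq_add_integral hq hk (continuousOn_jostM hq hk)
    (fun _ ht => norm_jostM_le hq hk ht) hx

lemma hasDerivAt_exp_I_mul (k : ℂ) (x : ℝ) :
    HasDerivAt (fun t : ℝ => Complex.exp (Complex.I * k * t))
      (Complex.I * k * Complex.exp (Complex.I * k * x)) x := by
  have h := (((hasDerivAt_id (x : ℂ)).const_mul (Complex.I * k)).cexp).comp_ofReal
  refine h.congr_deriv ?_
  simp only [id, mul_one]; ring

lemma integrableOn_mul_jostM (hq : InL11 q) (hk : 0 ≤ k.im) :
    IntegrableOn (fun t => (q t : ℂ) * jostM q k t) (Ioi 0) := by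
  refine Integrable.mul_bdd (c := jostBound q) hq.integrableOn.ofReal
    (((continuousOn_jostM hq hk).mono Ioi_subset_Ici_self).aestronglyMeasurable
      measurableSet_Ioi) ?_
  filter_upwards [ae_restrict_mem measurableSet_Ioi] with s hs
  exact norm_jostM_le hq hk (le_of_lt hs)

/-- Existence of the Jost solution. -/
lemma isJostSolution_jostSol (hq : InL11 q) (hk : 0 ≤ k.im) :
    IsJostSolution q k (jostSol q k) (jostSol' q k) where
  isSolution :=
    { hasDeriv := fun x hx => by
        refine ((hasDerivAt_exp_I_mul k x).hasDerivWithinAt.mul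
          (hasDerivWithinAt_jostM hq hk hx)).congr_deriv ?_
        rw [jostSol']; ring
      deriv_eq := fun x hx => by
        have hp := intervalIntegrable_of_integrableOn_Ioi (integrableOn_jostP hq hk) hx
        have hqm := intervalIntegrable_of_integrableOn_Ioi (integrableOn_mul_jostM hq hk) hx
        have hcont : Continuous fun t : ℝ => Complex.I * k * Complex.exp (Complex.I * k * t) := by
          fun_prop
        have h := mul_eq_add_integral (A := fun t : ℝ => Complex.exp (Complex.I * k * t))
          (B := fun t => Complex.I * k * jostM q k t - jostP q k t)
          (b := fun t => Complex.I * k * jostP q k t + (q t : ℂ) * jostM q k t) hx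
          (hcont.intervalIntegrable 0 x) ((hp.const_mul _).add hqm)
          (fun t _ => by
            rw [intervalIntegral.integral_eq_sub_of_hasDerivAt
              (fun s _ => hasDerivAt_exp_I_mul k s) (hcont.intervalIntegrable 0 t)]
            ring)
          (fun t ht => by
            have hp := intervalIntegrable_of_integrableOn_Ioi (integrableOn_jostP hq hk) ht.1
            have hqm := intervalIntegrable_of_integrableOn_Ioi (integrableOn_mul_jostM hq hk) ht.1
            rw [jostM_eq_sub hq hk ht.1, jostP_eq hq hk ht.1,
              intervalIntegral.integral_sub (hp.const_mul _) hqm,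
              intervalIntegral.integral_add (hp.const_mul _) hqm,
              intervalIntegral.integral_const_mul, intervalIntegral.integral_const_mul,
              intervalIntegral.integral_neg]
            ring)
        simp only [jostSol']
        rw [h]
        congr 1
        refine intervalIntegral.integral_congr fun t _ => ?_
        simp only [jostSol]
        linear_combination (k ^ 2 * Complex.exp (Complex.I * k * t) * jostM q k t) * Complex.I_sq }
  asymptotics := by
    refine (tendsto_jostM hq hk).congr fun x => ?_
    rw [jostSol, ← mul_assoc, ← Complex.exp_add, neg_add_cancel, Complex.exp_zero, one_mul]

lemma norm_exp_I_mul (k : ℂ) (x : ℝ) :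
    ‖Complex.exp (Complex.I * k * x)‖ = Real.exp (-(k.im * x)) := by
  rw [Complex.norm_exp]
  congr 1
  simp [Complex.mul_re, Complex.mul_im]

lemma norm_exp_I_mul_le_one (hk : 0 ≤ k.im) {x : ℝ} (hx : 0 ≤ x) :
    ‖Complex.exp (Complex.I * k * x)‖ ≤ 1 := by
  rw [norm_exp_I_mul, Real.exp_le_one_iff, neg_nonpos]
  exact mul_nonneg hk hx

lemma norm_jostSol_le (hq : InL11 q) (hk : 0 ≤ k.im) {x : ℝ} (hx : 0 ≤ x) :
    ‖jostSol q k x‖ ≤ jostBound q * Real.exp (-(k.im * x)) := by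
  rw [jostSol, norm_mul, norm_exp_I_mul, mul_comm]
  gcongr
  exact norm_jostM_le hq hk hx

lemma norm_jostSol'_le (hq : InL11 q) (hk : 0 ≤ k.im) {x : ℝ} (hx : 0 ≤ x) :
    ‖jostSol' q k x‖ ≤ (‖k‖ + tail q 0) * jostBound q * Real.exp (-(k.im * x)) := by
  rw [jostSol', norm_mul, norm_exp_I_mul, mul_comm]
  gcongr
  calc _ ≤ ‖Complex.I * k * jostM q k x‖ + ‖jostP q k x‖ := norm_sub_le _ _
    _ ≤ ‖k‖ * jostBound q + tail q 0 * jostBound q := by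
      gcongr
      · rw [norm_mul, norm_mul, Complex.norm_I, one_mul]
        gcongr
        exact norm_jostM_le hq hk hx
      · refine (norm_jostP_le hq hk hx).trans ?_
        gcongr
        · exact (jostBound_pos q).le
        · exact tail_le_zero hq hx
    _ = _ := by ring

/-- The integrated constancy of the Wronskian of two solutions with the same energy. -/
lemma IsSolution.wronskian_mul_eq {E : ℂ} {u v f g : ℝ → ℂ} (h₁ : IsSolution q E u v)
    (h₂ : IsSolution q E f g) (hq : InL11 q) {x : ℝ} (hx : 0 ≤ x) :
    (v 0 * f 0 - u 0 * g 0) * x =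
      u x * f x - u 0 * f 0 - 2 * ∫ t in (0 : ℝ)..x, u t * g t := by
  have hsub : uIcc 0 x ⊆ Ici 0 := by rw [uIcc_of_le hx]; exact Icc_subset_Ici_self
  have p := mul_eq_add_integral hx (h₁.intervalIntegrable_snd hq hx)
    (h₂.intervalIntegrable_snd hq hx) (fun t ht => h₁.fst_eq hq ht.1)
    (fun t ht => h₂.fst_eq hq ht.1)
  have cu := h₁.continuousOn_fst.mono hsub
  have cf := h₂.continuousOn_fst.mono hsub
  have cv := (h₁.continuousOn_snd hq).mono hsub
  have cg := (h₂.continuousOn_snd hq).mono hsub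
  have cvf : ContinuousOn (fun t => v t * f t) (uIcc 0 x) := cv.mul cf
  have cug : ContinuousOn (fun t => u t * g t) (uIcc 0 x) := cu.mul cg
  have hW : ∫ t in (0 : ℝ)..x, (v t * f t - u t * g t) = (v 0 * f 0 - u 0 * g 0) * x := by
    rw [intervalIntegral.integral_congr (g := fun _ => v 0 * f 0 - u 0 * g 0) fun t ht => ?_]
    · rw [intervalIntegral.integral_const, sub_zero, Complex.real_smul, mul_comm]
    · have := h₁.wronskian h₂ hq (hsub ht)
      simpa using this
  rw [intervalIntegral.integral_sub cvf.intervalIntegrable cug.intervalIntegrable] at hW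
  rw [intervalIntegral.integral_add cvf.intervalIntegrable cug.intervalIntegrable] at p
  linear_combination -p - hW

/-- Nothing is known about `v = u'` at infinity, so the Wronskian is averaged over `[N, N + 1]`.
There `v f = (u f)' - u g` removes `v`, and all remaining terms are small with `u`. -/
lemma IsSolution.wronskian_eq_zero_of_tendsto {E : ℂ} {u v f g : ℝ → ℂ}
    (h₁ : IsSolution q E u v) (h₂ : IsSolution q E f g) (hq : InL11 q)
    (hu : Tendsto u atTop (𝓝 0)) {C : ℝ} (hf : ∀ x, 0 ≤ x → ‖f x‖ ≤ C)
    (hg : ∀ x, 0 ≤ x → ‖g x‖ ≤ C) : v 0 * f 0 - u 0 * g 0 = 0 := by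
  rw [← norm_le_zero_iff]
  refine le_of_forall_pos_le_add fun ε hε => ?_
  have hC : 0 ≤ C := (norm_nonneg _).trans (hf 0 le_rfl)
  -- Two boundary terms and twice an integral contribute at most `4 δ C`; the `+ 1` keeps the
  -- denominator positive.
  set δ := ε / (4 * C + 1) with hδ
  have hδ0 : 0 < δ := by positivity
  obtain ⟨N, hN⟩ := eventually_atTop.1
    ((eventually_ge_atTop 0).and ((tendsto_zero_iff_norm_tendsto_zero.1 hu).eventually_le_const hδ0))
  have hN0 := (hN N le_rfl).1
  have e1 := h₁.wronskian_mul_eq h₂ hq hN0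
  have e2 := h₁.wronskian_mul_eq h₂ hq (add_nonneg hN0 zero_le_one)
  have hc : ∀ y : ℝ, 0 ≤ y → IntervalIntegrable (fun t => u t * g t) volume 0 y := fun y hy =>
    ContinuousOn.intervalIntegrable (by
      rw [uIcc_of_le hy]
      exact (h₁.continuousOn_fst.mul (h₂.continuousOn_snd hq)).mono Icc_subset_Ici_self)
  have e3 := intervalIntegral.integral_interval_sub_left (hc (N + 1) (by linarith)) (hc N hN0)
  have e : v 0 * f 0 - u 0 * g 0 = u (N + 1) * f (N + 1) - u N * f N -
      2 * ∫ t in N..(N + 1), u t * g t := by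
    rw [← e3]; push_cast at e1 e2; linear_combination e2 - e1
  have hbd : ∀ x, N ≤ x → ‖u x‖ ≤ δ := fun x hx => (hN x hx).2
  have b1 : ‖u (N + 1) * f (N + 1)‖ ≤ δ * C := by
    rw [norm_mul]; gcongr
    · exact hbd _ (by linarith)
    · exact hf _ (by linarith)
  have b2 : ‖u N * f N‖ ≤ δ * C := by
    rw [norm_mul]; gcongr
    · exact hbd _ le_rfl
    · exact hf _ hN0
  have b3 : ‖∫ t in N..(N + 1), u t * g t‖ ≤ δ * C * |N + 1 - N| := by
    refine intervalIntegral.norm_integral_le_of_norm_le_const fun t ht => ?_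
    rw [uIoc_of_le (by linarith)] at ht
    rw [norm_mul]; gcongr
    · exact hbd _ ht.1.le
    · exact hg _ (hN0.trans ht.1.le)
  rw [add_sub_cancel_left, abs_one, mul_one] at b3
  calc ‖v 0 * f 0 - u 0 * g 0‖ ≤ ‖u (N + 1) * f (N + 1)‖ + ‖u N * f N‖ +
        2 * ‖∫ t in N..(N + 1), u t * g t‖ := by
        rw [e]
        refine (norm_sub_le _ _).trans ?_
        gcongr
        · exact norm_sub_le _ _
        · rw [norm_mul]; simp
    _ ≤ δ * (4 * C) := by linarith
    _ ≤ δ * (4 * C + 1) := by gcongr; linarith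
    _ = 0 + ε := by rw [hδ, zero_add]; field_simp

/-- Zero initial data would force the zero solution, contradicting the normalisation at infinity. -/
lemma jostSol_ne_zero_or (hq : InL11 q) (hk : 0 ≤ k.im) :
    jostSol q k 0 ≠ 0 ∨ jostSol' q k 0 ≠ 0 := by
  by_contra! h
  have hJ := isJostSolution_jostSol hq hk
  have h0 : Tendsto (fun _ : ℝ => (0 : ℂ)) atTop (𝓝 1) := by
    refine hJ.asymptotics.congr' ?_
    filter_upwards [eventually_ge_atTop 0] with x hx
    rw [(hJ.isSolution.eq_zero hq h.1 h.2 hx).1, mul_zero]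
  exact zero_ne_one (tendsto_nhds_unique tendsto_const_nhds h0)

/-- Uniqueness of the Jost solution. -/
lemma IsJostSolution.eqOn (hq : InL11 q) (hk : 0 ≤ k.im) {u v : ℝ → ℂ}
    (h : IsJostSolution q k u v) :
    EqOn u (jostSol q k) (Ici 0) ∧ EqOn v (jostSol' q k) (Ici 0) := by
  have hJ := isJostSolution_jostSol hq hk
  set f := jostSol q k
  set g := jostSol' q k
  have hd := h.isSolution.lincomb hJ.isSolution hq 1 (-1)
  have hlim : Tendsto (fun x : ℝ => Complex.exp (-(Complex.I * k * x)) *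
      (1 * u x + -1 * f x)) atTop (𝓝 0) := by
    have := h.asymptotics.sub hJ.asymptotics
    rw [sub_self] at this
    exact this.congr fun x => by ring
  have hlim0 : Tendsto (fun x : ℝ => 1 * u x + -1 * f x) atTop (𝓝 0) := by
    rw [tendsto_zero_iff_norm_tendsto_zero] at hlim ⊢
    refine squeeze_zero' (Eventually.of_forall fun _ => norm_nonneg _) ?_ hlim
    filter_upwards [eventually_ge_atTop 0] with x hx
    rw [norm_mul]
    refine le_mul_of_one_le_left (norm_nonneg _) ?_
    rw [Complex.exp_neg, norm_inv]
    exact (one_le_inv₀ (norm_pos_iff.2 (Complex.exp_ne_zero _))).2 (norm_exp_I_mul_le_one hk hx)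
  have hexp1 : ∀ x : ℝ, 0 ≤ x → Real.exp (-(k.im * x)) ≤ 1 := fun x hx => by
    rw [Real.exp_le_one_iff, neg_nonpos]; exact mul_nonneg hk hx
  have hbpos := (jostBound_pos q).le
  have htl := tail_nonneg q 0
  have hW := hd.wronskian_eq_zero_of_tendsto hJ.isSolution hq hlim0
    (C := (1 + ‖k‖ + tail q 0) * jostBound q)
    (fun x hx => (norm_jostSol_le hq hk hx).trans (by
      calc _ ≤ jostBound q * 1 := by gcongr; exact hexp1 x hx
        _ = (1 + 0 + 0) * jostBound q := by ring
        _ ≤ _ := by gcongr; exact norm_nonneg _))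
    (fun x hx => (norm_jostSol'_le hq hk hx).trans (by
      calc _ ≤ (‖k‖ + tail q 0) * jostBound q * 1 := by gcongr; exact hexp1 x hx
        _ = (0 + ‖k‖ + tail q 0) * jostBound q := by ring
        _ ≤ _ := by gcongr; exact zero_le_one))
  -- A vanishing Wronskian makes the initial data of the difference a multiple `c` of those of `f`;
  -- the difference is then `c f`, and the asymptotics give `c = 0`.
  obtain ⟨c, hc1, hc2⟩ : ∃ c : ℂ, 1 * u 0 + -1 * f 0 = c * f 0 ∧ 1 * v 0 + -1 * g 0 = c * g 0 := by
    by_cases hf0 : f 0 = 0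
    · have hg0 : g 0 ≠ 0 := (jostSol_ne_zero_or hq hk).resolve_left (not_not.2 hf0)
      refine ⟨(1 * v 0 + -1 * g 0) / g 0, ?_, by field_simp⟩
      rw [hf0] at hW ⊢
      have : (1 * u 0 + -1 * 0) * g 0 = 0 := by linear_combination -hW
      rw [(mul_eq_zero.1 this).resolve_right hg0, mul_zero]
    · refine ⟨(1 * u 0 + -1 * f 0) / f 0, by field_simp, ?_⟩
      field_simp
      linear_combination hW
  have hz := hd.lincomb hJ.isSolution hq 1 (-c)
  have key : ∀ x, 0 ≤ x → 1 * u x + -1 * f x = c * f x ∧ 1 * v x + -1 * g x = c * g x := by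
    intro x hx
    have := hz.eq_zero hq (by linear_combination hc1)
      (by linear_combination hc2) hx
    exact ⟨by linear_combination this.1, by linear_combination this.2⟩
  have hc0 : c = 0 := by
    have h1 := hJ.asymptotics.const_mul c
    rw [mul_one] at h1
    refine tendsto_nhds_unique (h1.congr' ?_) hlim
    filter_upwards [eventually_ge_atTop 0] with x hx
    rw [(key x hx).1]; ring
  refine ⟨fun x hx => ?_, fun x hx => ?_⟩
  · have := (key x hx).1; rw [hc0] at this; linear_combination this
  · have := (key x hx).2; rw [hc0] at this; linear_combination this

lemma isJostSolution_jostPair (hq : InL11 q) (hk : 0 ≤ k.im) :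
    IsJostSolution q k (jostPair q k).1 (jostPair q k).2 :=
  Classical.epsilon_spec (p := fun p : (ℝ → ℂ) × (ℝ → ℂ) => IsJostSolution q k p.1 p.2)
    ⟨(jostSol q k, jostSol' q k), isJostSolution_jostSol hq hk⟩

lemma jostFunction_eq (hq : InL11 q) (hk : 0 ≤ k.im) : jostFunction q k = jostM q k 0 := by
  rw [jostFunction, ((isJostSolution_jostPair hq hk).eqOn hq hk).1 self_mem_Ici]
  simp [jostSol]

lemma jostPair_snd_zero_eq (hq : InL11 q) (hk : 0 ≤ k.im) :
    (jostPair q k).2 0 = Complex.I * k * jostM q k 0 - jostP q k 0 := by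
  rw [((isJostSolution_jostPair hq hk).eqOn hq hk).2 self_mem_Ici]
  simp [jostSol']

/-- The decay of the Jost function towards `1` at infinity. -/
lemma norm_mul_jostM_zero_sub_one_le (hq : InL11 q) (hk : 0 ≤ k.im) :
    ‖k‖ * ‖jostM q k 0 - 1‖ ≤ tail q 0 * jostBound q := by
  have hp := integrableOn_jostP hq hk
  have hqm := integrableOn_mul_jostM hq hk
  -- Letting `x → ∞` in `p' = -2ikp - qm` gives `2ik ∫ p = p(0) - ∫ qm`, while `∫ p = m(0) - 1`. The
  -- gain of a factor `1/k` thus needs no smoothness of `q`.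
  have h1 := intervalIntegral_tendsto_integral_Ioi 0
    ((hp.const_mul (-(2 * Complex.I * k))).sub hqm) tendsto_id
  have h2 := (tendsto_jostP hq hk).sub_const (jostP q k 0)
  have h3 := tendsto_nhds_unique (h1.congr' (by
    filter_upwards [eventually_ge_atTop 0] with x hx
    rw [jostP_eq hq hk hx, add_sub_cancel_left]; rfl)) h2
  have h4 := integral_sub (hp.const_mul (-(2 * Complex.I * k))) hqm
  simp only [Pi.sub_apply] at h3
  rw [h4, integral_const_mul] at h3
  have h5 : jostM q k 0 - 1 = ∫ t in Ioi 0, jostP q k t := by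
    rw [jostM_eq hq hk le_rfl, add_sub_cancel_left]; rfl
  have h6 : 2 * Complex.I * (k * (jostM q k 0 - 1)) =
      jostP q k 0 - ∫ t in Ioi 0, (q t : ℂ) * jostM q k t := by
    rw [h5]; linear_combination -h3
  have h7 : ‖∫ t in Ioi 0, (q t : ℂ) * jostM q k t‖ ≤ tail q 0 * jostBound q := by
    rw [tail, ← integral_mul_const]
    refine norm_integral_le_of_norm_le (hq.integrableOn_abs.mul_const _) ?_
    filter_upwards [ae_restrict_mem measurableSet_Ioi] with s hs
    rw [norm_mul, Complex.norm_real, Real.norm_eq_abs]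
    gcongr
    exact norm_jostM_le hq hk (le_of_lt hs)
  have h8 := congrArg norm h6
  rw [norm_mul, norm_mul, norm_mul, Complex.norm_I] at h8
  have h9 := norm_sub_le (jostP q k 0) (∫ t in Ioi 0, (q t : ℂ) * jostM q k t)
  have h10 := norm_jostP_le hq hk (le_refl (0 : ℝ))
  rw [← h8] at h9
  norm_num at h9
  linarith

end Schrodinger

/-! ### The Jost function: regularity, symmetry, lower bound, simple zeros -/

namespace Schrodinger

variable {q : ℝ → ℝ} {k : ℂ}

/-- The derivative `f'(0, k)` of the Jost solution at the origin. -/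
noncomputable def jostDeriv (q : ℝ → ℝ) (k : ℂ) : ℂ := (jostPair q k).2 0

lemma iFunction_eq (q : ℝ → ℝ) (k : ℂ) : iFunction q k = jostDeriv q k / jostFunction q k := rfl

lemma jostFunction_eq_jostSol (hq : InL11 q) (hk : 0 ≤ k.im) :
    jostFunction q k = jostSol q k 0 :=
  ((isJostSolution_jostPair hq hk).eqOn hq hk).1 self_mem_Ici

lemma jostDeriv_eq_jostSol' (hq : InL11 q) (hk : 0 ≤ k.im) : jostDeriv q k = jostSol' q k 0 :=
  ((isJostSolution_jostPair hq hk).eqOn hq hk).2 self_mem_Ici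

lemma continuousOn_jostFunction (hq : InL11 q) :
    ContinuousOn (jostFunction q) {k : ℂ | 0 ≤ k.im} :=
  ((isAdmissible_jostM hq).continuousOn_param 0 le_rfl).congr fun _ hk => jostFunction_eq hq hk

lemma differentiableOn_jostFunction (hq : InL11 q) :
    DifferentiableOn ℂ (jostFunction q) {k : ℂ | 0 < k.im} :=
  ((isAdmissible_jostM hq).differentiableOn_param 0 le_rfl).congr fun _ hk =>
    jostFunction_eq hq (le_of_lt hk)

lemma continuousOn_jostDeriv (hq : InL11 q) :
    ContinuousOn (jostDeriv q) {k : ℂ | 0 ≤ k.im} := by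
  refine ContinuousOn.congr (((continuousOn_const (c := Complex.I)).mul continuousOn_id).mul
    ((isAdmissible_jostM hq).continuousOn_param 0 le_rfl) |>.sub
    ((isAdmissible_jostM hq).continuousOn_jostKernel_param hq le_rfl))
    fun k hk => jostPair_snd_zero_eq hq hk

lemma differentiableOn_jostDeriv (hq : InL11 q) :
    DifferentiableOn ℂ (jostDeriv q) {k : ℂ | 0 < k.im} := by
  refine DifferentiableOn.congr (((differentiableOn_const (c := Complex.I)).mul
    differentiableOn_id).mul ((isAdmissible_jostM hq).differentiableOn_param 0 le_rfl) |>.sub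
    ((isAdmissible_jostM hq).differentiableOn_jostKernel_param hq le_rfl))
    fun k hk => jostPair_snd_zero_eq hq (le_of_lt hk)

lemma norm_jostFunction_le (hq : InL11 q) (hk : 0 ≤ k.im) : ‖jostFunction q k‖ ≤ jostBound q := by
  rw [jostFunction_eq hq hk]; exact norm_jostM_le hq hk le_rfl

lemma norm_jostDeriv_le (hq : InL11 q) (hk : 0 ≤ k.im) :
    ‖jostDeriv q k‖ ≤ (‖k‖ + tail q 0) * jostBound q := by
  rw [jostDeriv_eq_jostSol' hq hk]; simpa using norm_jostSol'_le hq hk (le_refl (0 : ℝ))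

lemma norm_mul_jostFunction_sub_one_le (hq : InL11 q) (hk : 0 ≤ k.im) :
    ‖k‖ * ‖jostFunction q k - 1‖ ≤ tail q 0 * jostBound q := by
  rw [jostFunction_eq hq hk]; exact norm_mul_jostM_zero_sub_one_le hq hk

/-- The symmetry of the Jost solutions under `k ↦ -k̄`. -/
lemma jost_neg_conj (hq : InL11 q) (hk : 0 ≤ k.im) :
    jostFunction q (-starRingEnd ℂ k) = starRingEnd ℂ (jostFunction q k) ∧
      jostDeriv q (-starRingEnd ℂ k) = starRingEnd ℂ (jostDeriv q k) := by
  have hk' : 0 ≤ (-starRingEnd ℂ k).im := by simpa using hk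
  have hJ := isJostSolution_jostPair hq hk
  have hJ' : IsJostSolution q (-starRingEnd ℂ k) (fun x => starRingEnd ℂ ((jostPair q k).1 x))
      (fun x => starRingEnd ℂ ((jostPair q k).2 x)) := by
    refine ⟨?_, ?_⟩
    · have := hJ.isSolution.conj
      rwa [map_pow, ← neg_sq] at this
    · have := (Complex.continuous_conj.tendsto 1).comp hJ.asymptotics
      rw [map_one] at this
      refine this.congr fun x => ?_
      rw [Function.comp_apply, map_mul, ← Complex.exp_conj]
      congr 2
      simp
  have h1 := hJ'.eqOn hq hk'
  rw [jostFunction_eq_jostSol hq hk', jostDeriv_eq_jostSol' hq hk', ← h1.1 self_mem_Ici,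
    ← h1.2 self_mem_Ici]
  exact ⟨rfl, rfl⟩

lemma iFunction_neg_ofReal (hq : InL11 q) (s : ℝ) :
    iFunction q ((-s : ℝ) : ℂ) = starRingEnd ℂ (iFunction q s) := by
  have h := jost_neg_conj hq (k := (s : ℂ)) (by simp)
  rw [Complex.conj_ofReal, ← Complex.ofReal_neg] at h
  rw [iFunction_eq, iFunction_eq, h.1, h.2, map_div₀]

lemma tendsto_exp_neg_mul_atTop {b : ℝ} (hb : 0 < b) :
    Tendsto (fun x : ℝ => Real.exp (-(b * x))) atTop (𝓝 0) :=
  Real.tendsto_exp_neg_atTop_nhds_zero.comp (tendsto_id.const_mul_atTop hb)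

/-- One `X` serves all `k`, since the estimate by `tail₂` is uniform. The value 1/8 leaves room both
for `‖m‖ ≥ 1/2` and for a product of two such factors to stay within 1/2 of 1. -/
lemma exists_norm_jostM_sub_one_le (hq : InL11 q) :
    ∃ X : ℝ, 0 ≤ X ∧ ∀ k : ℂ, 0 ≤ k.im → ∀ x, X ≤ x → ‖jostM q k x - 1‖ ≤ 1 / 8 := by
  have h : Tendsto (fun x => tail₂ q x * jostBound q) atTop (𝓝 0) := by
    simpa using (tendsto_tail₂ hq).mul_const (jostBound q)
  obtain ⟨X, hX⟩ := eventually_atTop.1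
    ((eventually_ge_atTop 0).and (h.eventually_le_const (by norm_num : (0 : ℝ) < 1 / 8)))
  exact ⟨X, (hX X le_rfl).1, fun k hk x hx =>
    (norm_jostM_sub_one_le hq hk (hX x hx).1).trans (hX x hx).2⟩

/-- The Wronskian of the Jost solution with its complex conjugate. -/
lemma im_jostSol'_mul_conj (hq : InL11 q) (hk : 0 ≤ k.im) {x : ℝ} (hx : 0 ≤ x) :
    (jostSol' q k x * starRingEnd ℂ (jostSol q k x)).im =
      (jostDeriv q k * starRingEnd ℂ (jostFunction q k)).im -
        2 * k.re * k.im * ∫ t in (0 : ℝ)..x, ‖jostSol q k t‖ ^ 2 := by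
  have hS := (isJostSolution_jostSol hq hk).isSolution
  have h := hS.wronskian hS.conj hq hx
  have e : ∫ t in (0 : ℝ)..x, jostSol q k t * starRingEnd ℂ (jostSol q k t) =
      ((∫ t in (0 : ℝ)..x, ‖jostSol q k t‖ ^ 2 : ℝ) : ℂ) := by
    rw [← intervalIntegral.integral_ofReal]
    refine intervalIntegral.integral_congr fun t _ => ?_
    simp only [Complex.mul_conj, Complex.normSq_eq_norm_sq]
  rw [e, ← jostFunction_eq_jostSol hq hk, ← jostDeriv_eq_jostSol' hq hk] at h
  have h2 := congrArg Complex.im h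
  simp only [Complex.sub_im, Complex.add_im, Complex.mul_im, Complex.conj_re, Complex.conj_im,
    Complex.ofReal_re, Complex.ofReal_im, Complex.sub_re, pow_two] at h2 ⊢
  linarith

/-- At real `k` the energy is real, so this part of the Wronskian is constant in `x`; its value is
read off at infinity, where `f ~ e^{isx}` and `f' ~ is e^{isx}`. -/
lemma im_jostDeriv_mul_conj_of_real (hq : InL11 q) (s : ℝ) :
    (jostDeriv q s * starRingEnd ℂ (jostFunction q s)).im = s := by
  have hk : 0 ≤ (s : ℂ).im := by simp
  have hlim : Tendsto (fun x => (jostSol' q s x * starRingEnd ℂ (jostSol q s x)).im) atTop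
      (𝓝 s) := by
    have hm := tendsto_jostM hq hk
    have hp := tendsto_jostP hq hk
    have h1 := ((hm.const_mul (Complex.I * s)).sub hp).mul
      ((Complex.continuous_conj.tendsto 1).comp hm)
    have h2 := (Complex.continuous_im.tendsto _).comp h1
    have e : ((Complex.I * s * 1 - 0) * starRingEnd ℂ 1).im = s := by simp
    rw [e] at h2
    refine h2.congr fun x => ?_
    simp only [Function.comp_apply, jostSol, jostSol', map_mul]
    congr 1
    have : Complex.exp (Complex.I * s * x) * starRingEnd ℂ (Complex.exp (Complex.I * s * x)) = 1 := by
      rw [Complex.mul_conj, Complex.normSq_eq_norm_sq, norm_exp_I_mul]; simp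
    linear_combination (-((Complex.I * s * jostM q s x - jostP q s x) *
      starRingEnd ℂ (jostM q s x))) * this
  refine tendsto_nhds_unique (tendsto_const_nhds.congr' ?_) hlim
  filter_upwards [eventually_ge_atTop 0] with x hx
  rw [im_jostSol'_mul_conj hq hk hx]; simp

/-- A lower bound for the Jost function off the imaginary axis. -/
lemma exists_abs_re_mul_le (hq : InL11 q) :
    ∃ X : ℝ, 0 ≤ X ∧ ∀ k : ℂ, 0 ≤ k.im →
      |k.re| / 4 * Real.exp (-(2 * k.im * X)) ≤ ‖jostDeriv q k‖ * ‖jostFunction q k‖ := by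
  obtain ⟨X, hX0, hX⟩ := exists_norm_jostM_sub_one_le hq
  refine ⟨X, hX0, fun k hk => ?_⟩
  have hle : |(jostDeriv q k * starRingEnd ℂ (jostFunction q k)).im| ≤
      ‖jostDeriv q k‖ * ‖jostFunction q k‖ := by
    refine (Complex.abs_im_le_norm _).trans ?_
    rw [norm_mul, RCLike.norm_conj]
  refine le_trans ?_ hle
  -- On the real line the Wronskian is known exactly; the estimate below divides by `Im k`.
  rcases hk.eq_or_lt with hk0 | hkpos
  · have hs : k = (k.re : ℂ) := Complex.ext (by simp) (by simp [← hk0])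
    rw [hs, im_jostDeriv_mul_conj_of_real hq]
    simp only [Complex.ofReal_re, Complex.ofReal_im, mul_zero, zero_mul, neg_zero, Real.exp_zero]
    linarith [abs_nonneg k.re]
  set b := k.im with hb
  set C := ((‖k‖ + tail q 0) * jostBound q) * jostBound q
  have hS := (isJostSolution_jostSol hq hk).isSolution
  -- Beyond `X` one has `‖f‖² ≥ e^{-2bt} / 4`, whose integral carries a factor `1 / (8b)`. It
  -- cancels the `b` in the Wronskian identity, so the bound survives `b → 0`. The boundary term at
  -- `x` disappears in the limit.
  have key : ∀ x, X ≤ x → |k.re| / 4 * (Real.exp (-(2 * b * X)) - Real.exp (-(2 * b * x))) -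
      C * Real.exp (-(2 * b * x)) ≤ |(jostDeriv q k * starRingEnd ℂ (jostFunction q k)).im| := by
    intro x hx
    have hx0 : 0 ≤ x := hX0.trans hx
    have h1 := im_jostSol'_mul_conj hq hk hx0
    have hv : |(jostSol' q k x * starRingEnd ℂ (jostSol q k x)).im| ≤
        C * Real.exp (-(2 * b * x)) := by
      refine (Complex.abs_im_le_norm _).trans ?_
      rw [norm_mul, RCLike.norm_conj]
      calc _ ≤ ((‖k‖ + tail q 0) * jostBound q * Real.exp (-(b * x))) *
            (jostBound q * Real.exp (-(b * x))) :=
            mul_le_mul (norm_jostSol'_le hq hk hx0) (norm_jostSol_le hq hk hx0)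
              (norm_nonneg _) ((norm_nonneg _).trans (norm_jostSol'_le hq hk hx0))
        _ = C * (Real.exp (-(b * x)) * Real.exp (-(b * x))) := by ring
        _ = _ := by rw [← Real.exp_add]; congr 2; ring
    have hcont : ContinuousOn (fun t => ‖jostSol q k t‖ ^ 2) (Ici 0) :=
      hS.continuousOn_fst.norm.pow 2
    have hii : ∀ y z : ℝ, 0 ≤ y → y ≤ z →
        IntervalIntegrable (fun t => ‖jostSol q k t‖ ^ 2) volume y z := fun y z hy hyz =>
      ContinuousOn.intervalIntegrable (hcont.mono (by
        rw [uIcc_of_le hyz]; exact fun t ht => hy.trans ht.1))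
    have hcexp : Continuous fun t : ℝ => 1 / 4 * Real.exp (-(2 * b * t)) := by fun_prop
    have hInt : (Real.exp (-(2 * b * X)) - Real.exp (-(2 * b * x))) / (8 * b) ≤
        ∫ t in (0 : ℝ)..x, ‖jostSol q k t‖ ^ 2 := by
      have hcalc : ∫ t in X..x, 1 / 4 * Real.exp (-(2 * b * t)) =
          (Real.exp (-(2 * b * X)) - Real.exp (-(2 * b * x))) / (8 * b) := by
        rw [intervalIntegral.integral_eq_sub_of_hasDerivAt
          (f := fun t => -(Real.exp (-(2 * b * t)) / (8 * b))) (fun t _ => ?_)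
          (hcexp.intervalIntegrable _ _)]
        · ring
        · have := (((hasDerivAt_id t).const_mul (2 * b)).neg.exp.div_const (8 * b)).neg
          refine this.congr_deriv ?_
          simp only [id, Pi.neg_apply]
          field_simp
          norm_num
      rw [← hcalc, ← intervalIntegral.integral_add_adjacent_intervals (hii 0 X le_rfl hX0)
        (hii X x hX0 hx)]
      refine le_add_of_nonneg_of_le
        (intervalIntegral.integral_nonneg hX0 fun t _ => by positivity) ?_
      refine intervalIntegral.integral_mono_on hx (hcexp.intervalIntegrable _ _)
        (hii X x hX0 hx) fun t ht => ?_
      have hm := hX k hk t ht.1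
      have hm2 : 1 / 2 ≤ ‖jostM q k t‖ := by
        have := norm_sub_norm_le 1 (jostM q k t)
        rw [norm_sub_rev, norm_one] at this
        linarith
      rw [jostSol, norm_mul, norm_exp_I_mul, mul_pow, ← Real.exp_nat_mul]
      have e : ((2 : ℕ) : ℝ) * -(k.im * t) = -(2 * b * t) := by push_cast; ring
      rw [e, mul_comm]
      gcongr
      nlinarith
    have h2 : (jostDeriv q k * starRingEnd ℂ (jostFunction q k)).im =
      (jostSol' q k x * starRingEnd ℂ (jostSol q k x)).im +
        2 * k.re * b * ∫ t in (0 : ℝ)..x, ‖jostSol q k t‖ ^ 2 := by rw [h1]; ring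
    rw [h2]
    have h3 : |k.re| / 4 * (Real.exp (-(2 * b * X)) - Real.exp (-(2 * b * x))) ≤
        |2 * k.re * b * ∫ t in (0 : ℝ)..x, ‖jostSol q k t‖ ^ 2| := by
      have hI0 : 0 ≤ ∫ t in (0 : ℝ)..x, ‖jostSol q k t‖ ^ 2 :=
        intervalIntegral.integral_nonneg hx0 fun t _ => by positivity
      rw [abs_mul, abs_of_nonneg hI0, abs_mul, abs_mul, abs_two, abs_of_pos hkpos]
      calc _ = 2 * |k.re| * b *
            ((Real.exp (-(2 * b * X)) - Real.exp (-(2 * b * x))) / (8 * b)) := by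
              field_simp; ring
        _ ≤ _ := by gcongr
    have h4 := abs_sub_abs_le_abs_sub (2 * k.re * b * ∫ t in (0 : ℝ)..x, ‖jostSol q k t‖ ^ 2)
      (-(jostSol' q k x * starRingEnd ℂ (jostSol q k x)).im)
    rw [abs_neg, sub_neg_eq_add, add_comm (2 * k.re * b * _)] at h4
    linarith
  have hexp : Tendsto (fun x : ℝ => Real.exp (-(2 * b * x))) atTop (𝓝 0) :=
    tendsto_exp_neg_mul_atTop (by positivity)
  have hlim := (((hexp.const_sub (Real.exp (-(2 * b * X)))).const_mul (|k.re| / 4))).sub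
    (hexp.const_mul C)
  rw [sub_zero, mul_zero, sub_zero] at hlim
  refine le_of_tendsto hlim ?_
  filter_upwards [eventually_ge_atTop X] with x hx using key x hx

/-- The Wronskian bounds `‖f'‖ ‖f‖` from below, and `f'` is bounded on bounded sets. The constant is
uniform down to the real line: this locates the zeros, makes them simple, and limits the singularity
of `log ‖f‖` at 0. -/
lemma exists_mul_abs_re_le_norm_jostFunction (hq : InL11 q) (R : ℝ) :
    ∃ c : ℝ, 0 < c ∧ ∀ k : ℂ, 0 ≤ k.im → ‖k‖ ≤ R → c * |k.re| ≤ ‖jostFunction q k‖ := by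
  obtain ⟨X, hX0, hX⟩ := exists_abs_re_mul_le hq
  set D := (|R| + tail q 0) * jostBound q + 1 with hD
  have htl := tail_nonneg q 0
  have hB := jostBound_pos q
  have hD0 : 0 < D := by positivity
  refine ⟨Real.exp (-(2 * |R| * X)) / (4 * D), by positivity, fun k hk hkR => ?_⟩
  have hRR := le_abs_self R
  have h1 := hX k hk
  have h2 : ‖jostDeriv q k‖ ≤ D := by
    refine (norm_jostDeriv_le hq hk).trans ?_
    rw [hD]
    have : (‖k‖ + tail q 0) * jostBound q ≤ (|R| + tail q 0) * jostBound q := by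
      gcongr; linarith
    linarith
  have h3 : k.im ≤ |R| := (le_abs_self _).trans ((Complex.abs_im_le_norm k).trans (by linarith))
  have h4 : Real.exp (-(2 * |R| * X)) ≤ Real.exp (-(2 * k.im * X)) := by gcongr
  have h5 : |k.re| / 4 * Real.exp (-(2 * |R| * X)) ≤ D * ‖jostFunction q k‖ :=
    calc _ ≤ |k.re| / 4 * Real.exp (-(2 * k.im * X)) := by gcongr
      _ ≤ _ := h1
      _ ≤ _ := by gcongr
  rw [div_mul_eq_mul_div, div_le_iff₀ (by positivity)]
  linarith

lemma jostFunction_ne_zero_of_re_ne_zero (hq : InL11 q) (hk : 0 ≤ k.im) (hre : k.re ≠ 0) :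
    jostFunction q k ≠ 0 := by
  obtain ⟨c, hc, h⟩ := exists_mul_abs_re_le_norm_jostFunction hq ‖k‖
  have := h k hk le_rfl
  have hp : 0 < c * |k.re| := mul_pos hc (abs_pos.2 hre)
  exact norm_pos_iff.1 (hp.trans_le this)

lemma jostDeriv_ne_zero_of_jostFunction_eq_zero (hq : InL11 q) (hk : 0 ≤ k.im)
    (h : jostFunction q k = 0) : jostDeriv q k ≠ 0 := by
  rw [jostDeriv_eq_jostSol' hq hk]
  rw [jostFunction_eq_jostSol hq hk] at h
  exact (jostSol_ne_zero_or hq hk).resolve_left (not_not.2 h)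

/-- Zeros of the Jost function in the open upper half-plane are simple. -/
lemma deriv_jostFunction_ne_zero (hq : InL11 q) (hk : 0 < k.im) (h : jostFunction q k = 0) :
    deriv (jostFunction q) k ≠ 0 := by
  intro hd
  obtain ⟨c, hc, hlow⟩ := exists_mul_abs_re_le_norm_jostFunction hq (‖k‖ + 1)
  have hre : k.re = 0 := by
    by_contra hre; exact jostFunction_ne_zero_of_re_ne_zero hq hk.le hre h
  have hder := ((differentiableOn_jostFunction hq).differentiableAt
    (isOpen_upper.mem_nhds hk)).hasDerivAt
  rw [hd, hasDerivAt_iff_isLittleO_nhds_zero] at hder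
  have hev := hder.def (half_pos hc)
  -- Moving horizontally off the imaginary axis by `a`, a double zero would give `f = o(a)`, against
  -- `‖f‖ ≥ c a`.
  have ht : Tendsto (fun n : ℕ => (((1 : ℝ) / (n + 1) : ℝ) : ℂ)) atTop (𝓝 0) :=
    (Complex.continuous_ofReal.tendsto' 0 0 Complex.ofReal_zero).comp
      tendsto_one_div_add_atTop_nhds_zero_nat
  obtain ⟨n, hn⟩ := (ht.eventually hev).exists
  set a : ℝ := (1 : ℝ) / (n + 1) with ha
  have ha0 : 0 < a := by positivity
  have ha1 : a ≤ 1 := by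
    rw [ha, div_le_one (by positivity)]; linarith [n.cast_nonneg (α := ℝ)]
  have hna : ‖(a : ℂ)‖ = a := by rw [Complex.norm_real, Real.norm_of_nonneg ha0.le]
  have h2 := hlow (k + a) (by simpa using hk.le) ((norm_add_le _ _).trans (by rw [hna]; linarith))
  rw [h, smul_zero, sub_zero, sub_zero, hna] at hn
  simp only [Complex.add_re, hre, Complex.ofReal_re, zero_add, abs_of_pos ha0] at h2
  nlinarith [mul_pos hc ha0]

end Schrodinger

/-! ### Bound states: zeros of the Jost function and finiteness -/

namespace Schrodinger

variable {q : ℝ → ℝ} {k : ℂ}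

lemma memLp_two_of_norm_le_exp {u : ℝ → ℂ} (hu : ContinuousOn u (Ici 0)) {C b : ℝ} (hb : 0 < b)
    (h : ∀ x, 0 ≤ x → ‖u x‖ ≤ C * Real.exp (-(b * x))) :
    MemLp u 2 (volume.restrict (Ioi (0 : ℝ))) := by
  have hm : AEStronglyMeasurable u (volume.restrict (Ioi (0 : ℝ))) :=
    (hu.mono Ioi_subset_Ici_self).aestronglyMeasurable measurableSet_Ioi
  refine (memLp_two_iff_integrable_sq_norm hm).2 ?_
  have hi : IntegrableOn (fun x : ℝ => C ^ 2 * Real.exp (-(2 * b) * x)) (Ioi 0) :=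
    (integrableOn_exp_mul_Ioi (by linarith) 0).const_mul _
  refine hi.mono' (hm.norm.pow 2) ?_
  filter_upwards [ae_restrict_mem measurableSet_Ioi] with x hx
  have := h x (le_of_lt hx)
  rw [norm_pow, norm_norm]
  calc ‖u x‖ ^ 2 ≤ (C * Real.exp (-(b * x))) ^ 2 := by gcongr
    _ = _ := by
      rw [mul_pow, ← Real.exp_nat_mul]; congr 2; push_cast; ring

lemma ofReal_neg_sq (κ : ℝ) : ((-κ ^ 2 : ℝ) : ℂ) = (Complex.I * κ) ^ 2 := by
  rw [mul_pow, Complex.I_sq]; push_cast; ring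

/-- The Dirichlet eigenvalues correspond to the zeros of the Jost function on `i(0, ∞)`. -/
lemma isDirichletEigenvalue_iff (hq : InL11 q) {κ : ℝ} (hκ : 0 < κ) :
    IsDirichletEigenvalue q (-κ ^ 2) ↔ jostFunction q (Complex.I * κ) = 0 := by
  have him : (Complex.I * (κ : ℂ)).im = κ := by simp
  have hk : 0 ≤ (Complex.I * (κ : ℂ)).im := by rw [him]; exact hκ.le
  have hJ := isJostSolution_jostSol hq hk
  have hL1 : MemLp (jostSol q (Complex.I * κ)) 2 (volume.restrict (Ioi (0 : ℝ))) :=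
    memLp_two_of_norm_le_exp hJ.isSolution.continuousOn_fst hκ fun x hx => by
      simpa only [him] using norm_jostSol_le hq hk hx
  have hL2 : MemLp (jostSol' q (Complex.I * κ)) 2 (volume.restrict (Ioi (0 : ℝ))) :=
    memLp_two_of_norm_le_exp (hJ.isSolution.continuousOn_snd hq) hκ fun x hx => by
      simpa only [him] using norm_jostSol'_le hq hk hx
  rw [IsDirichletEigenvalue, ofReal_neg_sq]
  constructor
  · rintro ⟨u, v, hS, hu0, huL, x₁, hx₁, hux₁⟩
    by_contra hf
    rw [jostFunction_eq_jostSol hq hk] at hf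
    set f := jostSol q (Complex.I * κ)
    set g := jostSol' q (Complex.I * κ)
    have i1 : IntegrableOn (fun t => u t * f t) (Ioi 0) := huL.integrable_mul hL1
    have i2 : IntegrableOn (fun t => u t * g t) (Ioi 0) := huL.integrable_mul hL2
    set C := ∫ t in Ioi 0, ‖u t * g t‖
    have hC0 : 0 ≤ C := integral_nonneg fun _ => norm_nonneg _
    by_cases hv : v 0 = 0
    · exact hux₁ (hS.eq_zero hq hu0 hv hx₁.le).1
    set W := ‖v 0 * f 0‖ with hW
    have hWpos : 0 < W := norm_pos_iff.2 (mul_ne_zero hv hf)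
    -- Only `u` is assumed square integrable, not `u'`, so the integrated Wronskian is used: a
    -- nonzero Wronskian would make the integrable function `u f` grow linearly.
    have key : ∀ x, 0 ≤ x → W * x - 2 * C ≤ ‖u x * f x‖ := by
      intro x hx
      have h1 := hS.wronskian_mul_eq hJ.isSolution hq hx
      rw [hu0] at h1
      have h2 : ‖∫ t in (0 : ℝ)..x, u t * g t‖ ≤ C := by
        refine (intervalIntegral.norm_integral_le_integral_norm hx).trans ?_
        rw [intervalIntegral.integral_of_le hx]
        exact setIntegral_mono_set i2.norm (ae_of_all _ fun _ => norm_nonneg _)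
          Ioc_subset_Ioi_self.eventuallyLE
      have h3 : v 0 * f 0 * x = u x * f x - 2 * ∫ t in (0 : ℝ)..x, u t * g t := by
        linear_combination h1
      have h4 := congrArg norm h3
      rw [norm_mul, ← hW, Complex.norm_real, Real.norm_of_nonneg hx] at h4
      have h5 := norm_sub_le (u x * f x) (2 * ∫ t in (0 : ℝ)..x, u t * g t)
      rw [norm_mul (2 : ℂ), Complex.norm_two] at h5
      linarith
    set X := (2 * C + 1) / W
    have hX0 : 0 ≤ X := by positivity
    have hconst : IntegrableOn (fun _ : ℝ => (1 : ℝ)) (Ioi X) := by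
      refine (i1.mono_set (Ioi_subset_Ioi hX0)).norm.mono' aestronglyMeasurable_const ?_
      filter_upwards [ae_restrict_mem measurableSet_Ioi] with x hx
      have hx : X < x := hx
      have h1 := key x (hX0.trans hx.le)
      have h2 : 2 * C + 1 ≤ W * x := by
        have := (div_le_iff₀ hWpos).1 hx.le
        linarith
      rw [norm_one]; linarith
    simp [integrableOn_const_iff] at hconst
  · intro hf
    refine ⟨jostSol q (Complex.I * κ), jostSol' q (Complex.I * κ), hJ.isSolution, ?_, hL1, ?_⟩
    · rw [← jostFunction_eq_jostSol hq hk, hf]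
    · obtain ⟨x, hx, hx0⟩ := (((tendsto_jostM hq hk).eventually_ne one_ne_zero).and
        (eventually_gt_atTop 0)).exists
      exact ⟨x, hx0, mul_ne_zero (Complex.exp_ne_zero _) hx⟩

lemma mem_boundStates_iff (hq : InL11 q) {κ : ℝ} :
    κ ∈ boundStates q ↔ 0 < κ ∧ jostFunction q (Complex.I * κ) = 0 := by
  constructor
  · rintro ⟨h0, h⟩; exact ⟨h0, (isDirichletEigenvalue_iff hq h0).1 h⟩
  · rintro ⟨h0, h⟩; exact ⟨h0, (isDirichletEigenvalue_iff hq h0).2 h⟩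

/-- Two distinct bound states cannot both be close to `0`. -/
lemma exists_boundStates_separation (hq : InL11 q) :
    ∃ δ : ℝ, 0 < δ ∧ ∀ κ₁ ∈ boundStates q, ∀ κ₂ ∈ boundStates q, κ₁ < δ → κ₂ < δ → κ₁ = κ₂ := by
  obtain ⟨X, hX0, hX⟩ := exists_norm_jostM_sub_one_le hq
  set B := jostBound q
  have hB : 0 < B := jostBound_pos q
  -- For small `σ = κ₁ + κ₂` the mass `e^{-σX} / (2σ)` beyond `X` exceeds the possible loss `B² X`
  -- on `[0, X]`, which is incompatible with orthogonality.
  obtain ⟨δ, hδ0, hδ⟩ : ∃ δ : ℝ, 0 < δ ∧ ∀ σ : ℝ, 0 < σ → σ < 2 * δ →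
      2 * σ * (B ^ 2 * X) < Real.exp (-(σ * X)) := by
    have hc : ContinuousAt (fun σ : ℝ => Real.exp (-(σ * X)) - 2 * σ * (B ^ 2 * X)) 0 := by
      fun_prop
    have hev : ∀ᶠ σ in 𝓝 (0 : ℝ), 0 < Real.exp (-(σ * X)) - 2 * σ * (B ^ 2 * X) :=
      hc.eventually (lt_mem_nhds (by simp))
    obtain ⟨ε, hε, h⟩ := Metric.eventually_nhds_iff.1 hev
    refine ⟨ε / 2, by positivity, fun σ h0 h1 => ?_⟩
    have := h (y := σ) (by rw [Real.dist_eq, sub_zero, abs_of_pos h0]; linarith)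
    linarith
  refine ⟨δ, hδ0, fun κ₁ h₁ κ₂ h₂ hlt₁ hlt₂ => ?_⟩
  by_contra hne
  obtain ⟨hp₁, hz₁⟩ := (mem_boundStates_iff hq).1 h₁
  obtain ⟨hp₂, hz₂⟩ := (mem_boundStates_iff hq).1 h₂
  have him : ∀ κ : ℝ, (Complex.I * (κ : ℂ)).im = κ := fun κ => by simp
  have hk₁ : 0 ≤ (Complex.I * (κ₁ : ℂ)).im := by rw [him]; exact hp₁.le
  have hk₂ : 0 ≤ (Complex.I * (κ₂ : ℂ)).im := by rw [him]; exact hp₂.le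
  rw [jostFunction_eq_jostSol hq hk₁] at hz₁
  rw [jostFunction_eq_jostSol hq hk₂] at hz₂
  have hS₁ := (isJostSolution_jostSol hq hk₁).isSolution
  have hS₂ := (isJostSolution_jostSol hq hk₂).isSolution
  set u₁ := jostSol q (Complex.I * κ₁) with hu₁
  set u₂ := jostSol q (Complex.I * κ₂) with hu₂
  set σ := κ₁ + κ₂ with hσ
  have hσ0 : 0 < σ := by positivity
  have hE : (Complex.I * (κ₂ : ℂ)) ^ 2 - (Complex.I * (κ₁ : ℂ)) ^ 2 ≠ 0 := by
    rw [← ofReal_neg_sq, ← ofReal_neg_sq, ← Complex.ofReal_sub, Complex.ofReal_ne_zero]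
    intro h
    have : (κ₁ - κ₂) * (κ₁ + κ₂) = 0 := by linarith
    rcases mul_eq_zero.1 this with h | h
    · exact hne (sub_eq_zero.1 h)
    · linarith
  -- the inner product of the two eigenfunctions vanishes
  have horth : Tendsto (fun x : ℝ => ∫ t in (0 : ℝ)..x, u₁ t * u₂ t) atTop (𝓝 0) := by
    have t1 : ∀ {κ : ℝ}, 0 < κ → Tendsto (jostSol q (Complex.I * κ)) atTop (𝓝 0) ∧
        Tendsto (jostSol' q (Complex.I * κ)) atTop (𝓝 0) := by
      intro κ hκ
      have hk : 0 ≤ (Complex.I * (κ : ℂ)).im := by rw [him]; exact hκ.le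
      have e : Tendsto (fun x : ℝ => Real.exp (-((Complex.I * (κ : ℂ)).im * x))) atTop (𝓝 0) := by
        rw [him]; exact tendsto_exp_neg_mul_atTop hκ
      constructor <;> rw [tendsto_zero_iff_norm_tendsto_zero]
      · refine squeeze_zero' (Eventually.of_forall fun _ => norm_nonneg _) ?_
          (by simpa using e.const_mul (jostBound q))
        filter_upwards [eventually_ge_atTop 0] with x hx
        simpa using norm_jostSol_le hq hk hx
      · refine squeeze_zero' (Eventually.of_forall fun _ => norm_nonneg _) ?_
          (by simpa using e.const_mul ((‖Complex.I * (κ : ℂ)‖ + tail q 0) * jostBound q))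
        filter_upwards [eventually_ge_atTop 0] with x hx
        simpa using norm_jostSol'_le hq hk hx
    have hW := ((t1 hp₁).2.mul (t1 hp₂).1).sub ((t1 hp₁).1.mul (t1 hp₂).2)
    have hW' := hW.const_mul ((Complex.I * (κ₂ : ℂ)) ^ 2 - (Complex.I * (κ₁ : ℂ)) ^ 2)⁻¹
    rw [mul_zero, sub_zero, mul_zero] at hW'
    refine hW'.congr' ?_
    filter_upwards [eventually_ge_atTop 0] with x hx
    rw [hS₁.wronskian hS₂ hq hx, hz₁, hz₂, mul_zero, zero_mul, sub_zero, zero_add,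
      inv_mul_cancel_left₀ hE]
  have hcont : ContinuousOn (fun t => u₁ t * u₂ t) (Ici 0) :=
    hS₁.continuousOn_fst.mul hS₂.continuousOn_fst
  have hii : ∀ y z : ℝ, 0 ≤ y → y ≤ z →
      IntervalIntegrable (fun t => u₁ t * u₂ t) volume y z := fun y z hy hyz =>
    ContinuousOn.intervalIntegrable (hcont.mono (by
      rw [uIcc_of_le hyz]; exact fun t ht => hy.trans ht.1))
  have hcexp : Continuous fun t : ℝ => 1 / 2 * Real.exp (-(σ * t)) := by fun_prop
  -- On `[0, X]` the product is at most `B²` in modulus; beyond `X` its real part is at least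
  -- `e^{-σt} / 2`, both modified solutions being close to 1.
  have key : ∀ x, X ≤ x → -(B ^ 2 * X) +
      (Real.exp (-(σ * X)) - Real.exp (-(σ * x))) / (2 * σ) ≤
      (∫ t in (0 : ℝ)..x, u₁ t * u₂ t).re := by
    intro x hx
    rw [← intervalIntegral.integral_add_adjacent_intervals (hii 0 X le_rfl hX0) (hii X x hX0 hx),
      Complex.add_re]
    refine add_le_add ?_ ?_
    · have h1 : ‖∫ t in (0 : ℝ)..X, u₁ t * u₂ t‖ ≤ B ^ 2 * |X - 0| := by
        refine intervalIntegral.norm_integral_le_of_norm_le_const fun t ht => ?_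
        rw [uIoc_of_le hX0] at ht
        have hb : ∀ κ : ℝ, 0 < κ → ‖jostSol q (Complex.I * κ) t‖ ≤ B := by
          intro κ hκ
          have hk : 0 ≤ (Complex.I * (κ : ℂ)).im := by rw [him]; exact hκ.le
          rw [jostSol, norm_mul]
          calc _ ≤ 1 * B := mul_le_mul (norm_exp_I_mul_le_one hk ht.1.le)
                (norm_jostM_le hq hk ht.1.le) (norm_nonneg _) zero_le_one
            _ = B := one_mul _
        rw [norm_mul, pow_two]
        exact mul_le_mul (hb κ₁ hp₁) (hb κ₂ hp₂) (norm_nonneg _) hB.le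
      rw [sub_zero, abs_of_nonneg hX0] at h1
      exact (neg_le_neg h1).trans (neg_le_of_abs_le (Complex.abs_re_le_norm _))
    · have hcalc : ∫ t in X..x, 1 / 2 * Real.exp (-(σ * t)) =
          (Real.exp (-(σ * X)) - Real.exp (-(σ * x))) / (2 * σ) := by
        rw [intervalIntegral.integral_eq_sub_of_hasDerivAt
          (f := fun t => -(Real.exp (-(σ * t)) / (2 * σ))) (fun t _ => ?_)
          (hcexp.intervalIntegrable _ _)]
        · ring
        · have := (((hasDerivAt_id t).const_mul σ).neg.exp.div_const (2 * σ)).neg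
          refine this.congr_deriv ?_
          simp only [id, Pi.neg_apply]
          field_simp
      have hre : (∫ t in X..x, u₁ t * u₂ t).re = ∫ t in X..x, (u₁ t * u₂ t).re := by
        have := Complex.reCLM.intervalIntegral_comp_comm (hii X x hX0 hx)
        simpa using this.symm
      rw [← hcalc, hre]
      have hirre : IntervalIntegrable (fun t => (u₁ t * u₂ t).re) volume X x :=
        ContinuousOn.intervalIntegrable (Complex.continuous_re.comp_continuousOn
          (hcont.mono (by rw [uIcc_of_le hx]; exact fun t ht => hX0.trans ht.1)))
      refine intervalIntegral.integral_mono_on hx (hcexp.intervalIntegrable _ _) hirre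
        fun t ht => ?_
      have hexp : ∀ κ : ℝ, Complex.exp (Complex.I * (Complex.I * κ) * t) =
          ((Real.exp (-(κ * t)) : ℝ) : ℂ) := by
        intro κ
        rw [← mul_assoc, Complex.I_mul_I]; push_cast; congr 1; ring
      have hprod : u₁ t * u₂ t = ((Real.exp (-(σ * t)) : ℝ) : ℂ) *
          (jostM q (Complex.I * κ₁) t * jostM q (Complex.I * κ₂) t) := by
        have : Real.exp (-(σ * t)) = Real.exp (-(κ₁ * t)) * Real.exp (-(κ₂ * t)) := by
          rw [← Real.exp_add]; congr 1; rw [hσ]; ring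
        rw [this, hu₁, hu₂, jostSol, jostSol, hexp, hexp]; push_cast; ring
      rw [hprod, Complex.re_ofReal_mul, mul_comm (1 / 2 : ℝ)]
      refine mul_le_mul_of_nonneg_left ?_ (Real.exp_pos _).le
      have a₁ := hX _ hk₁ t ht.1
      have a₂ := hX _ hk₂ t ht.1
      set m₁ := jostM q (Complex.I * κ₁) t
      set m₂ := jostM q (Complex.I * κ₂) t
      have h1 : ‖m₁ * m₂ - 1‖ ≤ 1 / 2 := by
        have e : m₁ * m₂ - 1 = (m₁ - 1) * (m₂ - 1) + (m₁ - 1) + (m₂ - 1) := by ring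
        rw [e]
        refine (norm_add_le _ _).trans ((add_le_add (norm_add_le _ _) le_rfl).trans ?_)
        rw [norm_mul]
        nlinarith [norm_nonneg (m₁ - 1), norm_nonneg (m₂ - 1)]
      have h2 := (abs_le.1 ((Complex.abs_re_le_norm _).trans h1)).1
      rw [Complex.sub_re, Complex.one_re] at h2
      linarith
  have hexpσ : Tendsto (fun x : ℝ => Real.exp (-(σ * x))) atTop (𝓝 0) :=
    tendsto_exp_neg_mul_atTop hσ0
  have hlim1 := ((hexpσ.const_sub (Real.exp (-(σ * X)))).div_const (2 * σ)).const_add (-(B ^ 2 * X))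
  have hlim2 := (Complex.continuous_re.tendsto 0).comp horth
  have hfin := le_of_tendsto_of_tendsto hlim1 hlim2
    (by filter_upwards [eventually_ge_atTop X] with x hx using key x hx)
  rw [sub_zero, Complex.zero_re] at hfin
  have h3 := hδ σ hσ0 (by rw [hσ]; linarith)
  have h4 : Real.exp (-(σ * X)) / (2 * σ) ≤ B ^ 2 * X := by linarith
  rw [div_le_iff₀ (by positivity)] at h4
  linarith

/-- At most one bound state lies below `δ` and none above `M`. An accumulation point in `[δ, M]`
would make `f` vanish on a neighbourhood, although it has no zeros off the imaginary axis. -/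
lemma finite_boundStates (hq : InL11 q) : (boundStates q).Finite := by
  obtain ⟨δ, hδ0, hδ⟩ := exists_boundStates_separation hq
  set M := tail q 0 * jostBound q
  have hsplit : boundStates q ⊆ {κ ∈ boundStates q | κ < δ} ∪ (boundStates q ∩ Icc δ M) := by
    intro κ hκ
    by_cases hlt : κ < δ
    · exact Or.inl ⟨hκ, hlt⟩
    · refine Or.inr ⟨hκ, not_lt.1 hlt, ?_⟩
      obtain ⟨h0, hz⟩ := (mem_boundStates_iff hq).1 hκ
      -- At a zero `‖f - 1‖ = 1`, so the decay estimate reads `κ ≤ M`.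
      have := norm_mul_jostFunction_sub_one_le hq (k := Complex.I * κ) (by simpa using h0.le)
      rw [hz] at this
      simpa [abs_of_pos h0] using this
  refine Finite.subset (Finite.union ?_ ?_) hsplit
  · exact Set.Subsingleton.finite fun a ha b hb => hδ a ha.1 b hb.1 ha.2 hb.2
  · by_contra hinf
    have hinf : (boundStates q ∩ Icc δ M).Infinite := hinf
    have hinj : InjOn (fun κ : ℝ => Complex.I * (κ : ℂ)) (boundStates q ∩ Icc δ M) :=
      fun a _ b _ h => Complex.ofReal_injective (mul_left_cancel₀ Complex.I_ne_zero h)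
    have hcpt : IsCompact ((fun κ : ℝ => Complex.I * (κ : ℂ)) '' Icc δ M) :=
      isCompact_Icc.image (by fun_prop)
    obtain ⟨z, ⟨κ, hκ, rfl⟩, hacc⟩ := (hinf.image hinj).exists_accPt_of_subset_isCompact hcpt
      (image_mono inter_subset_right)
    have hκ0 : 0 < κ := hδ0.trans_le hκ.1
    have hfreq := accPt_iff_frequently_nhdsNE.1 hacc
    have han : AnalyticAt ℂ (jostFunction q) (Complex.I * κ) :=
      (differentiableOn_jostFunction hq).analyticAt (isOpen_upper.mem_nhds (by simpa using hκ0))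
    rcases han.eventually_eq_zero_or_eventually_ne_zero with h | h
    · have ht : Tendsto (fun n : ℕ => Complex.I * κ + (((1 : ℝ) / (n + 1) : ℝ) : ℂ)) atTop
          (𝓝 (Complex.I * κ)) := by
        have := ((Complex.continuous_ofReal.tendsto' 0 0 Complex.ofReal_zero).comp
          (tendsto_one_div_add_atTop_nhds_zero_nat (𝕜 := ℝ))).const_add (Complex.I * (κ : ℂ))
        rw [add_zero] at this
        exact this
      obtain ⟨n, hn⟩ := (ht.eventually h).exists
      have hpos : (0 : ℝ) < 1 / (n + 1) := by positivity
      refine jostFunction_ne_zero_of_re_ne_zero hq ?_ ?_ hn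
      · simp only [Complex.add_im, Complex.ofReal_im, add_zero]; simpa using hκ0.le
      · simp only [Complex.add_re, Complex.ofReal_re]
        simpa using hpos.ne'
    · refine hfreq (h.mono fun y hy hmem => ?_)
      obtain ⟨κ', hκ', rfl⟩ := hmem
      exact hy ((mem_boundStates_iff hq).1 hκ'.1).2

end Schrodinger

/-! ### Cauchy integrals over the boundary of the half-plane -/

namespace Schrodinger

/-- A holomorphic function on the closed upper half-plane that is `O(|z|⁻²)` has vanishing
integral over the real line. -/
lemma integrable_and_integral_eq_zero_of_decay {G : ℂ → ℂ}
    (hG : DifferentiableOn ℂ G {z : ℂ | 0 ≤ z.im}) {C R : ℝ}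
    (hC : ∀ z : ℂ, 0 ≤ z.im → R ≤ ‖z‖ → ‖G z‖ ≤ C / ‖z‖ ^ 2) :
    Integrable (fun s : ℝ => G s) ∧ ∫ s : ℝ, G s = 0 := by
  have hcont : Continuous fun s : ℝ => G s := by
    rw [← continuousOn_univ]
    exact hG.continuousOn.comp Complex.continuous_ofReal.continuousOn fun s _ => by simp
  set T₀ := max R 1 with hT₀
  have hT₀1 : 1 ≤ T₀ := le_max_right _ _
  have hC0 : 0 ≤ C := by
    have h := hC (T₀ : ℂ) (by simp) (by
      rw [Complex.norm_real, Real.norm_of_nonneg (by linarith)]; exact le_max_left _ _)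
    have h2 := (norm_nonneg _).trans h
    rw [Complex.norm_real, Real.norm_of_nonneg (by linarith)] at h2
    by_contra hneg
    exact absurd h2 (not_le.2 (div_neg_of_neg_of_pos (not_le.1 hneg) (by positivity)))
  have hInt : Integrable (fun s : ℝ => G s) := by
    obtain ⟨M, hM⟩ := (isCompact_Icc (a := -T₀) (b := T₀)).exists_bound_of_continuousOn
      hcont.continuousOn
    have hM0 : 0 ≤ M := (norm_nonneg _).trans (hM 0 ⟨by linarith, by linarith⟩)
    refine (integrable_inv_one_add_sq.const_mul (2 * C + M * (1 + T₀ ^ 2))).mono'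
      hcont.aestronglyMeasurable (ae_of_all _ fun s => ?_)
    rw [← div_eq_mul_inv, le_div_iff₀ (by positivity)]
    by_cases hs : |s| ≤ T₀
    · have h1 := hM s (abs_le.1 hs)
      have h2 : s ^ 2 ≤ T₀ ^ 2 := by rw [← sq_abs]; gcongr
      calc ‖G s‖ * (1 + s ^ 2) ≤ M * (1 + T₀ ^ 2) := by gcongr
        _ ≤ _ := by linarith
    · push Not at hs
      have h1 := hC s (by simp) (by
        rw [Complex.norm_real, Real.norm_eq_abs]; exact (le_max_left _ _).trans hs.le)
      rw [Complex.norm_real, Real.norm_eq_abs, sq_abs] at h1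
      have hs2 : 1 ≤ s ^ 2 := by rw [← sq_abs]; nlinarith
      have h3 : C / s ^ 2 * (1 + s ^ 2) ≤ 2 * C := by
        rw [div_mul_eq_mul_div, div_le_iff₀ (by linarith)]; nlinarith
      calc ‖G s‖ * (1 + s ^ 2) ≤ C / s ^ 2 * (1 + s ^ 2) := by gcongr
        _ ≤ _ := by
          have : 0 ≤ M * (1 + T₀ ^ 2) := by positivity
          linarith
  refine ⟨hInt, ?_⟩
  have hlim := intervalIntegral_tendsto_integral hInt tendsto_neg_atTop_atBot tendsto_id
  refine tendsto_nhds_unique hlim ?_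
  rw [tendsto_zero_iff_norm_tendsto_zero]
  have hdec : Tendsto (fun T : ℝ => 4 * C * T⁻¹) atTop (𝓝 0) := by
    simpa using tendsto_inv_atTop_zero.const_mul (4 * C)
  refine squeeze_zero' (Eventually.of_forall fun _ => norm_nonneg _) ?_ hdec
  filter_upwards [eventually_ge_atTop T₀] with T hT
  have hT0 : 0 < T := by linarith
  have hTR : R ≤ T := (le_max_left _ _).trans hT
  -- On the top and the two sides of the rectangle, of total length `4T`, `G` is at most `C / T²`.
  have hrect := Complex.integral_boundary_rect_eq_zero_of_differentiableOn G (-T : ℝ)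
    ((T : ℂ) + T * Complex.I) (hG.mono fun z hz => by
      have h := hz.2
      simp only [Complex.ofReal_im, Complex.add_im, Complex.mul_im, Complex.I_im, Complex.I_re,
        Complex.ofReal_re, mem_preimage, mul_one, mul_zero, add_zero, zero_add] at h
      rw [uIcc_of_le hT0.le] at h
      exact h.1)
  simp only [Complex.ofReal_im, Complex.ofReal_re, Complex.add_im, Complex.add_re, Complex.mul_im,
    Complex.mul_re, Complex.I_im, Complex.I_re, mul_one, mul_zero, add_zero, zero_add,
    Complex.ofReal_zero, zero_mul, sub_self] at hrect
  have hside : ∀ z : ℂ, 0 ≤ z.im → T ≤ ‖z‖ → ‖G z‖ ≤ C / T ^ 2 := fun z hz hTz =>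
    (hC z hz (hTR.trans hTz)).trans (by gcongr)
  have b1 : ‖∫ x in (-T)..T, G (x + T * Complex.I)‖ ≤ C / T ^ 2 * |T - -T| := by
    refine intervalIntegral.norm_integral_le_of_norm_le_const fun x _ => hside _ ?_ ?_
    · simpa using hT0.le
    · have := Complex.abs_im_le_norm ((x : ℂ) + T * Complex.I)
      simpa [abs_of_pos hT0] using this
  have b2 : ∀ a : ℝ, |a| = T → ‖∫ y in (0 : ℝ)..T, G (a + y * Complex.I)‖ ≤ C / T ^ 2 * |T - 0| := by
    intro a ha
    refine intervalIntegral.norm_integral_le_of_norm_le_const fun y hy => hside _ ?_ ?_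
    · rw [uIoc_of_le hT0.le] at hy
      simpa using hy.1.le
    · have := Complex.abs_re_le_norm ((a : ℂ) + y * Complex.I)
      simpa [ha] using this
  have b3 := b2 T (abs_of_pos hT0)
  have b4 := b2 (-T) (by rw [abs_neg, abs_of_pos hT0])
  rw [sub_zero, abs_of_pos hT0] at b3 b4
  rw [sub_neg_eq_add, abs_of_pos (by linarith)] at b1
  have e : ∫ x in (-T)..T, G x = (∫ x in (-T)..T, G (x + T * Complex.I)) -
      Complex.I • (∫ y in (0 : ℝ)..T, G (T + y * Complex.I)) +
      Complex.I • ∫ y in (0 : ℝ)..T, G ((-T : ℝ) + y * Complex.I) := by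
    linear_combination hrect
  simp only [id]
  rw [e]
  refine (norm_add_le _ _).trans ((add_le_add (norm_sub_le _ _) le_rfl).trans ?_)
  rw [norm_smul, norm_smul, Complex.norm_I, one_mul, one_mul]
  calc _ ≤ C / T ^ 2 * (T + T) + C / T ^ 2 * T + C / T ^ 2 * T := by gcongr
    _ = 4 * C * T⁻¹ := by field_simp; ring

lemma ofReal_sub_ne_zero {z : ℂ} (hz : z.im ≠ 0) (s : ℝ) : (s : ℂ) - z ≠ 0 := by
  intro h
  apply hz
  have := congrArg Complex.im h
  simpa using this

/-- The Poisson kernel of the upper half-plane has total mass `π`. -/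
lemma integral_poisson {z : ℂ} (hz : 0 < z.im) :
    Integrable (fun s : ℝ => 2 * Complex.I * z.im / (((s : ℂ) - z) * (s - starRingEnd ℂ z))) ∧
      ∫ s : ℝ, 2 * Complex.I * z.im / (((s : ℂ) - z) * (s - starRingEnd ℂ z)) =
        2 * Real.pi * Complex.I := by
  set x := z.re
  set y := z.im
  have hfun : ∀ s : ℝ, 2 * Complex.I * y / (((s : ℂ) - z) * (s - starRingEnd ℂ z)) =
      2 * Complex.I * ((y⁻¹ * (1 + ((s - x) / y) ^ 2)⁻¹ : ℝ) : ℂ) := by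
    intro s
    have e : ((s : ℂ) - z) * (s - starRingEnd ℂ z) = (((s - x) ^ 2 + y ^ 2 : ℝ) : ℂ) := by
      have : (s : ℂ) - starRingEnd ℂ z = starRingEnd ℂ ((s : ℂ) - z) := by simp
      rw [this, Complex.mul_conj, Complex.normSq_apply]
      congr 1
      simp [x, y]; ring
    have e2 : (y⁻¹ * (1 + ((s - x) / y) ^ 2)⁻¹ : ℝ) = y / ((s - x) ^ 2 + y ^ 2) := by
      have : (s - x) ^ 2 + y ^ 2 ≠ 0 := by positivity
      field_simp
      ring
    rw [e, e2]; push_cast; ring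
  simp_rw [hfun]
  have h1 : Integrable fun s : ℝ => (1 + ((s - x) / y) ^ 2)⁻¹ :=
    (integrable_inv_one_add_sq.comp_div hz.ne').comp_sub_right x
  refine ⟨((h1.const_mul y⁻¹).ofReal).const_mul _, ?_⟩
  have e3 : ∫ s : ℝ, (1 + ((s - x) / y) ^ 2)⁻¹ = y * Real.pi := by
    rw [integral_sub_right_eq_self (fun s : ℝ => (1 + (s / y) ^ 2)⁻¹) x,
      Measure.integral_comp_div (fun s : ℝ => (1 + s ^ 2)⁻¹), integral_univ_inv_one_add_sq,
      abs_of_pos hz, smul_eq_mul]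
  rw [integral_const_mul, integral_complex_ofReal, integral_const_mul, e3,
    inv_mul_cancel_left₀ hz.ne']
  ring

/-- A holomorphic function on a neighbourhood of the closed upper half-plane that decays at
infinity is the Cauchy integral of twice its real part. -/
lemma integral_two_re_div_sub {h : ℂ → ℂ} {ε : ℝ} (hε : 0 < ε)
    (hh : DifferentiableOn ℂ h {z : ℂ | -ε < z.im}) {C R : ℝ}
    (hC : ∀ z : ℂ, 0 ≤ z.im → R ≤ ‖z‖ → ‖h z‖ ≤ C / ‖z‖) {z : ℂ} (hz : 0 < z.im) :
    ∫ s : ℝ, ((2 * (h s).re : ℝ) : ℂ) / ((s : ℂ) - z) = 2 * Real.pi * Complex.I * h z := by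
  have hsub : {w : ℂ | 0 ≤ w.im} ⊆ {w : ℂ | -ε < w.im} := fun w (hw : 0 ≤ w.im) => by
    change -ε < w.im; linarith
  have hopen : IsOpen {w : ℂ | -ε < w.im} := isOpen_lt continuous_const Complex.continuous_im
  have hzn : {w : ℂ | -ε < w.im} ∈ 𝓝 z := hopen.mem_nhds (hsub hz.le)
  set zb := starRingEnd ℂ z with hzb
  have hzb' : zb.im < 0 := by rw [hzb, Complex.conj_im]; linarith
  have hne : ∀ w : ℂ, 0 ≤ w.im → w - zb ≠ 0 := fun w hw h0 => by
    rw [sub_eq_zero.1 h0] at hw; linarith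
  set y := z.im
  set R' := max (max R 1) (2 * ‖z‖) with hR'
  have hR'R : R ≤ R' := (le_max_left _ _).trans (le_max_left _ _)
  have hR'1 : 1 ≤ R' := (le_max_right _ _).trans (le_max_left _ _)
  have hR'z : 2 * ‖z‖ ≤ R' := le_max_right _ _
  have hnzb : ‖zb‖ = ‖z‖ := RCLike.norm_conj z
  have hfar : ∀ a w : ℂ, ‖a‖ = ‖z‖ → R' ≤ ‖w‖ → ‖w‖ / 2 ≤ ‖w - a‖ := fun a w ha hw => by
    have := norm_sub_norm_le w a
    rw [ha] at this
    linarith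
  have hC0 : 0 ≤ C := by
    have h1 := (norm_nonneg _).trans (hC (R' : ℂ) (by simp) (by
      rw [Complex.norm_real, Real.norm_of_nonneg (by linarith)]; exact hR'R))
    rw [Complex.norm_real, Real.norm_of_nonneg (by linarith)] at h1
    by_contra hneg
    exact absurd h1 (not_le.2 (div_neg_of_neg_of_pos (not_le.1 hneg) (by linarith)))
  -- the conjugate Cauchy kernel
  obtain ⟨i2, e2⟩ := integrable_and_integral_eq_zero_of_decay (G := fun w => h w / (w - zb))
    (C := 2 * C) (R := R') ((hh.mono hsub).div (by fun_prop) hne) (fun w hw hwR => by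
      have hw0 : 0 < ‖w‖ := by linarith
      rw [norm_div]
      calc _ ≤ (C / ‖w‖) / (‖w‖ / 2) := by
            gcongr
            · exact hC w hw (hR'R.trans hwR)
            · exact hfar zb w hnzb hwR
        _ = _ := by field_simp)
  -- the Poisson kernel
  obtain ⟨i1, e1⟩ := integrable_and_integral_eq_zero_of_decay
    (G := fun w => dslope h z w * (2 * Complex.I * y / (w - zb)))
    (C := (C + ‖h z‖) * (2 * y) * 4) (R := R')
    (((Complex.differentiableOn_dslope hzn).2 hh |>.mono hsub).mul
      ((differentiableOn_const _).div (by fun_prop) hne)) (fun w hw hwR => by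
      have hw0 : 0 < ‖w‖ := by linarith
      have hwz : w ≠ z := by rintro rfl; linarith
      have h1 : ‖h w‖ ≤ C := (hC w hw (hR'R.trans hwR)).trans (div_le_self hC0 (by linarith))
      rw [dslope_of_ne _ hwz, slope_def_field, norm_mul, norm_div, norm_div]
      have h2 : ‖2 * Complex.I * (y : ℂ)‖ = 2 * y := by
        simp [abs_of_pos hz]
      rw [h2]
      calc _ ≤ (C + ‖h z‖) / (‖w‖ / 2) * (2 * y / (‖w‖ / 2)) := by
            gcongr
            · exact (norm_sub_le _ _).trans (by gcongr)
            · exact hfar z w rfl hwR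
            · exact hfar zb w hnzb hwR
        _ = _ := by field_simp; ring)
  have hsz : ∀ s : ℝ, (s : ℂ) - z ≠ 0 := ofReal_sub_ne_zero hz.ne'
  have hszb : ∀ s : ℝ, (s : ℂ) - zb ≠ 0 := ofReal_sub_ne_zero hzb'.ne
  obtain ⟨ip, ep⟩ := integral_poisson hz
  have hyz : (2 * Complex.I * y : ℂ) = z - zb := by
    rw [hzb, Complex.sub_conj]; push_cast; ring
  -- Subtracting `h z` removes the pole at `z`. The first and last terms are then holomorphic and
  -- `O(|s|⁻²)`, hence integrate to 0, and the Poisson term alone contributes.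
  have hkey : ∀ s : ℝ, h s / ((s : ℂ) - z) = dslope h z s * (2 * Complex.I * y / ((s : ℂ) - zb)) +
      h z * (2 * Complex.I * y / (((s : ℂ) - z) * (s - zb))) + h s / ((s : ℂ) - zb) := by
    intro s
    have h1 := hsz s
    have h2 := hszb s
    rw [dslope_of_ne _ (sub_ne_zero.1 h1), slope_def_field, hyz]
    field_simp
    ring
  have i3 : Integrable fun s : ℝ => h s / ((s : ℂ) - z) := by
    simp_rw [hkey]; exact (i1.add (ip.const_mul _)).add i2
  have e3 : ∫ s : ℝ, h s / ((s : ℂ) - z) = 2 * Real.pi * Complex.I * h z := by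
    simp_rw [hkey]
    have ip' : Integrable fun s : ℝ => h z * (2 * Complex.I * y / (((s : ℂ) - z) * (s - zb))) :=
      ip.const_mul (h z)
    have i12 : Integrable fun s : ℝ => dslope h z s * (2 * Complex.I * y / ((s : ℂ) - zb)) +
        h z * (2 * Complex.I * y / (((s : ℂ) - z) * (s - zb))) := i1.add ip'
    rw [integral_add i12 i2, integral_add i1 ip', e1, e2, integral_const_mul, ep]
    ring
  -- The conjugate of `h` has vanishing Cauchy integral at `z`, so replacing `h` by `2 Re h` changes
  -- nothing.
  have hconj : ∀ s : ℝ, starRingEnd ℂ (h s) / ((s : ℂ) - z) =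
      starRingEnd ℂ (h s / ((s : ℂ) - zb)) := by
    intro s; simp [hzb]
  have i4 : Integrable fun s : ℝ => starRingEnd ℂ (h s) / ((s : ℂ) - z) := by
    simp_rw [hconj]
    exact (Complex.conjCLE.toContinuousLinearMap.integrable_comp i2)
  have e4 : ∫ s : ℝ, starRingEnd ℂ (h s) / ((s : ℂ) - z) = 0 := by
    simp_rw [hconj]; rw [integral_conj, e2, map_zero]
  have hsum : ∀ s : ℝ, ((2 * (h s).re : ℝ) : ℂ) / ((s : ℂ) - z) =
      h s / ((s : ℂ) - z) + starRingEnd ℂ (h s) / ((s : ℂ) - z) := by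
    intro s
    rw [← add_div, Complex.add_conj]
  simp_rw [hsum]
  rw [integral_add i3 i4, e3, e4, add_zero]

/-! ### Holomorphic logarithms and their decay -/

/-- A nonvanishing holomorphic function on a convex open set has a holomorphic logarithm. -/
lemma exists_differentiableOn_log {U : Set ℂ} (hUo : IsOpen U) (hUc : Convex ℝ U)
    (hUn : U.Nonempty) {g : ℂ → ℂ} (hg : DifferentiableOn ℂ g U) (hg0 : ∀ z ∈ U, g z ≠ 0) :
    ∃ h : ℂ → ℂ, DifferentiableOn ℂ h U ∧ ∀ z ∈ U, Complex.exp (h z) = g z := by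
  have : ContractibleSpace U := hUc.contractibleSpace hUn
  have hsc : IsSimplyConnected U := SimplyConnectedSpace.ofContractible U
  obtain ⟨h, hhc, hhe⟩ := Complex.exists_continuousOn_eqOn_exp_comp hsc hUo hg.continuousOn
    (by rintro ⟨z, hz, h0⟩; exact hg0 z hz h0)
  refine ⟨h, fun z₀ hz₀ => ?_, fun z hz => hhe hz⟩
  have hca : ContinuousAt (fun z => h z - h z₀) z₀ :=
    ((hhc.continuousAt (hUo.mem_nhds hz₀))).sub continuousAt_const
  have hsmall : ∀ᶠ z in 𝓝 z₀, ‖h z - h z₀‖ < Real.pi := by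
    have hpi : ‖h z₀ - h z₀‖ < Real.pi := by rw [sub_self, norm_zero]; exact Real.pi_pos
    exact hca.norm.eventually (gt_mem_nhds hpi)
  -- The lift is a priori only continuous. Where it stays within `π` of `h z₀` it is a translate of
  -- the principal branch, hence holomorphic.
  have heq : h =ᶠ[𝓝 z₀] fun z => Complex.log (g z / g z₀) + h z₀ := by
    filter_upwards [hsmall, hUo.mem_nhds hz₀] with z hz hzU
    have e1 : Complex.exp (h z) = g z := hhe hzU
    have e2 : Complex.exp (h z₀) = g z₀ := hhe hz₀
    have him := (Complex.abs_im_le_norm _).trans_lt hz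
    rw [← e1, ← e2, ← Complex.exp_sub, Complex.log_exp (neg_lt_of_abs_lt him)
      (le_of_abs_le him.le), sub_add_cancel]
  refine (DifferentiableAt.congr_of_eventuallyEq ?_ heq).differentiableWithinAt
  refine DifferentiableAt.add_const _ (DifferentiableAt.clog ?_ ?_)
  · exact (hg.differentiableAt (hUo.mem_nhds hz₀)).div_const _
  · rw [div_self (hg0 z₀ hz₀)]; exact Complex.one_mem_slitPlane

lemma convex_upper : Convex ℝ {z : ℂ | 0 < z.im} := convex_halfSpace_im_gt 0

/-- A nonvanishing holomorphic function on the upper half-plane that is `1 + O(1/|z|)` has a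
holomorphic logarithm that is `O(1/|z|)`. -/
lemma exists_log_of_decay {g : ℂ → ℂ} (hg : DifferentiableOn ℂ g {z : ℂ | 0 < z.im})
    (hg0 : ∀ z : ℂ, 0 < z.im → g z ≠ 0) {C R : ℝ}
    (hC : ∀ z : ℂ, 0 < z.im → R ≤ ‖z‖ → ‖g z - 1‖ ≤ C / ‖z‖) :
    ∃ h : ℂ → ℂ, DifferentiableOn ℂ h {z : ℂ | 0 < z.im} ∧
      (∀ z : ℂ, 0 < z.im → Complex.exp (h z) = g z) ∧
      ∃ C' R' : ℝ, ∀ z : ℂ, 0 < z.im → R' ≤ ‖z‖ → ‖h z‖ ≤ C' / ‖z‖ := by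
  obtain ⟨h, hd, he⟩ := exists_differentiableOn_log isOpen_upper convex_upper
    ⟨Complex.I, by simp⟩ hg hg0
  set R₁ := max R (max 1 (2 * C)) with hR₁
  have hR₁R : R ≤ R₁ := le_max_left _ _
  have hR₁1 : 1 ≤ R₁ := (le_max_left _ _).trans (le_max_right _ _)
  have hR₁C : 2 * C ≤ R₁ := (le_max_right _ _).trans (le_max_right _ _)
  -- Three overlapping convex pieces form a connected neighbourhood of infinity in the half-plane,
  -- where `‖g - 1‖ ≤ 1/2` and the principal logarithm of `g` is holomorphic.
  set A : Set ℂ := {z | R₁ < z.im}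
  set B₁ : Set ℂ := {z | 0 < z.im} ∩ {z | R₁ < z.re}
  set B₂ : Set ℂ := {z | 0 < z.im} ∩ {z | z.re < -R₁}
  have hSo : IsOpen (A ∪ B₁ ∪ B₂) :=
    ((isOpen_lt continuous_const Complex.continuous_im).union
      (isOpen_upper.inter (isOpen_lt continuous_const Complex.continuous_re))).union
      (isOpen_upper.inter (isOpen_lt Complex.continuous_re continuous_const))
  have hSc : IsPreconnected (A ∪ B₁ ∪ B₂) := by
    have hA : IsPreconnected A := (convex_halfSpace_im_gt R₁).isPreconnected
    have hB₁ : IsPreconnected B₁ := (convex_upper.inter (convex_halfSpace_re_gt R₁)).isPreconnected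
    have hB₂ : IsPreconnected B₂ :=
      (convex_upper.inter (convex_halfSpace_re_lt (-R₁))).isPreconnected
    have hAB : IsPreconnected (A ∪ B₁) := IsPreconnected.union (⟨R₁ + 1, R₁ + 1⟩ : ℂ)
      (by change R₁ < R₁ + 1; linarith)
      ⟨by change 0 < R₁ + 1; linarith, by change R₁ < R₁ + 1; linarith⟩ hA hB₁
    exact IsPreconnected.union (⟨-(R₁ + 1), R₁ + 1⟩ : ℂ)
      (Or.inl (by change R₁ < R₁ + 1; linarith))
      ⟨by change 0 < R₁ + 1; linarith, by change -(R₁ + 1) < -R₁; linarith⟩ hAB hB₂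
  have hSim : ∀ z ∈ A ∪ B₁ ∪ B₂, 0 < z.im := by
    rintro z ((hz | hz) | hz)
    · have hz : R₁ < z.im := hz
      linarith
    · exact hz.1
    · exact hz.1
  have hSnorm : ∀ z ∈ A ∪ B₁ ∪ B₂, R₁ ≤ ‖z‖ := by
    rintro z ((hz | hz) | hz)
    · exact (le_of_lt hz).trans ((le_abs_self _).trans (Complex.abs_im_le_norm z))
    · exact (le_of_lt hz.2).trans ((le_abs_self _).trans (Complex.abs_re_le_norm z))
    · have hz : z.re < -R₁ := hz.2
      have := (neg_le_abs z.re).trans (Complex.abs_re_le_norm z)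
      linarith
  have hhalf : ∀ z ∈ A ∪ B₁ ∪ B₂, ‖g z - 1‖ ≤ 1 / 2 := by
    intro z hz
    have h1 := hSnorm z hz
    refine (hC z (hSim z hz) (hR₁R.trans h1)).trans ?_
    rw [div_le_iff₀ (by linarith)]
    linarith
  have hslit : ∀ z ∈ A ∪ B₁ ∪ B₂, g z ∈ Complex.slitPlane := by
    intro z hz
    have h1 := hhalf z hz
    have := Complex.mem_slitPlane_of_norm_lt_one (z := g z - 1) (by linarith)
    rwa [add_sub_cancel] at this
  have hsubS : A ∪ B₁ ∪ B₂ ⊆ {z : ℂ | 0 < z.im} := hSim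
  have hφ : DifferentiableOn ℂ (fun z => h z - Complex.log (g z)) (A ∪ B₁ ∪ B₂) :=
    (hd.mono hsubS).sub ((hg.mono hsubS).clog hslit)
  have hφe : ∀ z ∈ A ∪ B₁ ∪ B₂, Complex.exp (h z - Complex.log (g z)) = 1 := by
    intro z hz
    rw [Complex.exp_sub, he z (hSim z hz), Complex.exp_log (hg0 z (hSim z hz)),
      div_self (hg0 z (hSim z hz))]
  -- `h` and the principal logarithm differ by a constant `a` with `exp a = 1`; subtracting it makes
  -- `h` decay.
  obtain ⟨a, ha⟩ := hSo.exists_is_const_of_deriv_eq_zero hSc hφ (by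
    intro z hz
    have hda := (hφ.differentiableAt (hSo.mem_nhds hz)).hasDerivAt.cexp
    have hev : (fun z => Complex.exp (h z - Complex.log (g z))) =ᶠ[𝓝 z] fun _ => 1 := by
      filter_upwards [hSo.mem_nhds hz] with w hw using hφe w hw
    have h0 := (hda.congr_of_eventuallyEq hev.symm).unique (hasDerivAt_const z (1 : ℂ))
    exact (mul_eq_zero.1 h0).resolve_left (Complex.exp_ne_zero _))
  have hSmem : (⟨0, R₁ + 1⟩ : ℂ) ∈ A ∪ B₁ ∪ B₂ :=
    Or.inl (Or.inl (by change R₁ < R₁ + 1; linarith))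
  have hae : Complex.exp a = 1 := by rw [← ha _ hSmem]; exact hφe _ hSmem
  refine ⟨fun z => h z - a, hd.sub_const _, fun z hz => ?_, 3 / 2 * C, 2 * R₁ + 1,
    fun z hz hzR => ?_⟩
  · rw [Complex.exp_sub, hae, div_one, he z hz]
  -- Outside the union `‖z‖ ≤ 2 R₁`, which explains the radius `2 R₁ + 1`.
  · have hzS : z ∈ A ∪ B₁ ∪ B₂ := by
      by_contra hnot
      have h1 : z.im ≤ R₁ := not_lt.1 fun h => hnot (Or.inl (Or.inl h))
      have h2 : z.re ≤ R₁ := not_lt.1 fun h => hnot (Or.inl (Or.inr ⟨hz, h⟩))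
      have h3 : -R₁ ≤ z.re := not_lt.1 fun h => hnot (Or.inr ⟨hz, h⟩)
      have h4 := Complex.norm_le_abs_re_add_abs_im z
      have h5 := abs_le.2 ⟨h3, h2⟩
      rw [abs_of_pos hz] at h4
      linarith
    have e : h z - a = Complex.log (g z) := by rw [← ha z hzS]; ring
    have h1 := Complex.norm_log_one_add_half_le_self (hhalf z hzS)
    rw [add_sub_cancel] at h1
    simp only
    rw [e]
    calc _ ≤ 3 / 2 * ‖g z - 1‖ := h1
      _ ≤ 3 / 2 * (C / ‖z‖) := by
        gcongr; exact hC z hz (by linarith)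
      _ = _ := by ring

end Schrodinger

/-! ### Representation by the boundary values of the modulus -/

namespace Schrodinger

/-- The dominating function for the limit to the real line: it behaves like `|s|^{-1/2}` at 0 and
`|s|^{-3/2}` at infinity. -/
lemma integrable_rpow_mul_inv_norm_sub {z : ℂ} (hz : 0 < z.im) :
    Integrable fun s : ℝ => |s| ^ (-(1 / 2) : ℝ) * ‖(s : ℂ) - z‖⁻¹ := by
  set φ : ℝ → ℝ := fun s => |s| ^ (-(1 / 2) : ℝ) * (1 + |s|)⁻¹ with hφ
  have hmeasφ : Measurable φ := by
    refine Measurable.mul ?_ ?_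
    · exact (measurable_id.abs).pow_const _
    · exact (measurable_const.add measurable_id.abs).inv
  have hpos : IntegrableOn φ (Ioi 0) := by
    rw [← Ioc_union_Ioi_eq_Ioi zero_le_one]
    refine IntegrableOn.union ?_ ?_
    · have h1 : IntegrableOn (fun s : ℝ => s ^ (-(1 / 2) : ℝ)) (Ioc 0 1) :=
        (intervalIntegrable_iff_integrableOn_Ioc_of_le zero_le_one).1
          (intervalIntegral.intervalIntegrable_rpow' (by norm_num))
      refine h1.mono' hmeasφ.aestronglyMeasurable ?_
      filter_upwards [ae_restrict_mem measurableSet_Ioc] with s hs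
      have hs0 : 0 < s := hs.1
      rw [Real.norm_of_nonneg (by positivity)]
      simp only [hφ, abs_of_pos hs0]
      refine mul_le_of_le_one_right (by positivity) (inv_le_one_of_one_le₀ (by linarith))
    · have h1 : IntegrableOn (fun s : ℝ => s ^ (-(3 / 2) : ℝ)) (Ioi 1) :=
        integrableOn_Ioi_rpow_of_lt (by norm_num) one_pos
      refine h1.mono' hmeasφ.aestronglyMeasurable ?_
      filter_upwards [ae_restrict_mem measurableSet_Ioi] with s hs
      have hs1 : 1 < s := hs
      have hs0 : 0 < s := by linarith
      rw [Real.norm_of_nonneg (by positivity)]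
      simp only [hφ, abs_of_pos hs0]
      have e : s ^ (-(3 / 2) : ℝ) = s ^ (-(1 / 2) : ℝ) * s⁻¹ := by
        rw [← Real.rpow_neg_one, ← Real.rpow_add hs0]; norm_num
      rw [e]
      gcongr
      linarith
  have hneg : IntegrableOn φ (Iic 0) := by
    have h := Iff.mpr integrableOn_Ici_iff_integrableOn_Ioi hpos
    rw [← neg_zero] at h
    have h2 := h.comp_neg_Iic
    refine h2.congr_fun (fun s _ => ?_) measurableSet_Iic
    simp only [hφ, abs_neg]
  have hInt : Integrable φ := by
    have h := hneg.union hpos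
    rwa [Iic_union_Ioi, integrableOn_univ] at h
  have hsz := ofReal_sub_ne_zero hz.ne'
  refine (hInt.const_mul (1 + (1 + ‖z‖) / z.im)).mono' ?_ (ae_of_all _ fun s => ?_)
  · refine (((measurable_id.abs).pow_const _).mul ?_).aestronglyMeasurable
    exact ((Complex.measurable_ofReal.sub measurable_const).norm).inv
  · have h1 : z.im ≤ ‖(s : ℂ) - z‖ := by
      have := Complex.abs_im_le_norm ((s : ℂ) - z)
      simpa [abs_of_pos hz] using this
    have h2 : |s| ≤ ‖(s : ℂ) - z‖ + ‖z‖ := by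
      have := norm_add_le ((s : ℂ) - z) z
      rwa [sub_add_cancel, Complex.norm_real, Real.norm_eq_abs] at this
    have h3 : 0 < ‖(s : ℂ) - z‖ := norm_pos_iff.2 (hsz s)
    rw [Real.norm_of_nonneg (by positivity), hφ]
    have h4 : ‖(s : ℂ) - z‖⁻¹ ≤ (1 + (1 + ‖z‖) / z.im) * (1 + |s|)⁻¹ := by
      rw [← div_eq_mul_inv, le_div_iff₀ (by positivity), inv_mul_le_iff₀ h3]
      have : 1 + ‖z‖ ≤ ‖(s : ℂ) - z‖ * ((1 + ‖z‖) / z.im) := by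
        rw [mul_div_assoc', le_div_iff₀ hz, mul_comm]; gcongr
      linarith
    calc _ ≤ |s| ^ (-(1 / 2) : ℝ) * ((1 + (1 + ‖z‖) / z.im) * (1 + |s|)⁻¹) := by gcongr
      _ = _ := by ring

lemma abs_log_le_two_mul_abs_sub_one {x : ℝ} (hx : |x - 1| ≤ 1 / 2) :
    |Real.log x| ≤ 2 * |x - 1| := by
  have h := abs_le.1 hx
  have hx0 : 0 < x := by linarith
  rw [abs_le]
  constructor
  · have h1 := Real.log_le_sub_one_of_pos (inv_pos.2 hx0)
    rw [Real.log_inv] at h1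
    have h2 : x⁻¹ - 1 ≤ 2 * |x - 1| := by
      have e : x⁻¹ - 1 = (1 - x) / x := by field_simp
      rw [e, div_le_iff₀ hx0]
      have h3 := neg_le_abs (x - 1)
      nlinarith [abs_nonneg (x - 1)]
    linarith
  · have h1 := Real.log_le_sub_one_of_pos hx0
    have h2 := le_abs_self (x - 1)
    linarith [abs_nonneg (x - 1)]

/-- A bound for `log |g|` near the real line. -/
lemma exists_abs_log_norm_le {g : ℂ → ℂ} {C R : ℝ}
    (hC : ∀ z : ℂ, 0 < z.im → R ≤ ‖z‖ → ‖g z - 1‖ ≤ C / ‖z‖)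
    (hbd : ∀ T : ℝ, ∃ c M ε₀ : ℝ, 0 < c ∧ 0 < M ∧ 0 < ε₀ ∧ ∀ z : ℂ, 0 < z.im → z.im < ε₀ →
      |z.re| ≤ T → z.re ≠ 0 → c * |z.re| ≤ ‖g z‖ ∧ ‖g z‖ ≤ M / |z.re|) :
    ∃ K ε₀ : ℝ, 0 < ε₀ ∧ ∀ z : ℂ, 0 < z.im → z.im < ε₀ → z.re ≠ 0 →
      |Real.log ‖g z‖| ≤ K * |z.re| ^ (-(1 / 2) : ℝ) := by
  set T := max R (max 1 (2 * C)) with hT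
  have hTR : R ≤ T := le_max_left _ _
  have hT1 : 1 ≤ T := (le_max_left _ _).trans (le_max_right _ _)
  have hTC : 2 * C ≤ T := (le_max_right _ _).trans (le_max_right _ _)
  obtain ⟨c, M, ε₀, hc, hM, hε₀, h⟩ := hbd T
  -- The inequality `log x ≤ 2 x^{1/2}` trades the logarithmic singularity for an integrable power,
  -- uniformly in the height.
  have hsplit : ∀ a s : ℝ, 0 < a → 0 < s →
      Real.log (a / s) ≤ 2 * a ^ (1 / 2 : ℝ) * s ^ (-(1 / 2) : ℝ) := by
    intro a s ha hs
    have h1 := Real.log_le_rpow_div (x := a / s) (by positivity) (by norm_num : (0 : ℝ) < 1 / 2)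
    rw [Real.div_rpow ha.le hs.le] at h1
    rw [Real.rpow_neg hs.le]
    refine h1.trans (le_of_eq ?_)
    field_simp
  set K₁ := 2 * M ^ (1 / 2 : ℝ)
  set K₂ := 2 * c⁻¹ ^ (1 / 2 : ℝ)
  have hK₁ : 0 ≤ K₁ := by positivity
  have hK₂ : 0 ≤ K₂ := by positivity
  refine ⟨K₁ + K₂ + 2 * |C|, ε₀, hε₀, fun z hz hzε hre => ?_⟩
  have hs : 0 < |z.re| := abs_pos.2 hre
  have hp : 0 < |z.re| ^ (-(1 / 2) : ℝ) := by positivity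
  by_cases hzT : |z.re| ≤ T
  · obtain ⟨h1, h2⟩ := h z hz hzε hzT hre
    have hg : 0 < ‖g z‖ := (mul_pos hc hs).trans_le h1
    have hu : Real.log ‖g z‖ ≤ K₁ * |z.re| ^ (-(1 / 2) : ℝ) :=
      (Real.log_le_log hg h2).trans (hsplit M _ hM hs)
    have hl : -Real.log ‖g z‖ ≤ K₂ * |z.re| ^ (-(1 / 2) : ℝ) := by
      rw [← Real.log_inv]
      refine (Real.log_le_log (by positivity) ?_).trans (hsplit c⁻¹ _ (by positivity) hs)
      rw [div_eq_mul_inv, ← mul_inv]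
      gcongr
    rw [abs_le]
    have := abs_nonneg C
    constructor <;> nlinarith
  · push Not at hzT
    have hzn : |z.re| ≤ ‖z‖ := Complex.abs_re_le_norm z
    have h1 := hC z hz (by linarith)
    have h2 : |‖g z‖ - 1| ≤ C / ‖z‖ := by
      have := abs_norm_sub_norm_le (g z) 1
      rw [norm_one] at this
      exact this.trans h1
    have hC0 : 0 ≤ C / ‖z‖ := (abs_nonneg _).trans h2
    have h3 : C / ‖z‖ ≤ 1 / 2 := by
      rw [div_le_iff₀ (by linarith)]; linarith
    have h4 := abs_log_le_two_mul_abs_sub_one (h2.trans h3)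
    have h5 : C / ‖z‖ ≤ |C| * |z.re| ^ (-(1 / 2) : ℝ) := by
      calc C / ‖z‖ ≤ |C| / ‖z‖ := by gcongr; exact le_abs_self C
        _ ≤ |C| / |z.re| := by gcongr
        _ = |C| * |z.re| ^ (-1 : ℝ) := by rw [Real.rpow_neg_one]; rfl
        _ ≤ _ := by
          gcongr
          · linarith
          · norm_num
    have h6 : 0 ≤ (K₁ + K₂) * |z.re| ^ (-(1 / 2) : ℝ) := by positivity
    linarith

/-- A nonvanishing holomorphic function on the upper half-plane is recovered from the boundary
values of its modulus. -/
lemma eq_exp_integral_log_boundary {g : ℂ → ℂ} (hg : DifferentiableOn ℂ g {z : ℂ | 0 < z.im})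
    (hg0 : ∀ z : ℂ, 0 < z.im → g z ≠ 0) {C R : ℝ}
    (hC : ∀ z : ℂ, 0 < z.im → R ≤ ‖z‖ → ‖g z - 1‖ ≤ C / ‖z‖)
    (hbd : ∀ T : ℝ, ∃ c M ε₀ : ℝ, 0 < c ∧ 0 < M ∧ 0 < ε₀ ∧ ∀ z : ℂ, 0 < z.im → z.im < ε₀ →
      |z.re| ≤ T → z.re ≠ 0 → c * |z.re| ≤ ‖g z‖ ∧ ‖g z‖ ≤ M / |z.re|)
    {L : ℝ → ℝ} (hL : ∀ s : ℝ, s ≠ 0 →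
      Tendsto (fun ε : ℝ => Real.log ‖g (s + ε * Complex.I)‖) (𝓝[>] 0) (𝓝 (L s)))
    {z : ℂ} (hz : 0 < z.im) :
    Integrable (fun s : ℝ => ((2 * L s : ℝ) : ℂ) / ((s : ℂ) - z)) ∧
      g z = Complex.exp (1 / (2 * Real.pi * Complex.I) *
        ∫ s : ℝ, ((2 * L s : ℝ) : ℂ) / ((s : ℂ) - z)) := by
  obtain ⟨h, hd, he, C', R', hdec⟩ := exists_log_of_decay hg hg0 hC
  obtain ⟨K, ε₀, hε₀, hK⟩ := exists_abs_log_norm_le hC hbd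
  have hre : ∀ w : ℂ, 0 < w.im → (h w).re = Real.log ‖g w‖ := by
    intro w hw; rw [← he w hw, Complex.norm_exp, Real.log_exp]
  have himε : ∀ s ε : ℝ, ((s : ℂ) + ε * Complex.I).im = ε := fun s ε => by simp
  have hreε : ∀ s ε : ℝ, ((s : ℂ) + ε * Complex.I).re = s := fun s ε => by simp
  -- Shifting by `iε` makes `h` holomorphic past the real line, as the Cauchy formula requires.
  have hI : ∀ ε : ℝ, 0 < ε →
      ∫ s : ℝ, ((2 * (h (s + ε * Complex.I)).re : ℝ) : ℂ) / ((s : ℂ) - z) =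
        2 * Real.pi * Complex.I * h (z + ε * Complex.I) := by
    intro ε hε
    refine integral_two_re_div_sub (h := fun w => h (w + ε * Complex.I)) hε ?_ (C := max C' 0)
      (R := max R' 1) ?_ hz
    · refine hd.comp (by fun_prop) fun w hw => ?_
      have hw : -ε < w.im := hw
      change 0 < (w + ε * Complex.I).im
      simp only [Complex.add_im, Complex.mul_im, Complex.ofReal_re, Complex.I_im, mul_one,
        Complex.ofReal_im, Complex.I_re, mul_zero, add_zero]
      linarith
    · intro w hw hwR
      have hle : ‖w‖ ≤ ‖w + ε * Complex.I‖ := by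
        rw [← sq_le_sq₀ (norm_nonneg _) (norm_nonneg _), ← Complex.normSq_eq_norm_sq,
          ← Complex.normSq_eq_norm_sq, Complex.normSq_apply, Complex.normSq_apply]
        simp only [Complex.add_im, Complex.add_re, Complex.mul_re, Complex.mul_im,
          Complex.ofReal_re, Complex.I_im, mul_one, Complex.ofReal_im, Complex.I_re, mul_zero,
          add_zero, sub_zero]
        nlinarith
      have hwp : 0 < ‖w‖ := lt_of_lt_of_le zero_lt_one ((le_max_right _ _).trans hwR)
      calc _ ≤ C' / ‖w + ε * Complex.I‖ := hdec _ (by simp; linarith)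
            (((le_max_left _ _).trans hwR).trans hle)
        _ ≤ max C' 0 / ‖w + ε * Complex.I‖ := by gcongr; exact le_max_left _ _
        _ ≤ _ := by gcongr
  have hbound : ∀ ε : ℝ, 0 < ε → ε < ε₀ → ∀ s : ℝ, s ≠ 0 →
      |(h (s + ε * Complex.I)).re| ≤ K * |s| ^ (-(1 / 2) : ℝ) := by
    intro ε hε hεε s hs
    rw [hre _ (by rw [himε]; exact hε)]
    have := hK (s + ε * Complex.I) (by rw [himε]; exact hε) (by rw [himε]; exact hεε)
      (by rw [hreε]; exact hs)
    rwa [hreε] at this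
  have hcont : ∀ ε : ℝ, 0 < ε → Continuous fun s : ℝ => (h (s + ε * Complex.I)).re := by
    intro ε hε
    refine Complex.continuous_re.comp ?_
    rw [← continuousOn_univ]
    exact hd.continuousOn.comp (by fun_prop) fun s _ => by
      change 0 < ((s : ℂ) + ε * Complex.I).im; rw [himε]; exact hε
  have hsz := ofReal_sub_ne_zero hz.ne'
  have hmeas : ∀ ε : ℝ, 0 < ε → AEStronglyMeasurable
      (fun s : ℝ => ((2 * (h (s + ε * Complex.I)).re : ℝ) : ℂ) / ((s : ℂ) - z)) volume := by
    intro ε hε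
    have h1 := hcont ε hε
    exact Continuous.aestronglyMeasurable (Continuous.div (by fun_prop) (by fun_prop) hsz)
  have hlimpt : ∀ s : ℝ, s ≠ 0 → Tendsto
      (fun ε : ℝ => ((2 * (h (s + ε * Complex.I)).re : ℝ) : ℂ) / ((s : ℂ) - z)) (𝓝[>] 0)
      (𝓝 (((2 * L s : ℝ) : ℂ) / ((s : ℂ) - z))) := by
    intro s hs
    refine Tendsto.div_const ?_ _
    refine (Complex.continuous_ofReal.tendsto _).comp (Tendsto.const_mul 2 ?_)
    refine (hL s hs).congr' ?_
    filter_upwards [self_mem_nhdsWithin] with ε hε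
    rw [hre _ (by rw [himε]; exact hε)]
  have hne : ∀ᵐ s : ℝ, s ≠ 0 := by simp [ae_iff, measure_singleton]
  have hevpos : ∀ᶠ ε : ℝ in 𝓝[>] 0, 0 < ε ∧ ε < ε₀ := Ioo_mem_nhdsGT hε₀
  have hbint : Integrable fun s : ℝ => 2 * K * (|s| ^ (-(1 / 2) : ℝ) * ‖(s : ℂ) - z‖⁻¹) :=
    (integrable_rpow_mul_inv_norm_sub hz).const_mul _
  have hbd' : ∀ ε : ℝ, 0 < ε → ε < ε₀ → ∀ s : ℝ, s ≠ 0 →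
      ‖((2 * (h (s + ε * Complex.I)).re : ℝ) : ℂ) / ((s : ℂ) - z)‖ ≤
        2 * K * (|s| ^ (-(1 / 2) : ℝ) * ‖(s : ℂ) - z‖⁻¹) := by
    intro ε hε hεε s hs
    rw [norm_div, Complex.norm_real, norm_mul, Real.norm_eq_abs, Real.norm_eq_abs, abs_two,
      div_eq_mul_inv]
    calc _ ≤ 2 * (K * |s| ^ (-(1 / 2) : ℝ)) * ‖(s : ℂ) - z‖⁻¹ := by
          gcongr; exact hbound ε hε hεε s hs
      _ = _ := by ring
  have hconv := tendsto_integral_filter_of_dominated_convergence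
    (fun s : ℝ => 2 * K * (|s| ^ (-(1 / 2) : ℝ) * ‖(s : ℂ) - z‖⁻¹))
    (hevpos.mono fun ε hε => hmeas ε hε.1)
    (hevpos.mono fun ε hε => hne.mono fun s hs => hbd' ε hε.1 hε.2 s hs) hbint
    (hne.mono fun s hs => hlimpt s hs)
  -- `L` is arbitrary apart from being a pointwise limit, so measurability comes from a sequence of
  -- heights tending to 0.
  have hInt : Integrable (fun s : ℝ => ((2 * L s : ℝ) : ℂ) / ((s : ℂ) - z)) := by
    have hu : Tendsto (fun n : ℕ => ε₀ / 2 * ((1 : ℝ) / (n + 1))) atTop (𝓝[>] 0) := by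
      refine tendsto_nhdsWithin_iff.2 ⟨?_, Eventually.of_forall fun n => ?_⟩
      · simpa using (tendsto_one_div_add_atTop_nhds_zero_nat (𝕜 := ℝ)).const_mul (ε₀ / 2)
      · exact mem_Ioi.2 (by positivity)
    refine hbint.mono' (aestronglyMeasurable_of_tendsto_ae atTop
      (f := fun (n : ℕ) (s : ℝ) =>
        ((2 * (h (s + (ε₀ / 2 * ((1 : ℝ) / (n + 1)) : ℝ) * Complex.I)).re : ℝ) : ℂ) / ((s : ℂ) - z))
      (fun n => hmeas _ (by positivity)) ?_) ?_
    · filter_upwards [hne] with s hs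
      exact (hlimpt s hs).comp hu
    · filter_upwards [hne] with s hs
      refine le_of_tendsto (hlimpt s hs).norm (hevpos.mono fun ε hε => hbd' ε hε.1 hε.2 s hs)
  refine ⟨hInt, ?_⟩
  have hrhs : Tendsto (fun ε : ℝ => 2 * Real.pi * Complex.I * h (z + ε * Complex.I)) (𝓝[>] 0)
      (𝓝 (2 * Real.pi * Complex.I * h z)) := by
    refine Tendsto.const_mul _ ?_
    have hc : ContinuousAt h z := hd.continuousOn.continuousAt (isOpen_upper.mem_nhds hz)
    have ht : Tendsto (fun ε : ℝ => z + ε * Complex.I) (𝓝[>] 0) (𝓝 z) := by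
      have : Continuous fun ε : ℝ => z + ε * Complex.I := by fun_prop
      exact (this.tendsto' 0 z (by simp)).mono_left nhdsWithin_le_nhds
    exact hc.tendsto.comp ht
  have hfin := tendsto_nhds_unique (hconv.congr' (hevpos.mono fun ε hε => hI ε hε.1)) hrhs
  rw [hfin, ← he z hz]
  congr 1
  have : (2 * Real.pi * Complex.I : ℂ) ≠ 0 := Complex.two_pi_I_ne_zero
  field_simp

/-- Dividing out finitely many simple zeros. -/
lemma exists_eq_prod_mul {U : Set ℂ} (hU : IsOpen U) (S : Finset ℂ) :
    ∀ {f : ℂ → ℂ}, DifferentiableOn ℂ f U → (∀ z ∈ U, f z = 0 → z ∈ S) →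
      (∀ p ∈ S, p ∈ U ∧ f p = 0 ∧ deriv f p ≠ 0) →
      ∃ g : ℂ → ℂ, DifferentiableOn ℂ g U ∧ (∀ z ∈ U, g z ≠ 0) ∧
        ∀ z ∈ U, f z = (∏ p ∈ S, (z - p)) * g z := by
  classical
  induction S using Finset.induction_on with
  | empty =>
    intro f hf h0 _
    exact ⟨f, hf, fun z hz h => by simpa using h0 z hz h, fun z _ => by simp⟩
  | insert p S hpS ih =>
    intro f hf h0 hS
    obtain ⟨hpU, hfp, hdp⟩ := hS p (Finset.mem_insert_self p S)
    have hfac : ∀ z, f z = (z - p) * dslope f p z := by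
      intro z
      have := sub_smul_dslope f p z
      rw [hfp, sub_zero, smul_eq_mul] at this
      exact this.symm
    have hd1 : DifferentiableOn ℂ (dslope f p) U :=
      (Complex.differentiableOn_dslope (hU.mem_nhds hpU)).2 hf
    obtain ⟨g, hg, hg0, hfg⟩ := ih (f := dslope f p) hd1 (fun z hz hz0 => by
      have h1 : f z = 0 := by rw [hfac z, hz0, mul_zero]
      rcases Finset.mem_insert.1 (h0 z hz h1) with rfl | h
      · rw [dslope_same] at hz0; exact absurd hz0 hdp
      · exact h) (fun p' hp' => by
      obtain ⟨hU', hf', hd'⟩ := hS p' (Finset.mem_insert_of_mem hp')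
      have hne : p' ≠ p := by rintro rfl; exact hpS hp'
      have hz' : dslope f p p' = 0 := by
        have := hfac p'
        rw [hf'] at this
        exact (mul_eq_zero.1 this.symm).resolve_left (sub_ne_zero.2 hne)
      refine ⟨hU', hz', fun hdd => hd' ?_⟩
      -- By the product rule, a multiple zero of the quotient at `p'` would be a multiple zero of
      -- `f`.
      have h1 := (hd1.differentiableAt (hU.mem_nhds hU')).hasDerivAt
      have h2 := ((hasDerivAt_id p').sub_const p).mul h1
      have h3 : HasDerivAt f (1 * dslope f p p' + (id p' - p) * deriv (dslope f p) p') p' :=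
        h2.congr_of_eventuallyEq (Eventually.of_forall hfac)
      rw [h3.deriv, hz', hdd]; simp)
    refine ⟨g, hg, hg0, fun z hz => ?_⟩
    rw [Finset.prod_insert hpS, hfac z, hfg z hz, mul_assoc]

end Schrodinger

/-! ### Poles of the I-function and the two formulas for the Jost function -/

namespace Schrodinger

variable {q : ℝ → ℝ} {k : ℂ}

lemma analyticAt_jostFunction (hq : InL11 q) (hk : 0 < k.im) :
    AnalyticAt ℂ (jostFunction q) k :=
  (differentiableOn_jostFunction hq).analyticAt (isOpen_upper.mem_nhds hk)

lemma analyticAt_jostDeriv (hq : InL11 q) (hk : 0 < k.im) : AnalyticAt ℂ (jostDeriv q) k :=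
  (differentiableOn_jostDeriv hq).analyticAt (isOpen_upper.mem_nhds hk)

lemma meromorphicAt_iFunction (hq : InL11 q) (hk : 0 < k.im) :
    MeromorphicAt (iFunction q) k :=
  (analyticAt_jostDeriv hq hk).meromorphicAt.div (analyticAt_jostFunction hq hk).meromorphicAt

/-- The zero of the denominator is simple, and the numerator does not vanish there because the
initial data of the Jost solution cannot both be 0. -/
lemma meromorphicOrderAt_iFunction_of_eq_zero (hq : InL11 q) (hk : 0 < k.im)
    (h : jostFunction q k = 0) : meromorphicOrderAt (iFunction q) k = -1 := by
  have hU := isOpen_upper.mem_nhds hk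
  have hds : AnalyticAt ℂ (dslope (jostFunction q) k) k :=
    ((Complex.differentiableOn_dslope hU).2 (differentiableOn_jostFunction hq)).analyticAt hU
  have hds0 : dslope (jostFunction q) k k ≠ 0 := by
    rw [dslope_same]; exact deriv_jostFunction_ne_zero hq hk h
  refine (meromorphicOrderAt_eq_int_iff (n := -1) (meromorphicAt_iFunction hq hk)).2
    ⟨fun z => jostDeriv q z / dslope (jostFunction q) k z,
      (analyticAt_jostDeriv hq hk).div hds hds0,
      div_ne_zero (jostDeriv_ne_zero_of_jostFunction_eq_zero hq hk.le h) hds0, ?_⟩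
  refine Eventually.of_forall fun z => ?_
  have := sub_smul_dslope (jostFunction q) k z
  rw [h, sub_zero, smul_eq_mul] at this
  rw [iFunction_eq, ← this, zpow_neg_one, smul_eq_mul, div_mul_eq_div_div_swap, div_eq_mul_inv,
    mul_comm]

lemma meromorphicOrderAt_iFunction_of_ne_zero (hq : InL11 q) (hk : 0 < k.im)
    (h : jostFunction q k ≠ 0) : 0 ≤ meromorphicOrderAt (iFunction q) k :=
  ((analyticAt_jostDeriv hq hk).div (analyticAt_jostFunction hq hk)
    h).meromorphicOrderAt_nonneg

lemma mem_upperPoles_iff (hq : InL11 q) {p : ℂ} :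
    p ∈ upperPoles (iFunction q) ↔ 0 < p.im ∧ jostFunction q p = 0 := by
  constructor
  · rintro ⟨hp, hlt⟩
    refine ⟨hp, by_contra fun h => ?_⟩
    exact absurd hlt (not_lt.2 (meromorphicOrderAt_iFunction_of_ne_zero hq hp h))
  · rintro ⟨hp, h⟩
    refine ⟨hp, ?_⟩
    rw [meromorphicOrderAt_iFunction_of_eq_zero hq hp h]
    exact WithTop.coe_lt_coe.2 (by norm_num : (-1 : ℤ) < 0)

lemma eq_I_mul_im_of_jostFunction_eq_zero (hq : InL11 q) (hk : 0 < k.im)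
    (h : jostFunction q k = 0) : Complex.I * (k.im : ℂ) = k := by
  have hre : k.re = 0 := by
    by_contra hre; exact jostFunction_ne_zero_of_re_ne_zero hq hk.le hre h
  exact Complex.ext (by simp [hre]) (by simp)

lemma upperPoles_iFunction (hq : InL11 q) :
    upperPoles (iFunction q) = (fun κ : ℝ => Complex.I * (κ : ℂ)) '' boundStates q := by
  ext p
  rw [mem_upperPoles_iff hq]
  constructor
  · rintro ⟨hp, h⟩
    have e := eq_I_mul_im_of_jostFunction_eq_zero hq hp h
    exact ⟨p.im, (mem_boundStates_iff hq).2 ⟨hp, by rw [e]; exact h⟩, e⟩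
  · rintro ⟨κ, hκ, rfl⟩
    obtain ⟨h0, h⟩ := (mem_boundStates_iff hq).1 hκ
    exact ⟨by simpa using h0, h⟩

lemma jostFunction_ofReal_ne_zero (hq : InL11 q) {s : ℝ} (hs : s ≠ 0) :
    jostFunction q s ≠ 0 :=
  jostFunction_ne_zero_of_re_ne_zero hq (by simp) (by simpa using hs)

/-- The real-line Wronskian divided by `‖f‖²`. If `f s = 0`, both sides are 0 by the convention for
division. -/
lemma im_iFunction_ofReal (hq : InL11 q) (s : ℝ) :
    (iFunction q s).im = s / ‖jostFunction q s‖ ^ 2 := by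
  have h := im_jostDeriv_mul_conj_of_real hq s
  rw [iFunction_eq, div_eq_mul_inv, Complex.inv_def, ← mul_assoc, Complex.im_mul_ofReal, h,
    Complex.normSq_eq_norm_sq]
  rfl

lemma div_im_iFunction (hq : InL11 q) {s : ℝ} (hs : s ≠ 0) :
    s / (iFunction q s).im = ‖jostFunction q s‖ ^ 2 := by
  rw [im_iFunction_ofReal hq, div_div_cancel₀ hs]

/-- `φ(z) = 1 + O(1/|z|)` in the upper half-plane. -/
def IsOneAtInfinity (φ : ℂ → ℂ) : Prop :=
  ∃ C R : ℝ, ∀ z : ℂ, 0 < z.im → R ≤ ‖z‖ → ‖φ z - 1‖ ≤ C / ‖z‖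

lemma IsOneAtInfinity.mul {φ ψ : ℂ → ℂ} (hφ : IsOneAtInfinity φ) (hψ : IsOneAtInfinity ψ) :
    IsOneAtInfinity fun z => φ z * ψ z := by
  obtain ⟨C, R, h⟩ := hφ
  obtain ⟨C', R', h'⟩ := hψ
  refine ⟨|C| * (|C'| + 1) + |C'|, max 1 (max R R'), fun z hz hzR => ?_⟩
  have h1 : 1 ≤ ‖z‖ := (le_max_left _ _).trans hzR
  have h2 := h z hz (((le_max_left _ _).trans (le_max_right _ _)).trans hzR)
  have h3 := h' z hz (((le_max_right _ _).trans (le_max_right _ _)).trans hzR)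
  have h2' : ‖φ z - 1‖ ≤ |C| / ‖z‖ := h2.trans (by gcongr; exact le_abs_self C)
  have h3' : ‖ψ z - 1‖ ≤ |C'| / ‖z‖ := h3.trans (by gcongr; exact le_abs_self C')
  have h4 : ‖ψ z‖ ≤ |C'| + 1 := by
    have := norm_add_le (ψ z - 1) 1
    rw [sub_add_cancel, norm_one] at this
    have h5 : |C'| / ‖z‖ ≤ |C'| := div_le_self (abs_nonneg _) h1
    linarith
  have e : φ z * ψ z - 1 = (φ z - 1) * ψ z + (ψ z - 1) := by ring
  calc ‖φ z * ψ z - 1‖ ≤ ‖φ z - 1‖ * ‖ψ z‖ + ‖ψ z - 1‖ := by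
        rw [e, ← norm_mul]; exact norm_add_le _ _
    _ ≤ |C| / ‖z‖ * (|C'| + 1) + |C'| / ‖z‖ := by gcongr
    _ = _ := by ring

lemma isOneAtInfinity_moebius (p : ℂ) : IsOneAtInfinity fun z => (z + p) / (z - p) := by
  refine ⟨4 * ‖p‖, 2 * ‖p‖ + 1, fun z _ hzR => ?_⟩
  have hz : 0 < ‖z‖ := by linarith [norm_nonneg p]
  have h1 : ‖z‖ / 2 ≤ ‖z - p‖ := by linarith [norm_sub_norm_le z p]
  have hne : z - p ≠ 0 := norm_pos_iff.1 (by linarith)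
  have e : (z + p) / (z - p) - 1 = 2 * p / (z - p) := by field_simp; ring
  rw [e, norm_div, norm_mul, Complex.norm_two]
  calc _ ≤ 2 * ‖p‖ / (‖z‖ / 2) := by gcongr
    _ = _ := by field_simp; ring

lemma isOneAtInfinity_prod (S : Finset ℂ) :
    IsOneAtInfinity fun z => ∏ p ∈ S, (z + p) / (z - p) := by
  classical
  induction S using Finset.induction_on with
  | empty => exact ⟨0, 0, fun z _ _ => by simp⟩
  | insert p S hp ih =>
    simp_rw [Finset.prod_insert hp]
    exact (isOneAtInfinity_moebius p).mul ih

lemma isOneAtInfinity_jostFunction (hq : InL11 q) : IsOneAtInfinity (jostFunction q) := by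
  refine ⟨tail q 0 * jostBound q, 1, fun z hz hzR => ?_⟩
  rw [le_div_iff₀ (by linarith), mul_comm]
  exact norm_mul_jostFunction_sub_one_le hq hz.le

/-- The representation of the Jost function by its modulus on the real line and its zeros. -/
lemma jostFunction_representation (hq : InL11 q) {z : ℂ} (hz : 0 < z.im) :
    Integrable (fun s : ℝ => ((2 * Real.log ‖jostFunction q s‖ : ℝ) : ℂ) / ((s : ℂ) - z)) ∧
      jostFunction q z = Complex.exp (1 / (2 * Real.pi * Complex.I) *
        ∫ s : ℝ, ((2 * Real.log ‖jostFunction q s‖ : ℝ) : ℂ) / ((s : ℂ) - z)) *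
        w (iFunction q) z := by
  classical
  set f := jostFunction q with hf
  have hfin := finite_boundStates hq
  have hSfin : (upperPoles (iFunction q)).Finite := by
    rw [upperPoles_iFunction hq]; exact hfin.image _
  set S : Finset ℂ := hSfin.toFinset with hS
  have hSmem : ∀ p, p ∈ S ↔ 0 < p.im ∧ f p = 0 := fun p => by
    rw [hS, Finite.mem_toFinset, mem_upperPoles_iff hq]
  have hSI : ∀ p ∈ S, Complex.I * (p.im : ℂ) = p := fun p hp =>
    eq_I_mul_im_of_jostFunction_eq_zero hq ((hSmem p).1 hp).1 ((hSmem p).1 hp).2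
  -- Hence `-p` is the conjugate of `p`, and `w` is a Blaschke product: of modulus at most 1 in the
  -- half-plane and equal to 1 on the real line.
  have hSre : ∀ p ∈ S, p.re = 0 := fun p hp => by
    rw [← hSI p hp]; simp
  have hw : ∀ z, w (iFunction q) z = ∏ p ∈ S, (z - p) / (z + p) := fun z => by
    rw [w, finprod_mem_eq_finite_toFinset_prod _ hSfin]
  obtain ⟨g₀, hg₀, hg₀0, hfg₀⟩ := exists_eq_prod_mul isOpen_upper S
    (differentiableOn_jostFunction hq) (fun z hz h0 => (hSmem z).2 ⟨hz, h0⟩)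
    (fun p hp => ⟨((hSmem p).1 hp).1, ((hSmem p).1 hp).2,
      deriv_jostFunction_ne_zero hq ((hSmem p).1 hp).1 ((hSmem p).1 hp).2⟩)
  replace hfg₀ : ∀ z : ℂ, 0 < z.im → f z = (∏ p ∈ S, (z - p)) * g₀ z := hfg₀
  have hadd : ∀ z : ℂ, 0 ≤ z.im → ∀ p ∈ S, z + p ≠ 0 := fun z hz p hp h0 => by
    have := congrArg Complex.im h0
    rw [Complex.add_im, Complex.zero_im] at this
    linarith [((hSmem p).1 hp).1]
  -- This is `f / w` in a form that is holomorphic at the zeros too.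
  set g : ℂ → ℂ := fun z => g₀ z * ∏ p ∈ S, (z + p) with hg
  have hgd : DifferentiableOn ℂ g {z : ℂ | 0 < z.im} :=
    hg₀.mul (DifferentiableOn.fun_finsetProd fun p _ => by fun_prop)
  have hg0 : ∀ z : ℂ, 0 < z.im → g z ≠ 0 := fun z hz =>
    mul_ne_zero (hg₀0 z hz) (Finset.prod_ne_zero_iff.2 fun p hp => hadd z hz.le p hp)
  have hfg : ∀ z : ℂ, 0 < z.im → f z = w (iFunction q) z * g z := by
    intro z hz
    have hP : ∏ p ∈ S, (z + p) ≠ 0 := Finset.prod_ne_zero_iff.2 fun p hp => hadd z hz.le p hp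
    rw [hw, hfg₀ z hz, hg, Finset.prod_div_distrib]
    field_simp
  have hgf : ∀ z : ℂ, 0 < z.im → z ∉ S → g z = f z * ∏ p ∈ S, (z + p) / (z - p) := by
    intro z hz hzS
    have hP : ∏ p ∈ S, (z - p) ≠ 0 := Finset.prod_ne_zero_iff.2 fun p hp =>
      sub_ne_zero.2 (by rintro rfl; exact hzS hp)
    rw [hfg₀ z hz, hg, Finset.prod_div_distrib]
    field_simp
  -- decay
  obtain ⟨C, R, hCR⟩ := (isOneAtInfinity_jostFunction hq).mul (isOneAtInfinity_prod S)
  obtain ⟨R₂, hR₂⟩ := (hSfin.isBounded).exists_norm_le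
  have hC : ∀ z : ℂ, 0 < z.im → max R (R₂ + 1) ≤ ‖z‖ → ‖g z - 1‖ ≤ C / ‖z‖ := by
    intro z hz hzR
    have hzS : z ∉ S := fun h => by
      have h1 := hR₂ z (by rwa [hS, Finite.mem_toFinset] at h)
      have h2 := (le_max_right _ _).trans hzR
      linarith
    rw [hgf z hz hzS]
    exact hCR z hz ((le_max_left _ _).trans hzR)
  -- bounds near the real line
  have hwle : ∀ z : ℂ, 0 < z.im → ‖w (iFunction q) z‖ ≤ 1 := by
    intro z hz
    rw [hw, norm_prod]
    refine Finset.prod_le_one (fun _ _ => norm_nonneg _) fun p hp => ?_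
    rw [norm_div, div_le_one (norm_pos_iff.2 (hadd z hz.le p hp)),
      ← sq_le_sq₀ (norm_nonneg _) (norm_nonneg _), ← Complex.normSq_eq_norm_sq,
      ← Complex.normSq_eq_norm_sq, Complex.normSq_apply, Complex.normSq_apply]
    simp only [Complex.sub_re, Complex.sub_im, Complex.add_re, Complex.add_im, hSre p hp]
    nlinarith [((hSmem p).1 hp).1]
  -- Below half the height of the lowest zero, `‖z - p‖ ≥ p.im / 2`.
  obtain ⟨ε₁, hε₁0, hε₁⟩ : ∃ ε₁ : ℝ, 0 < ε₁ ∧ ∀ p ∈ S, ε₁ ≤ p.im / 2 := by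
    have : ∀ᶠ ε : ℝ in 𝓝[>] 0, ∀ p ∈ S, ε ≤ p.im / 2 := by
      rw [eventually_all_finset]
      intro p hp
      exact (eventually_le_nhds (half_pos ((hSmem p).1 hp).1)).filter_mono nhdsWithin_le_nhds
    obtain ⟨ε, h1, h2⟩ := (this.and self_mem_nhdsWithin).exists
    exact ⟨ε, h2, h1⟩
  have hbd : ∀ T : ℝ, ∃ c M ε₀ : ℝ, 0 < c ∧ 0 < M ∧ 0 < ε₀ ∧ ∀ z : ℂ, 0 < z.im → z.im < ε₀ →
      |z.re| ≤ T → z.re ≠ 0 → c * |z.re| ≤ ‖g z‖ ∧ ‖g z‖ ≤ M / |z.re| := by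
    intro T
    obtain ⟨c, hc, hlow⟩ := exists_mul_abs_re_le_norm_jostFunction hq (|T| + 1)
    have hB := jostBound_pos q
    refine ⟨c, jostBound q * 5 ^ S.card * (|T| + 1), min ε₁ 1, hc, by positivity,
      lt_min hε₁0 one_pos, fun z hz hzε hzT hre => ⟨?_, ?_⟩⟩
    · have hzn : ‖z‖ ≤ |T| + 1 := by
        have h1 := Complex.norm_le_abs_re_add_abs_im z
        rw [abs_of_pos hz] at h1
        have h2 := hzε.trans_le (min_le_right _ _)
        have h3 := le_abs_self T
        linarith
      refine (hlow z hz.le hzn).trans ?_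
      rw [← hf, hfg z hz, norm_mul]
      exact mul_le_of_le_one_left (norm_nonneg _) (hwle z hz)
    · have hzS : z ∉ S := fun h => hre (hSre z h)
      rw [hgf z hz hzS, norm_mul, norm_prod, le_div_iff₀ (abs_pos.2 hre)]
      -- The 5 comes from `‖z + p‖ ≤ ‖z - p‖ + 2 ‖p‖` and `‖p‖ = p.im ≤ 2 ‖z - p‖`.
      have h1 : ∏ p ∈ S, ‖(z + p) / (z - p)‖ ≤ 5 ^ S.card := by
        rw [← Finset.prod_const]
        refine Finset.prod_le_prod (fun _ _ => norm_nonneg _) fun p hp => ?_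
        have hp0 := ((hSmem p).1 hp).1
        have h2 : p.im / 2 ≤ ‖z - p‖ := by
          have h3 := (neg_le_abs _).trans (Complex.abs_im_le_norm (z - p))
          rw [Complex.sub_im] at h3
          have h4 := hzε.trans_le ((min_le_left _ _).trans (hε₁ p hp))
          linarith
        have h5 : ‖p‖ = p.im := by
          rw [← hSI p hp]; simp [abs_of_pos hp0]
        have h6 : ‖z + p‖ ≤ ‖z - p‖ + 2 * ‖p‖ := by
          have e : z + p = (z - p) + 2 * p := by ring
          rw [e]
          refine (norm_add_le _ _).trans ?_
          rw [norm_mul, Complex.norm_two]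
        rw [norm_div, div_le_iff₀ (by linarith)]
        linarith
      have h7 : |z.re| ≤ |T| + 1 := by linarith [le_abs_self T]
      have h8 := norm_jostFunction_le hq hz.le
      gcongr
  -- boundary values
  have hL : ∀ s : ℝ, s ≠ 0 → Tendsto (fun ε : ℝ => Real.log ‖g (s + ε * Complex.I)‖) (𝓝[>] 0)
      (𝓝 (Real.log ‖f s‖)) := by
    intro s hs
    have hpath : Tendsto (fun ε : ℝ => (s : ℂ) + ε * Complex.I) (𝓝[>] 0) (𝓝 (s : ℂ)) := by
      have : Continuous fun ε : ℝ => (s : ℂ) + ε * Complex.I := by fun_prop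
      exact (this.tendsto' 0 _ (by simp)).mono_left nhdsWithin_le_nhds
    have hpath' : Tendsto (fun ε : ℝ => (s : ℂ) + ε * Complex.I) (𝓝[>] 0)
        (𝓝[{k : ℂ | 0 ≤ k.im}] (s : ℂ)) := by
      refine tendsto_nhdsWithin_iff.2 ⟨hpath, ?_⟩
      filter_upwards [self_mem_nhdsWithin] with ε hε
      have hε : (0 : ℝ) < ε := hε
      change 0 ≤ ((s : ℂ) + ε * Complex.I).im
      simpa using hε.le
    have h1 : Tendsto (fun ε : ℝ => f (s + ε * Complex.I)) (𝓝[>] 0) (𝓝 (f s)) :=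
      (continuousOn_jostFunction hq (s : ℂ) (by simp)).tendsto.comp hpath'
    have hws : ‖w (iFunction q) s‖ = 1 := by
      rw [hw, norm_prod]
      refine Finset.prod_eq_one fun p hp => ?_
      have : ‖(s : ℂ) - p‖ = ‖(s : ℂ) + p‖ := by
        rw [← sq_eq_sq₀ (norm_nonneg _) (norm_nonneg _), ← Complex.normSq_eq_norm_sq,
          ← Complex.normSq_eq_norm_sq, Complex.normSq_apply, Complex.normSq_apply]
        simp only [Complex.sub_re, Complex.sub_im, Complex.add_re, Complex.add_im, hSre p hp,
          Complex.ofReal_re, Complex.ofReal_im]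
        ring
      rw [norm_div, this, div_self (norm_ne_zero_iff.2 (hadd s (by simp) p hp))]
    have h2 : Tendsto (fun ε : ℝ => w (iFunction q) (s + ε * Complex.I)) (𝓝[>] 0)
        (𝓝 (w (iFunction q) s)) := by
      simp_rw [hw]
      refine tendsto_finsetProd _ fun p hp => ?_
      exact (hpath.sub_const p).div (hpath.add_const p) (hadd s (by simp) p hp)
    have h3 := h1.norm.div h2.norm (by rw [hws]; exact one_ne_zero)
    rw [hws, div_one] at h3
    refine (((Real.continuousAt_log (norm_ne_zero_iff.2
      (jostFunction_ofReal_ne_zero hq hs))).tendsto.comp h3)).congr' ?_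
    filter_upwards [self_mem_nhdsWithin] with ε hε
    have hε : (0 : ℝ) < ε := hε
    have him : 0 < ((s : ℂ) + ε * Complex.I).im := by simpa using hε
    have hre : ((s : ℂ) + ε * Complex.I).re ≠ 0 := by simpa using hs
    have hw0 : w (iFunction q) (s + ε * Complex.I) ≠ 0 := fun h0 => by
      have := hfg _ him
      rw [h0, zero_mul] at this
      exact jostFunction_ne_zero_of_re_ne_zero hq him.le hre this
    simp only [Function.comp_apply, Pi.div_apply]
    rw [hfg _ him, norm_mul, mul_div_cancel_left₀ _ (norm_ne_zero_iff.2 hw0)]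
  obtain ⟨hInt, hexp⟩ := eq_exp_integral_log_boundary hgd hg0 hC hbd hL hz
  refine ⟨hInt, ?_⟩
  rw [← hexp, hfg z hz, mul_comm]

lemma ae_integrand_eq (hq : InL11 q) (z : ℂ) :
    integrand (iFunction q) z =ᵐ[volume]
      fun s : ℝ => ((2 * Real.log ‖jostFunction q s‖ : ℝ) : ℂ) / ((s : ℂ) - z) := by
  have hne : ∀ᵐ s : ℝ, s ≠ 0 := by simp [ae_iff, measure_singleton]
  filter_upwards [hne] with s hs
  rw [integrand, div_im_iFunction hq hs, Real.log_pow]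
  norm_num

lemma jostFunction_eq_exp_integrand (hq : InL11 q) {z : ℂ} (hz : 0 < z.im) :
    Integrable (integrand (iFunction q) z) ∧
      jostFunction q z = Complex.exp (1 / (2 * Real.pi * Complex.I) *
        ∫ s : ℝ, integrand (iFunction q) z s) * w (iFunction q) z := by
  obtain ⟨h1, h2⟩ := jostFunction_representation hq hz
  refine ⟨(integrable_congr (ae_integrand_eq hq z)).2 h1, ?_⟩
  rw [integral_congr_ae (ae_integrand_eq hq z)]
  exact h2

/-- The Cauchy integral of `log ((s² + 1) / s²)`. -/
lemma exp_integral_log_norm_add_I_div {z : ℂ} (hz : 0 < z.im) :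
    Integrable (fun s : ℝ =>
      ((2 * Real.log ‖((s : ℂ) + Complex.I) / s‖ : ℝ) : ℂ) / ((s : ℂ) - z)) ∧
      (z + Complex.I) / z = Complex.exp (1 / (2 * Real.pi * Complex.I) *
        ∫ s : ℝ, ((2 * Real.log ‖((s : ℂ) + Complex.I) / s‖ : ℝ) : ℂ) / ((s : ℂ) - z)) := by
  have hne : ∀ z : ℂ, 0 < z.im → z ≠ 0 := by rintro z hz rfl; simp at hz
  have hne' : ∀ z : ℂ, 0 ≤ z.im → z + Complex.I ≠ 0 := fun z hz h => by
    have := congrArg Complex.im h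
    simp at this
    linarith
  refine eq_exp_integral_log_boundary (g := fun z => (z + Complex.I) / z) (C := 1) (R := 1)
    (L := fun s : ℝ => Real.log ‖((s : ℂ) + Complex.I) / s‖) ?_ ?_ ?_ ?_ ?_ hz
  · exact DifferentiableOn.div (by fun_prop) (by fun_prop) hne
  · exact fun z hz => div_ne_zero (hne' z hz.le) (hne z hz)
  · intro z hz _
    have h0 := hne z hz
    have e : (z + Complex.I) / z - 1 = Complex.I / z := by field_simp; ring
    rw [e, norm_div, Complex.norm_I]
  -- The pole at 0 is what the bound `M / |Re z|` in the hypothesis allows for.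
  · intro T
    refine ⟨1 / ((|T| + 1) * (|T| + 1)), |T| + 2, 1, by positivity, by positivity, one_pos,
      fun z hz hz1 hzT hre => ?_⟩
    have hs : 0 < |z.re| := abs_pos.2 hre
    have hzT' : |z.re| ≤ |T| := hzT.trans (le_abs_self T)
    have hzn : ‖z‖ ≤ |T| + 1 := by
      have h1 := Complex.norm_le_abs_re_add_abs_im z
      rw [abs_of_pos hz] at h1
      linarith
    have hzp : 0 < ‖z‖ := norm_pos_iff.2 (hne z hz)
    have h1 : 1 ≤ ‖z + Complex.I‖ := by
      have := (le_abs_self _).trans (Complex.abs_im_le_norm (z + Complex.I))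
      rw [Complex.add_im, Complex.I_im] at this
      linarith
    have h2 : ‖z + Complex.I‖ ≤ |T| + 2 := by
      have := norm_add_le z Complex.I
      rw [Complex.norm_I] at this
      linarith
    rw [norm_div]
    constructor
    · calc 1 / ((|T| + 1) * (|T| + 1)) * |z.re| ≤ 1 / ((|T| + 1) * (|T| + 1)) * (|T| + 1) := by
            gcongr; linarith
        _ = 1 / (|T| + 1) := by field_simp
        _ ≤ _ := by gcongr
    · gcongr
      exact Complex.abs_re_le_norm z
  · intro s hs
    have hs' : (s : ℂ) ≠ 0 := Complex.ofReal_ne_zero.2 hs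
    have hpath : Tendsto (fun ε : ℝ => (s : ℂ) + ε * Complex.I) (𝓝[>] 0) (𝓝 (s : ℂ)) := by
      have : Continuous fun ε : ℝ => (s : ℂ) + ε * Complex.I := by fun_prop
      exact (this.tendsto' 0 _ (by simp)).mono_left nhdsWithin_le_nhds
    have h1 := ((hpath.add_const Complex.I).div hpath hs').norm
    exact (Real.continuousAt_log (norm_ne_zero_iff.2
      (div_ne_zero (hne' s (by simp)) hs'))).tendsto.comp h1

lemma ae_integrand₁_eq (hq : InL11 q) (z : ℂ) :
    integrand₁ (iFunction q) z =ᵐ[volume] fun s : ℝ =>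
      ((2 * Real.log ‖jostFunction q s‖ : ℝ) : ℂ) / ((s : ℂ) - z) +
        ((2 * Real.log ‖((s : ℂ) + Complex.I) / s‖ : ℝ) : ℂ) / ((s : ℂ) - z) := by
  have hne : ∀ᵐ s : ℝ, s ≠ 0 := by simp [ae_iff, measure_singleton]
  filter_upwards [hne] with s hs
  have hf : ‖jostFunction q s‖ ≠ 0 := norm_ne_zero_iff.2 (jostFunction_ofReal_ne_zero hq hs)
  have hn : ‖((s : ℂ) + Complex.I) / s‖ ^ 2 = (s ^ 2 + 1) / s ^ 2 := by
    rw [norm_div, div_pow, ← Complex.normSq_eq_norm_sq, ← Complex.normSq_eq_norm_sq,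
      Complex.normSq_apply, Complex.normSq_ofReal]
    simp [pow_two]
  have hlog : Real.log ((s ^ 2 + 1) / (s * (iFunction q s).im)) =
      2 * Real.log ‖jostFunction q s‖ + 2 * Real.log ‖((s : ℂ) + Complex.I) / s‖ := by
    have e : (s ^ 2 + 1) / (s * (iFunction q s).im) =
        ‖jostFunction q s‖ ^ 2 * ‖((s : ℂ) + Complex.I) / s‖ ^ 2 := by
      rw [im_iFunction_ofReal hq, hn]
      field_simp
    have h2 : ‖((s : ℂ) + Complex.I) / s‖ ^ 2 ≠ 0 := by
      rw [hn]; positivity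
    rw [e, Real.log_mul (pow_ne_zero 2 hf) h2, Real.log_pow, Real.log_pow]
    norm_num
  rw [integrand₁, hlog, ← add_div, Complex.ofReal_add]

/-- Since `(s² + 1) / (s Im I) = |f|² |(s + i)/s|²`, the new exponential is the old one times `(z +
i)/z`, which cancels the extra factor of `w₁`. -/
lemma jostFunction_eq_exp_integrand₁ (hq : InL11 q) {z : ℂ} (hz : 0 < z.im) :
    Integrable (integrand₁ (iFunction q) z) ∧
      jostFunction q z = Complex.exp (1 / (2 * Real.pi * Complex.I) *
        ∫ s : ℝ, integrand₁ (iFunction q) z s) * w₁ (iFunction q) z := by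
  obtain ⟨h1, h2⟩ := jostFunction_representation hq hz
  obtain ⟨h3, h4⟩ := exp_integral_log_norm_add_I_div hz
  refine ⟨(integrable_congr (ae_integrand₁_eq hq z)).2 (h1.add h3), ?_⟩
  rw [integral_congr_ae (ae_integrand₁_eq hq z), integral_add h1 h3, mul_add, Complex.exp_add,
    ← h4, w₁]
  have hz0 : z ≠ 0 := by rintro rfl; simp at hz
  have hzI : z + Complex.I ≠ 0 := fun h => by
    have := congrArg Complex.im h
    simp at this
    linarith
  rw [h2]
  field_simp

/-! ### The I-function on the positive half-line determines the Jost function -/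

section Uniqueness

variable {q' : ℝ → ℝ}

lemma iFunction_eq_of_ne_zero (hq : InL11 q) (hq' : InL11 q')
    (h : ∀ k : ℝ, 0 < k → iFunction q' k = iFunction q k) {s : ℝ} (hs : s ≠ 0) :
    iFunction q' s = iFunction q s := by
  rcases lt_or_gt_of_ne hs with hneg | hpos
  · have e := h (-s) (by linarith)
    rw [iFunction_neg_ofReal hq, iFunction_neg_ofReal hq'] at e
    exact (starRingEnd ℂ).injective e
  · exact h s hpos

/-- If the I-functions agree on the positive half-line, then so do the logarithmic derivatives
at the origin in the whole upper half-plane. -/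
lemma jostDeriv_mul_eq (hq : InL11 q) (hq' : InL11 q')
    (h : ∀ k : ℝ, 0 < k → iFunction q' k = iFunction q k) {z : ℂ} (hz : 0 ≤ z.im) :
    jostDeriv q' z * jostFunction q z = jostDeriv q z * jostFunction q' z := by
  set D : ℂ → ℂ := fun z => jostDeriv q' z * jostFunction q z - jostDeriv q z * jostFunction q' z
    with hD
  have hDc : ContinuousOn D {k : ℂ | 0 ≤ k.im} :=
    ((continuousOn_jostDeriv hq').mul (continuousOn_jostFunction hq)).sub
      ((continuousOn_jostDeriv hq).mul (continuousOn_jostFunction hq'))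
  have hDd : DifferentiableOn ℂ D {k : ℂ | 0 < k.im} :=
    ((differentiableOn_jostDeriv hq').mul (differentiableOn_jostFunction hq)).sub
      ((differentiableOn_jostDeriv hq).mul (differentiableOn_jostFunction hq'))
  have hDreal : ∀ s : ℝ, D s = 0 := by
    have hcr : Continuous fun s : ℝ => D s := by
      rw [← continuousOn_univ]
      exact hDc.comp Complex.continuous_ofReal.continuousOn fun s _ => by simp
    have hne : ∀ s : ℝ, s ≠ 0 → D s = 0 := by
      intro s hs
      have e := iFunction_eq_of_ne_zero hq hq' h hs
      rw [iFunction_eq, iFunction_eq, div_eq_div_iff (jostFunction_ofReal_ne_zero hq' hs)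
        (jostFunction_ofReal_ne_zero hq hs)] at e
      rw [hD]; simp only; rw [e, sub_self]
    intro s
    -- At 0 the Jost functions may vanish and the quotients say nothing, so continuity of `D` is
    -- used.
    by_cases hs : s = 0
    · subst hs
      have h1 := (hcr.tendsto 0).mono_left (nhdsWithin_le_nhds (s := {0}ᶜ))
      refine tendsto_nhds_unique h1 (tendsto_const_nhds.congr' ?_)
      filter_upwards [self_mem_nhdsWithin] with s hs using (hne s hs).symm
    · exact hne s hs
  -- `D` grows at most linearly, and division by `k + i` makes it bounded.
  set K := (1 + tail q' 0) * jostBound q' * jostBound q +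
    (1 + tail q 0) * jostBound q * jostBound q'
  have hB := jostBound_pos q
  have hB' := jostBound_pos q'
  have ht := tail_nonneg q 0
  have ht' := tail_nonneg q' 0
  have hnorm : ∀ k : ℂ, 0 ≤ k.im → ‖k‖ ≤ ‖k + Complex.I‖ ∧ 1 ≤ ‖k + Complex.I‖ := by
    intro k hk
    constructor
    · rw [← sq_le_sq₀ (norm_nonneg _) (norm_nonneg _), ← Complex.normSq_eq_norm_sq,
        ← Complex.normSq_eq_norm_sq, Complex.normSq_apply, Complex.normSq_apply]
      simp only [Complex.add_im, Complex.add_re, Complex.I_im, Complex.I_re, add_zero]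
      nlinarith
    · have := (le_abs_self _).trans (Complex.abs_im_le_norm (k + Complex.I))
      rw [Complex.add_im, Complex.I_im] at this
      linarith
  have hbound : ∀ k : ℂ, 0 ≤ k.im → ‖D k / (k + Complex.I)‖ ≤ K := by
    intro k hk
    obtain ⟨h1, h2⟩ := hnorm k hk
    rw [norm_div, div_le_iff₀ (by linarith)]
    have a1 : ‖jostDeriv q' k * jostFunction q k‖ ≤
        ((‖k‖ + tail q' 0) * jostBound q') * jostBound q := by
      rw [norm_mul]
      exact mul_le_mul (norm_jostDeriv_le hq' hk) (norm_jostFunction_le hq hk) (norm_nonneg _)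
        (by positivity)
    have a2 : ‖jostDeriv q k * jostFunction q' k‖ ≤
        ((‖k‖ + tail q 0) * jostBound q) * jostBound q' := by
      rw [norm_mul]
      exact mul_le_mul (norm_jostDeriv_le hq hk) (norm_jostFunction_le hq' hk) (norm_nonneg _)
        (by positivity)
    have b : ∀ t : ℝ, 0 ≤ t → ‖k‖ + t ≤ (1 + t) * ‖k + Complex.I‖ := fun t ht => by nlinarith
    calc ‖D k‖ ≤ _ := norm_sub_le _ _
      _ ≤ ((‖k‖ + tail q' 0) * jostBound q') * jostBound q +
          ((‖k‖ + tail q 0) * jostBound q) * jostBound q' := add_le_add a1 a2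
      _ ≤ (((1 + tail q' 0) * ‖k + Complex.I‖) * jostBound q') * jostBound q +
          (((1 + tail q 0) * ‖k + Complex.I‖) * jostBound q) * jostBound q' := by
        gcongr
        · exact b _ ht'
        · exact b _ ht
      _ = _ := by ring
  -- rotate to the right half-plane
  set F : ℂ → ℂ := fun ζ => D (Complex.I * ζ) / (Complex.I * ζ + Complex.I) with hF
  have him : ∀ ζ : ℂ, (Complex.I * ζ).im = ζ.re := fun ζ => by simp
  have hden : ∀ ζ : ℂ, 0 ≤ ζ.re → Complex.I * ζ + Complex.I ≠ 0 := fun ζ hζ =>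
    norm_pos_iff.1 (lt_of_lt_of_le one_pos (hnorm _ (by rw [him]; exact hζ)).2)
  have hFd : DiffContOnCl ℂ F {ζ : ℂ | 0 < ζ.re} := by
    refine ⟨?_, ?_⟩
    · refine DifferentiableOn.div (hDd.comp (by fun_prop) fun ζ hζ => ?_) (by fun_prop)
        fun ζ hζ => hden ζ (le_of_lt hζ)
      change 0 < (Complex.I * ζ).im
      rw [him]; exact hζ
    · rw [Complex.closure_setOfPred_lt_re]
      refine ContinuousOn.div (hDc.comp (by fun_prop) fun ζ hζ => ?_) (by fun_prop)
        fun ζ hζ => hden ζ hζ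
      change 0 ≤ (Complex.I * ζ).im
      rw [him]; exact hζ
  have hFb : ∀ ζ : ℂ, 0 ≤ ζ.re → ‖F ζ‖ ≤ K := fun ζ hζ => hbound _ (by rw [him]; exact hζ)
  have hFz := PhragmenLindelof.right_half_plane_of_bounded_on_real (C := 0)
    (z := -Complex.I * z) hFd
    -- Growth exponent `1 < 2` with coefficient 0, as `F` is bounded.
    ⟨1, by norm_num, 0, by
      refine Asymptotics.IsBigO.of_bound K ?_
      refine eventually_inf_principal.2 (Eventually.of_forall fun ζ hζ => ?_)
      simpa using hFb ζ (le_of_lt hζ)⟩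
    ⟨K, eventually_map.2 (by
      filter_upwards [eventually_ge_atTop 0] with x hx
      exact hFb x (by simpa using hx))⟩
    (fun x => by
      have e : Complex.I * ((x : ℂ) * Complex.I) = ((-x : ℝ) : ℂ) := by
        push_cast; linear_combination (x : ℂ) * Complex.I_sq
      rw [hF]; simp only
      rw [e, hDreal, zero_div, norm_zero])
    (by simpa using hz)
  have e : Complex.I * (-Complex.I * z) = z := by linear_combination (-z) * Complex.I_sq
  rw [norm_le_zero_iff, hF] at hFz
  simp only [e] at hFz
  have hzI : z + Complex.I ≠ 0 := norm_pos_iff.1 (lt_of_lt_of_le one_pos (hnorm z hz).2)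
  exact sub_eq_zero.1 ((div_eq_zero_iff.1 hFz).resolve_right hzI)

/-- At a zero of one Jost function its derivative datum is nonzero, so the cross relation forces the
other Jost function to vanish as well. -/
lemma boundStates_eq (hq : InL11 q) (hq' : InL11 q')
    (h : ∀ k : ℝ, 0 < k → iFunction q' k = iFunction q k) : boundStates q' = boundStates q := by
  ext κ
  rw [mem_boundStates_iff hq, mem_boundStates_iff hq']
  refine and_congr_right fun hκ => ?_
  have him : 0 ≤ (Complex.I * (κ : ℂ)).im := by simpa using hκ.le
  have e := jostDeriv_mul_eq hq hq' h him
  constructor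
  · intro h0
    rw [h0, mul_zero] at e
    exact (mul_eq_zero.1 e).resolve_left (jostDeriv_ne_zero_of_jostFunction_eq_zero hq' him h0)
  · intro h0
    rw [h0, mul_zero] at e
    exact (mul_eq_zero.1 e.symm).resolve_left (jostDeriv_ne_zero_of_jostFunction_eq_zero hq him h0)

/-- The formula involves `I` only through its values at almost every real point and its poles, and
both agree. -/
lemma eqOn_jostFunction (hq : InL11 q) (hq' : InL11 q')
    (h : ∀ k : ℝ, 0 < k → iFunction q' k = iFunction q k) :
    EqOn (jostFunction q') (jostFunction q) upperHalf := by
  intro z hz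
  have hz : 0 < z.im := hz
  have hne : ∀ᵐ s : ℝ, s ≠ 0 := by simp [ae_iff, measure_singleton]
  have hInt : ∫ s : ℝ, integrand (iFunction q') z s = ∫ s : ℝ, integrand (iFunction q) z s := by
    refine integral_congr_ae ?_
    filter_upwards [hne] with s hs
    rw [integrand, integrand, iFunction_eq_of_ne_zero hq hq' h hs]
  have hw : w (iFunction q') z = w (iFunction q) z := by
    rw [w, w, upperPoles_iFunction hq, upperPoles_iFunction hq', boundStates_eq hq hq' h]
  rw [(jostFunction_eq_exp_integrand hq' hz).2, (jostFunction_eq_exp_integrand hq hz).2, hInt, hw]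

end Uniqueness

end Schrodinger

theorem mainTheorem3 (q : ℝ → ℝ) (hq : Schrodinger.InL11 q) :
    -- the Jost solution exists and is unique, so `f` and `I` are well defined
    (∀ k : ℂ, 0 ≤ k.im → ∃ u v : ℝ → ℂ, Schrodinger.IsJostSolution q k u v ∧
      ∀ u' v' : ℝ → ℂ, Schrodinger.IsJostSolution q k u' v' →
        Set.EqOn u' u (Set.Ici 0) ∧ Set.EqOn v' v (Set.Ici 0)) ∧
    -- `I` is meromorphic in the upper half-plane; its poles there are the finitely many `i k_j`,
    -- and they are simple
    MeromorphicOn (Schrodinger.iFunction q) Schrodinger.upperHalf ∧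
    (Schrodinger.boundStates q).Finite ∧
    Schrodinger.upperPoles (Schrodinger.iFunction q) =
      (fun κ : ℝ => Complex.I * (κ : ℂ)) '' Schrodinger.boundStates q ∧
    (∀ p ∈ Schrodinger.upperPoles (Schrodinger.iFunction q),
      meromorphicOrderAt (Schrodinger.iFunction q) p = -1) ∧
    -- the logarithm is taken of a positive number
    (∀ s : ℝ, s ≠ 0 → 0 < s / (Schrodinger.iFunction q s).im) ∧
    -- the formula for `f` in terms of `I`, whether or not `f(0) = 0`
    (∀ z : ℂ, 0 < z.im →
      MeasureTheory.Integrable (Schrodinger.integrand (Schrodinger.iFunction q) z) ∧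
      Schrodinger.jostFunction q z =
        Complex.exp (1 / (2 * Real.pi * Complex.I) *
          ∫ s : ℝ, Schrodinger.integrand (Schrodinger.iFunction q) z s) *
        Schrodinger.w (Schrodinger.iFunction q) z) ∧
    -- the second formula, when `f(0) = 0`
    (Schrodinger.jostFunction q 0 = 0 → ∀ z : ℂ, 0 < z.im →
      MeasureTheory.Integrable (Schrodinger.integrand₁ (Schrodinger.iFunction q) z) ∧
      Schrodinger.jostFunction q z =
        Complex.exp (1 / (2 * Real.pi * Complex.I) *
          ∫ s : ℝ, Schrodinger.integrand₁ (Schrodinger.iFunction q) z s) *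
        Schrodinger.w₁ (Schrodinger.iFunction q) z) ∧
    -- the values `I(k)`, `k > 0`, determine the `k_j`, their number, and `f`
    (∀ q' : ℝ → ℝ, Schrodinger.InL11 q' →
      (∀ k : ℝ, 0 < k → Schrodinger.iFunction q' k = Schrodinger.iFunction q k) →
      Schrodinger.boundStates q' = Schrodinger.boundStates q ∧
      Set.EqOn (Schrodinger.jostFunction q') (Schrodinger.jostFunction q)
        Schrodinger.upperHalf) := by
  refine ⟨fun k hk => ⟨_, _, Schrodinger.isJostSolution_jostSol hq hk, fun u v h => h.eqOn hq hk⟩,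
    fun p hp => Schrodinger.meromorphicAt_iFunction hq hp, Schrodinger.finite_boundStates hq,
    Schrodinger.upperPoles_iFunction hq, fun p hp => ?_, fun s hs => ?_,
    fun z hz => Schrodinger.jostFunction_eq_exp_integrand hq hz,
    fun _ z hz => Schrodinger.jostFunction_eq_exp_integrand₁ hq hz,
    fun q' hq' h => ⟨Schrodinger.boundStates_eq hq hq' h, Schrodinger.eqOn_jostFunction hq hq' h⟩⟩
  · obtain ⟨h1, h2⟩ := (Schrodinger.mem_upperPoles_iff hq).1 hp
    exact Schrodinger.meromorphicOrderAt_iFunction_of_eq_zero hq h1 h2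
  · rw [Schrodinger.div_im_iFunction hq hs]
    have := norm_pos_iff.2 (Schrodinger.jostFunction_ofReal_ne_zero hq hs)
    positivity
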